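/- Theorem 4.1. Let $\mathbb{H}^3$ be hyperbolic 3-space of curvature $-1$. Let $N$ be a compact smooth 2-manifold without boundary, let $F_0:N\to\mathbb{H}^3$ be a smooth embedding, and let $\Sigma_0=F_0(N)$. For a compact set $S\subset\mathbb{H}^3$ let $\mathrm{Vol}(S)$ be the volume of the domain enclosed by $S$, that is, of the union of the bounded connected components of $\mathbb{H}^3\setminus S$. A mean curvature flow starting from $F_0$ on $[0,T)$ is a smooth map $F:N\times[0,T)\to\mathbb{H}^3$ with $F(\cdot,0)=F_0$ such that every $F(\cdot,t)$ is an immersion and $$\partial_t F=-H\nu ,$$ where $\nu$ is a unit normal and $H=\tfrac12(k_1+k_2)$ is the mean curvature with respect to $\nu$ (the vector $H\nu$ does not depend on the choice of $\nu$; with respect to the outer unit normal geodesic spheres have $H>0$). Suppose that the mean curvature flow of $\Sigma_0$ has no singularity before the enclosed volume shrinks to zero: for some $T\in(0,\infty)$ there is a mean curvature flow $F$ starting from $F_0$ on $[0,T)$ such that $\mathrm{Vol}(F(N,t))\to 0$ as $t\to T$. Let $\bar\Sigma$ be a geodesic sphere (of positive radius) in $\mathbb{H}^3$ with $\mathrm{Vol}(\bar\Sigma)=\mathrm{Vol}(\Sigma_0)$.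 Then $$\mathrm{Area}(\Sigma_0)\ \ge\ \mathrm{Area}(\bar\Sigma).$$ Moreover, if equality holds, then $\Sigma_0$ is a geodesic sphere. -/

import Mathlib

open Set Filter Topology MeasureTheory
open scoped Manifold ContDiff RealInnerProductSpace ENNReal

noncomputable section

namespace Hyp3

/-- Parameter plane of a surface. -/
abbrev E2 : Type := EuclideanSpace ℝ (Fin 2)

/-- The coordinate space that contains the upper half-space. -/
abbrev E3 : Type := EuclideanSpace ℝ (Fin 3)

/-! ### Hyperbolic space (upper half-space model, curvature `-1`) -/

/-- Hyperbolic 3-space `ℍ³` as the upper half-space `{x : x₂ > 0}` (coordinates `x₀, x₁, x₂`). -/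
def H3 : Set E3 := {x | 0 < x 2}

/-- The hyperbolic metric `g = (dx₀² + dx₁² + dx₂²) / x₂²` at the point `x`. -/
def metric (x v w : E3) : ℝ := ⟪v, w⟫ / x 2 ^ 2

/-- The Christoffel symbols of the hyperbolic metric at `x`, as a bilinear map
`(v, w) ↦ ∑ Γᵏᵢⱼ vⁱ wʲ eₖ`. This is the unique symmetric bilinear map with
`D_u g(v, w) = g(Γ(u, v), w) + g(v, Γ(u, w))` for all constant vectors `u, v, w`. -/
def christoffel (x v w : E3) : E3 :=
  (1 / x 2) • (⟪v, w⟫ • EuclideanSpace.single (2 : Fin 3) (1 : ℝ) - v 2 • w - w 2 • v)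

/-- The hyperbolic (geodesic) distance, `sinh (d / 2) = |x - y| / (2 √(x₂ y₂))`. -/
def hdist (x y : E3) : ℝ := 2 * Real.arsinh (dist x y / (2 * √(x 2 * y 2)))

/-- The geodesic sphere with centre `p` and radius `r`. -/
def geodesicSphere (p : E3) (r : ℝ) : Set E3 := {x ∈ H3 | hdist p x = r}

/-- The hyperbolic volume of a subset of `ℍ³`: the volume element is `dx / x₂³`. -/
def hvolume (A : Set E3) : ℝ≥0∞ := ∫⁻ x in A, ENNReal.ofReal (1 / x 2 ^ 3)

/-- The domain enclosed by `S`: the union of those connected components of `ℍ³ \ S` that are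
bounded in the hyperbolic distance. -/
def enclosed (S : Set E3) : Set E3 :=
  {x ∈ H3 \ S | ∃ R : ℝ, ∀ y ∈ connectedComponentIn (H3 \ S) x, hdist x y ≤ R}

/-- The volume enclosed by `S`. -/
def enclosedVolume (S : Set E3) : ℝ≥0∞ := hvolume (enclosed S)

/-! ### Geometry of parametrized surfaces in `ℍ³` -/

/-- The coordinate tangent vector `∂ᵢ f` at `u`. -/
def tangent (f : E2 → E3) (u : E2) (i : Fin 2) : E3 :=
  fderiv ℝ f u (EuclideanSpace.single i 1)

/-- The first fundamental form `g(∂ᵢ f, ∂ⱼ f)` of `f` at `u`. -/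
def firstForm (f : E2 → E3) (u : E2) : Matrix (Fin 2) (Fin 2) ℝ :=
  Matrix.of fun i j => metric (f u) (tangent f u i) (tangent f u j)

/-- The Levi-Civita covariant derivative `∇ᵢ ∂ⱼ f = ∂ᵢ ∂ⱼ f + Γ(∂ᵢ f, ∂ⱼ f)` along `f` at `u`. -/
def covDeriv (f : E2 → E3) (u : E2) (i j : Fin 2) : E3 :=
  fderiv ℝ (fun w => tangent f w j) u (EuclideanSpace.single i 1)
    + christoffel (f u) (tangent f u i) (tangent f u j)

/-- The second fundamental form `hᵢⱼ = - g(∇ᵢ ∂ⱼ f, ν)` of `f` at `u` with respect to `ν`. -/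
def secondForm (f : E2 → E3) (u : E2) (ν : E3) : Matrix (Fin 2) (Fin 2) ℝ :=
  Matrix.of fun i j => - metric (f u) (covDeriv f u i j) ν

/-- `ν` is a unit normal vector of `f` at `u`. -/
def IsUnitNormal (f : E2 → E3) (u : E2) (ν : E3) : Prop :=
  metric (f u) ν ν = 1 ∧ ∀ i, metric (f u) (tangent f u i) ν = 0

/-- The mean curvature `H = (k₁ + k₂) / 2` of `f` at `u` with respect to the unit normal `ν`.
With `ν` the outer normal, geodesic spheres of radius `r` have `H = coth r`. -/
def meanCurvature (f : E2 → E3) (u : E2) (ν : E3) : ℝ :=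
  ((firstForm f u)⁻¹ * secondForm f u ν).trace / 2

/-- `φ` restricted to the open set `U` is a smooth injective immersion with values in `S ∩ ℍ³`. -/
structure IsLocalParam (S : Set E3) (U : Set E2) (φ : E2 → E3) : Prop where
  isOpen : IsOpen U
  smooth : ContDiffOn ℝ ∞ φ U
  injOn : InjOn φ U
  immersion : ∀ u ∈ U, Function.Injective (fderiv ℝ φ u)
  mapsTo : MapsTo φ U (S ∩ H3)

/-- The area measure of a surface `S` in `ℍ³`: the least measure that dominates the push-forward of
`√(det gᵢⱼ) du` under every local parametrization of `S`. For an embedded surface these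
push-forwards agree where they overlap, and this is the Riemannian area measure of the metric
induced on `S`. -/
def areaMeasure (S : Set E3) : Measure E3 :=
  ⨆ (U : Set E2) (φ : E2 → E3) (_ : IsLocalParam S U φ),
    Measure.map φ ((volume.restrict U).withDensity
      fun u => ENNReal.ofReal √(firstForm φ u).det)

/-- The hyperbolic area of a surface. -/
def area (S : Set E3) : ℝ≥0∞ := areaMeasure S univ

/-! ### Mean curvature flow -/

section Flow

variable {N : Type*} [TopologicalSpace N] [ChartedSpace E2 N]

/-- The map `F : N → ℍ³` in the preferred chart of the surface `N` at `x`. -/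
def inChart (F : N → E3) (x : N) : E2 → E3 := F ∘ (extChartAt (𝓡 2) x).symm

/-- `F` is a smooth mean curvature flow `∂ₜ F = - H ν` of immersed surfaces in `ℍ³` on the time
interval `[0, T)`. The vector `H ν` does not change when `ν` is replaced by `-ν`, so that
the equation for the outer unit normal is the equation for any unit normal. -/
structure IsMeanCurvatureFlow (T : ℝ) (F : ℝ → N → E3) : Prop where
  mem : ∀ t ∈ Ico 0 T, ∀ x, F t x ∈ H3
  smooth : ContMDiffOn (𝓘(ℝ, ℝ).prod (𝓡 2)) 𝓘(ℝ, E3) ∞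
    (fun q : ℝ × N => F q.1 q.2) (Ico 0 T ×ˢ univ)
  immersion : ∀ t ∈ Ico 0 T, ∀ x, Function.Injective (mfderiv (𝓡 2) 𝓘(ℝ, E3) (F t) x)
  evolution : ∀ t ∈ Ico 0 T, ∀ (x : N) (ν : E3),
    IsUnitNormal (inChart (F t) x) (extChartAt (𝓡 2) x x) ν →
      HasDerivWithinAt (fun s => F s x)
        (-(meanCurvature (inChart (F t) x) (extChartAt (𝓡 2) x x) ν • ν)) (Ico 0 T) t

/-- The mean curvature flow starting from `F₀` has no singularity before the enclosed volume
shrinks to zero: it is smooth on some `[0, T)`, and the enclosed volume tends to zero as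
`t → T`. -/
def NoSingularityBeforeVolumeVanishes (F₀ : N → E3) : Prop :=
  ∃ T : ℝ, 0 < T ∧ ∃ F : ℝ → N → E3, F 0 = F₀ ∧ IsMeanCurvatureFlow T F ∧
    Tendsto (fun t => enclosedVolume (range (F t))) (𝓝[<] T) (𝓝 0)

end Flow

end Hyp3

end

/-! Along the flow write A for the area, W for the integral of H² and C for the integral of |H| over
the evolving surface. The first variation formula gives A' = -2W, and the volume swept out up to
time t is at most ∫₀ᵗ C. Two inequalities link these quantities: Cauchy-Schwarz, C² ≤ W·A, and the
Willmore inequality W - A ≥ 4π for closed embedded surfaces in hyperbolic space (`willmore_ge`).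

Let φ = `isoVol` be the volume of a geodesic ball as a function of its boundary area, so that φ'(A)
= ½√(A/(4π+A)). Then (φ(A) + ∫₀ᵗ C)' = C - √(A/(4π+A))·W, and the two inequalities make this
nonpositive. Hence the swept volume never exceeds φ(A(0)). A point enclosed at time 0 is either
still enclosed at time t or has been hit by the surface, so Vol(0) ≤ Vol(t) + swept volume. Letting
Vol(t) tend to 0 gives Vol(0) ≤ φ(A(0)), and φ is strictly increasing. If equality holds, the
Willmore inequality must be an equality at time 0: a strict inequality would persist for a short
time, φ(A) + ∫C would drop strictly, and the same bound started from that later time would fail.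

The Willmore inequality comes from one vector field, essentially the gradient of log(|y-p|²/y₂). For
p off the surface the divergence theorem turns its flux into W - A = ∫ (deviation)², where the
deviation is that of the mean curvature from the curvature of the sphere through p tangent to the
surface (`integral_deviation_sq`). Let p approach a point f(a) of the surface along the normal. On
the scale of the distance to f(a) the integrand becomes the stereographic density 4/(1+|z|²)², of
mass 4π; Fatou's lemma gives 4π + ∫ (deviation with p = f(a))² ≤ W - A. In the equality case the
deviation vanishes for every pair of points, which places the surface on a Euclidean sphere inside
the half-space, that is, on a geodesic sphere.

Both the Willmore argument and the topology of the enclosed domain use that the surface stays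
embedded. This is a two-point maximum principle (`IsMeanCurvatureFlow.injective`): at a locally
closest pair of distinct points the squared Euclidean distance decreases at most at a bounded
exponential rate. Given embeddedness, nearby surfaces are related by ambient homeomorphisms close to
the identity, so a point that is not hit keeps the boundedness of its complementary component
(`IsMeanCurvatureFlow.enclosed_subset`).

For the comparison sphere one-sided estimates suffice: its enclosed volume is at least, and its area
at most, the classical value. For the initial surface it is enough that its area measure dominates
the integral of the area density. -/

noncomputable section

namespace Hyp3

/-! ### The cross product -/

/-- The cross product of `ℝ³` as a bilinear map. -/
def cross : E3 →L[ℝ] E3 →L[ℝ] E3 :=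
  (LinearMap.mk₂ ℝ (fun a b : E3 =>
    (!₂[a 1 * b 2 - a 2 * b 1, a 2 * b 0 - a 0 * b 2, a 0 * b 1 - a 1 * b 0] : E3))
    (by intro a b c; ext i; fin_cases i <;> simp <;> ring)
    (by intro a b c; ext i; fin_cases i <;> simp <;> ring)
    (by intro a b c; ext i; fin_cases i <;> simp <;> ring)
    (by intro a b c; ext i; fin_cases i <;> simp <;> ring)).toContinuousBilinearMap

theorem cross_zero (a b : E3) : cross a b 0 = a 1 * b 2 - a 2 * b 1 := by simp [cross]
theorem cross_one (a b : E3) : cross a b 1 = a 2 * b 0 - a 0 * b 2 := by simp [cross]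
theorem cross_two (a b : E3) : cross a b 2 = a 0 * b 1 - a 1 * b 0 := by simp [cross]

theorem inner_coord (a b : E3) : ⟪a, b⟫ = a 0 * b 0 + a 1 * b 1 + a 2 * b 2 := by
  simp [PiLp.inner_apply, Fin.sum_univ_three]; ring

theorem norm_sq_coord (a : E3) : ‖a‖ ^ 2 = a 0 ^ 2 + a 1 ^ 2 + a 2 ^ 2 := by
  rw [← real_inner_self_eq_norm_sq, inner_coord]; ring

theorem cross_swap (a b : E3) : cross a b = -cross b a := by
  ext i; fin_cases i <;> simp [cross_zero, cross_one, cross_two] <;> ring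

theorem cross_self (a : E3) : cross a a = 0 := by
  ext i; fin_cases i <;> simp [cross_zero, cross_one, cross_two] <;> ring

theorem inner_cross_left (a b : E3) : ⟪cross a b, a⟫ = 0 := by
  rw [inner_coord, cross_zero, cross_one, cross_two]; ring

theorem inner_cross_right (a b : E3) : ⟪cross a b, b⟫ = 0 := by
  rw [inner_coord, cross_zero, cross_one, cross_two]; ring

theorem inner_cross_rotate (a b c : E3) : ⟪cross a b, c⟫ = ⟪a, cross b c⟫ := by
  simp only [inner_coord, cross_zero, cross_one, cross_two]; ring

theorem inner_cross_cross (a b c d : E3) :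
    ⟪cross a b, cross c d⟫ = ⟪a, c⟫ * ⟪b, d⟫ - ⟪a, d⟫ * ⟪b, c⟫ := by
  simp only [inner_coord, cross_zero, cross_one, cross_two]; ring

theorem norm_cross_sq (a b : E3) :
    ‖cross a b‖ ^ 2 = ⟪a, a⟫ * ⟪b, b⟫ - ⟪a, b⟫ ^ 2 := by
  rw [← real_inner_self_eq_norm_sq, inner_cross_cross, real_inner_comm a b]; ring

theorem cross_cross (a b c : E3) : cross (cross a b) c = ⟪a, c⟫ • b - ⟪b, c⟫ • a := by
  ext i; fin_cases i <;> simp [cross_zero, cross_one, cross_two, inner_coord] <;> ring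

theorem eq_smul_of_cross_eq_zero {x n : E3} (hn : ‖n‖ = 1) (h : cross x n = 0) :
    x = ⟪x, n⟫ • n := by
  have := cross_cross x n n
  rw [h, map_zero, zero_apply, real_inner_self_eq_norm_sq, hn] at this
  rw [eq_comm, sub_eq_zero] at this
  simpa using this.symm

/-- A vector orthogonal to two linearly independent vectors is a multiple of their cross product. -/
theorem eq_smul_of_inner_eq_zero {a b n x : E3} (hn : ‖n‖ = 1) (hab : cross a b ≠ 0)
    (han : ⟪a, n⟫ = 0) (hbn : ⟪b, n⟫ = 0) (hax : ⟪a, x⟫ = 0) (hbx : ⟪b, x⟫ = 0) :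
    x = ⟪x, n⟫ • n := by
  have key : ∀ y : E3, ⟪a, y⟫ = 0 → ⟪b, y⟫ = 0 → cross (cross a b) y = 0 := by
    intro y h1 h2; rw [cross_cross, h1, h2]; simp
  have hω : (0 : ℝ) < ‖cross a b‖ := norm_pos_iff.2 hab
  set m : E3 := (‖cross a b‖)⁻¹ • cross a b with hm
  have hm1 : ‖m‖ = 1 := by
    rw [hm, norm_smul, norm_inv, norm_norm, inv_mul_cancel₀ hω.ne']
  have h1 : ∀ y : E3, ⟪a, y⟫ = 0 → ⟪b, y⟫ = 0 → y = ⟪y, m⟫ • m := by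
    intro y h1 h2
    apply eq_smul_of_cross_eq_zero hm1
    rw [cross_swap, hm, map_smul, smul_apply, key y h1 h2]; simp
  have hx := h1 x hax hbx
  have hn' := h1 n han hbn
  have hc : ⟪n, m⟫ ^ 2 = 1 := by
    have := congrArg (fun y => ⟪y, y⟫) hn'
    simp only [real_inner_self_eq_norm_sq, hn, norm_smul, hm1, Real.norm_eq_abs] at this
    rw [mul_one, sq_abs] at this; linarith
  have hxn : ⟪x, n⟫ = ⟪x, m⟫ * ⟪n, m⟫ := by
    conv_lhs => rw [hn', inner_smul_right]
    ring
  rw [hxn, hn', smul_smul, ← hn', mul_assoc, ← sq, hc, mul_one]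
  exact hx

theorem cross_eq_smul_of_inner_eq_zero {x y n : E3} (hn : ‖n‖ = 1) (hx : ⟪x, n⟫ = 0)
    (hy : ⟪y, n⟫ = 0) : cross x y = ⟪cross x y, n⟫ • n := by
  apply eq_smul_of_cross_eq_zero hn
  rw [cross_cross, hx, hy]; simp

/-- The weighted sum of second derivatives of a parametrization. -/
theorem cross_normal_deriv {a b n na nb : E3} {h00 h01 h11 W : ℝ} (hn : ‖n‖ = 1)
    (hW : W ≠ 0) (hab : cross a b = W • n) (hna : ⟪na, n⟫ = 0) (hnb : ⟪nb, n⟫ = 0)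
    (haa : ⟪na, a⟫ = -h00) (hba : ⟪na, b⟫ = -h01) (hab' : ⟪nb, a⟫ = -h01)
    (hbb : ⟪nb, b⟫ = -h11) :
    cross b na + cross nb a =
      ((⟪b, b⟫ * h00 - 2 * ⟪a, b⟫ * h01 + ⟪a, a⟫ * h11) / W) • n := by
  have hnn : ⟪n, n⟫ = (1 : ℝ) := by rw [real_inner_self_eq_norm_sq, hn]; norm_num
  have hω : n = W⁻¹ • cross a b := by rw [hab, smul_smul, inv_mul_cancel₀ hW, one_smul]
  have han : ⟪a, n⟫ = 0 := by
    rw [hω, inner_smul_right, real_inner_comm, inner_cross_left, mul_zero]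
  have hbn : ⟪b, n⟫ = 0 := by
    rw [hω, inner_smul_right, real_inner_comm, inner_cross_right, mul_zero]
  have h1 : ⟪cross b na, n⟫ = (⟪b, b⟫ * h00 - ⟪a, b⟫ * h01) / W := by
    rw [hω, inner_smul_right, inner_cross_cross, haa, hba, real_inner_comm a b]
    field_simp; ring
  have h2 : ⟪cross nb a, n⟫ = (⟪a, a⟫ * h11 - ⟪a, b⟫ * h01) / W := by
    rw [hω, inner_smul_right, inner_cross_cross, hab', hbb]
    field_simp; ring
  rw [cross_eq_smul_of_inner_eq_zero hn hbn hna, cross_eq_smul_of_inner_eq_zero hn hnb han, h1, h2,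
    ← add_smul]
  congr 1; ring

/-- The divergence along a plane of a linear vector field. -/
theorem inner_map_cross_add {a b : E3} (D : E3 →L[ℝ] E3) :
    ⟪D a, cross b (cross a b)⟫ + ⟪D b, cross (cross a b) a⟫ =
      ‖cross a b‖ ^ 2 * (∑ j, D (EuclideanSpace.single j 1) j) -
        ⟪D (cross a b), cross a b⟫ := by
  have hD : ∀ v : E3, ∀ i, D v i = v 0 * D (EuclideanSpace.single 0 1) i +
      v 1 * D (EuclideanSpace.single 1 1) i + v 2 * D (EuclideanSpace.single 2 1) i := by
    intro v i
    have : v = v 0 • EuclideanSpace.single (0 : Fin 3) (1 : ℝ) +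
      v 1 • EuclideanSpace.single (1 : Fin 3) (1 : ℝ) +
      v 2 • EuclideanSpace.single (2 : Fin 3) (1 : ℝ) := by
      ext k; fin_cases k <;> simp
    conv_lhs => rw [this]
    simp
  simp only [norm_sq_coord, inner_coord, cross_zero, cross_one, cross_two, Fin.sum_univ_three]
  rw [hD a 0, hD a 1, hD a 2, hD b 0, hD b 1, hD b 2, hD (cross a b) 0, hD (cross a b) 1,
    hD (cross a b) 2]
  simp only [cross_zero, cross_one, cross_two]
  ring

/-! ### Parametrized surfaces -/

/-- Coordinate vectors of the parameter plane. -/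
abbrev ee (i : Fin 2) : E2 := EuclideanSpace.single i 1

theorem eq_sum_ee (ξ : E2) : ξ = ξ 0 • ee 0 + ξ 1 • ee 1 := by
  ext k; fin_cases k <;> simp

/-- The area vector of a linear map from the plane to space. -/
def areaVec (L : E2 →L[ℝ] E3) : E3 := cross (L (ee 0)) (L (ee 1))

theorem areaVec_ne_zero {L : E2 →L[ℝ] E3} (hL : Function.Injective L) : areaVec L ≠ 0 := by
  intro h
  have h0 : L (ee 1) = 0 := by
    by_contra hb
    have hb' : (⟪L (ee 1), L (ee 1)⟫ : ℝ) ≠ 0 := by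
      rwa [Ne, inner_self_eq_zero]
    have h1 := cross_cross (L (ee 0)) (L (ee 1)) (L (ee 1))
    rw [← areaVec, h, map_zero, zero_apply] at h1
    have h2 : L (⟪L (ee 0), L (ee 1)⟫ • ee 1 - ⟪L (ee 1), L (ee 1)⟫ • ee 0) = 0 := by
      rw [map_sub, map_smul, map_smul]; exact h1.symm
    have h3 := hL (h2.trans (map_zero L).symm)
    have := congrFun (congrArg (fun v : E2 => (v : Fin 2 → ℝ)) h3) 0
    simp at this
    exact hb (by simpa using this)
  have h3 := hL (h0.trans (map_zero L).symm)
  have := congrFun (congrArg (fun v : E2 => (v : Fin 2 → ℝ)) h3) 1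
  simp at this

/-- The determinant of a plane linear map in coordinates. -/
theorem det_plane (A : E2 →L[ℝ] E2) :
    A.det = A (ee 0) 0 * A (ee 1) 1 - A (ee 1) 0 * A (ee 0) 1 := by
  have : A.det = LinearMap.det (A : E2 →ₗ[ℝ] E2) := rfl
  rw [this, ← LinearMap.det_toMatrix (EuclideanSpace.basisFun (Fin 2) ℝ).toBasis,
    Matrix.det_fin_two]
  simp [LinearMap.toMatrix_apply]

/-- The cross product is alternating and bilinear, so it sees a linear change of the plane only
through its determinant. Every chart-independence statement below rests on this. -/
theorem areaVec_comp (L : E2 →L[ℝ] E3) (A : E2 →L[ℝ] E2) :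
    areaVec (L.comp A) = A.det • areaVec L := by
  have h : ∀ i, L (A (ee i)) = A (ee i) 0 • L (ee 0) + A (ee i) 1 • L (ee 1) := by
    intro i
    conv_lhs => rw [eq_sum_ee (A (ee i))]
    rw [map_add, map_smul, map_smul]
  rw [areaVec, areaVec, det_plane, ContinuousLinearMap.comp_apply, ContinuousLinearMap.comp_apply,
    h 0, h 1]
  simp only [map_add, map_smul, add_apply, smul_apply,
    cross_self, cross_swap (L (ee 1)) (L (ee 0))]
  module

/-- The unit normal of an immersion. -/
def unitVec (L : E2 →L[ℝ] E3) : E3 := (‖areaVec L‖)⁻¹ • areaVec L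

theorem norm_unitVec {L : E2 →L[ℝ] E3} (h : areaVec L ≠ 0) : ‖unitVec L‖ = 1 := by
  rw [unitVec, norm_smul, norm_inv, norm_norm, inv_mul_cancel₀ (norm_ne_zero_iff.2 h)]

theorem areaVec_eq {L : E2 →L[ℝ] E3} (h : areaVec L ≠ 0) :
    areaVec L = ‖areaVec L‖ • unitVec L := by
  rw [unitVec, smul_smul, mul_inv_cancel₀ (norm_ne_zero_iff.2 h), one_smul]

theorem inner_unitVec (L : E2 →L[ℝ] E3) (ξ : E2) : ⟪L ξ, unitVec L⟫ = 0 := by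
  rw [eq_sum_ee ξ, map_add, map_smul, map_smul, inner_add_left, inner_smul_left, inner_smul_left,
    unitVec, inner_smul_right, inner_smul_right, areaVec, real_inner_comm, inner_cross_left,
    real_inner_comm, inner_cross_right]
  simp

/-- The sign is that of the determinant. No orientation of the surface is assumed, so the normal is
only defined up to sign and all later global quantities are even in it. -/
theorem unitVec_comp (L : E2 →L[ℝ] E3) {A : E2 →L[ℝ] E2} (hA : A.det ≠ 0) :
    unitVec (L.comp A) = unitVec L ∨ unitVec (L.comp A) = -unitVec L := by
  rw [unitVec, unitVec, areaVec_comp, norm_smul, smul_smul, Real.norm_eq_abs, mul_inv, mul_comm,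
    ← mul_assoc]
  rcases lt_or_gt_of_ne hA with h | h
  · right
    rw [abs_of_neg h, inv_neg, mul_neg, mul_inv_cancel₀ hA, neg_one_mul, neg_smul]
  · left
    rw [abs_of_pos h, mul_inv_cancel₀ hA, one_mul]

/-! ### Second derivatives and unit normals of parametrized surfaces -/

theorem two_le_infty : (2 : WithTop ℕ∞) ≤ ((⊤ : ℕ∞) : WithTop ℕ∞) :=
  show ((2 : ℕ∞) : WithTop ℕ∞) ≤ ((⊤ : ℕ∞) : WithTop ℕ∞) from WithTop.coe_le_coe.2 le_top

/-- The second derivative `∂ᵢ ∂ⱼ f`. -/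
def hess (f : E2 → E3) (u : E2) (i j : Fin 2) : E3 :=
  fderiv ℝ (fun w => tangent f w j) u (ee i)

/-- The unit normal field of a parametrized surface. -/
def nrm (f : E2 → E3) (u : E2) : E3 := unitVec (fderiv ℝ f u)

/-- The normal component of the Euclidean Laplacian of a parametrized surface. -/
def lapl (f : E2 → E3) (u : E2) : ℝ :=
  (⟪tangent f u 1, tangent f u 1⟫ * ⟪hess f u 0 0, nrm f u⟫
    - 2 * ⟪tangent f u 0, tangent f u 1⟫ * ⟪hess f u 0 1, nrm f u⟫
    + ⟪tangent f u 0, tangent f u 0⟫ * ⟪hess f u 1 1, nrm f u⟫) / ‖areaVec (fderiv ℝ f u)‖ ^ 2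

theorem firstForm_det (f : E2 → E3) (u : E2) :
    (firstForm f u).det = (‖areaVec (fderiv ℝ f u)‖ / f u 2 ^ 2) ^ 2 := by
  rw [Matrix.det_fin_two, div_pow, areaVec, norm_cross_sq]
  simp only [firstForm, Matrix.of_apply, metric, tangent, ee]
  rw [real_inner_comm ((fderiv ℝ f u) (EuclideanSpace.single 0 1))
    ((fderiv ℝ f u) (EuclideanSpace.single 1 1))]
  ring

theorem sqrt_firstForm_det (f : E2 → E3) (u : E2) :
    √(firstForm f u).det = ‖areaVec (fderiv ℝ f u)‖ / f u 2 ^ 2 := by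
  rw [firstForm_det, Real.sqrt_sq (by positivity)]

theorem tangent_inner_nrm (f : E2 → E3) (u : E2) (i : Fin 2) :
    ⟪tangent f u i, nrm f u⟫ = 0 := inner_unitVec _ _

theorem isUnitNormal_smul_nrm {f : E2 → E3} {u : E2} (h : areaVec (fderiv ℝ f u) ≠ 0)
    (hx : 0 < f u 2) : IsUnitNormal f u (f u 2 • nrm f u) := by
  refine ⟨?_, fun i => ?_⟩
  · rw [metric, real_inner_self_eq_norm_sq, norm_smul, nrm, norm_unitVec h, mul_one,
      Real.norm_eq_abs, sq_abs, div_self (by positivity)]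
  · rw [metric, inner_smul_right, tangent_inner_nrm]; simp

theorem tangent_differentiableAt {f : E2 → E3} {u : E2} (hf : ContDiffAt ℝ ∞ f u) (i : Fin 2) :
    ContDiffAt ℝ ∞ (fun w => tangent f w i) u :=
  (hf.fderiv_right (m := ∞) (by simp)).clm_apply contDiffAt_const

theorem hess_eq {f : E2 → E3} {u : E2} (hf : ContDiffAt ℝ ∞ f u) (i j : Fin 2) :
    hess f u i j = fderiv ℝ (fderiv ℝ f) u (ee i) (ee j) := by
  have h1 : DifferentiableAt ℝ (fderiv ℝ f) u :=
    (hf.fderiv_right (m := ∞) (by simp)).differentiableAt (by simp)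
  have := fderiv_clm_apply h1 (differentiableAt_const (x := u) (ee j))
  rw [hess]
  unfold tangent
  rw [this]; simp

theorem hess_symm {f : E2 → E3} {u : E2} (hf : ContDiffAt ℝ ∞ f u) (i j : Fin 2) :
    hess f u i j = hess f u j i := by
  rw [hess_eq hf, hess_eq hf]
  exact (hf.isSymmSndFDerivAt (by simp; exact two_le_infty)).eq _ _

theorem nrm_contDiffAt {f : E2 → E3} {u : E2} (hf : ContDiffAt ℝ ∞ f u)
    (h : areaVec (fderiv ℝ f u) ≠ 0) : ContDiffAt ℝ ∞ (nrm f) u := by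
  have h1 : ContDiffAt ℝ ∞ (fun w => areaVec (fderiv ℝ f w)) u := by
    unfold areaVec
    exact (contDiffAt_const.clm_apply (tangent_differentiableAt hf 0)).clm_apply
      (tangent_differentiableAt hf 1)
  exact (((contDiffAt_norm ℝ h).comp u h1).inv (norm_ne_zero_iff.2 h)).smul h1

theorem eventually_areaVec_ne_zero {f : E2 → E3} {u : E2} (hf : ContDiffAt ℝ ∞ f u)
    (h : areaVec (fderiv ℝ f u) ≠ 0) : ∀ᶠ w in 𝓝 u, areaVec (fderiv ℝ f w) ≠ 0 := by
  have h1 : ContDiffAt ℝ ∞ (fun w => areaVec (fderiv ℝ f w)) u := by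
    unfold areaVec
    exact (contDiffAt_const.clm_apply (tangent_differentiableAt hf 0)).clm_apply
      (tangent_differentiableAt hf 1)
  exact h1.continuousAt.eventually_ne h

theorem inner_fderiv_nrm_nrm {f : E2 → E3} {u : E2} (hf : ContDiffAt ℝ ∞ f u)
    (h : areaVec (fderiv ℝ f u) ≠ 0) (ξ : E2) : ⟪fderiv ℝ (nrm f) u ξ, nrm f u⟫ = 0 := by
  have hd := (nrm_contDiffAt hf h).differentiableAt (by simp)
  have h1 : (fun w => ⟪nrm f w, nrm f w⟫) =ᶠ[𝓝 u] fun _ => (1 : ℝ) := by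
    filter_upwards [eventually_areaVec_ne_zero hf h] with w hw
    rw [real_inner_self_eq_norm_sq, nrm, norm_unitVec hw]; norm_num
  have h2 := fderiv_inner_apply ℝ hd hd ξ
  rw [h1.fderiv_eq] at h2
  rw [real_inner_comm] at h2
  simp at h2
  linarith

theorem inner_fderiv_nrm_tangent {f : E2 → E3} {u : E2} (hf : ContDiffAt ℝ ∞ f u)
    (h : areaVec (fderiv ℝ f u) ≠ 0) (i j : Fin 2) :
    ⟪fderiv ℝ (nrm f) u (ee i), tangent f u j⟫ = -⟪hess f u i j, nrm f u⟫ := by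
  have hd := (nrm_contDiffAt hf h).differentiableAt (by simp)
  have ht := (tangent_differentiableAt hf j).differentiableAt (by simp)
  have h1 : (fun w => ⟪tangent f w j, nrm f w⟫) = fun _ => (0 : ℝ) := by
    funext w; exact tangent_inner_nrm f w j
  have h2 := fderiv_inner_apply ℝ ht hd (ee i)
  rw [h1, fderiv_fun_const] at h2
  rw [real_inner_comm, hess]
  simp at h2
  linarith

/-- The divergence of the tangential part of a vector field along a surface, in coordinates. -/
theorem fderiv_conormal_add {f : E2 → E3} {u : E2} (hf : ContDiffAt ℝ ∞ f u)
    (h : areaVec (fderiv ℝ f u) ≠ 0) {X : E2 → E3} (hX : DifferentiableAt ℝ X u) :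
    fderiv ℝ (fun w => ⟪X w, cross (tangent f w 1) (nrm f w)⟫) u (ee 0)
      + fderiv ℝ (fun w => ⟪X w, cross (nrm f w) (tangent f w 0)⟫) u (ee 1)
    = ⟪fderiv ℝ X u (ee 0), cross (tangent f u 1) (nrm f u)⟫
      + ⟪fderiv ℝ X u (ee 1), cross (nrm f u) (tangent f u 0)⟫
      + lapl f u * ‖areaVec (fderiv ℝ f u)‖ * ⟪X u, nrm f u⟫ := by
  have hn := (nrm_contDiffAt hf h).differentiableAt (by simp)
  have h0 := (tangent_differentiableAt hf 0).differentiableAt (by simp)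
  have h1 := (tangent_differentiableAt hf 1).differentiableAt (by simp)
  have hA : HasFDerivAt (fun w => cross (tangent f w 1) (nrm f w)) _ u :=
    cross.hasFDerivAt_of_bilinear h1.hasFDerivAt hn.hasFDerivAt
  have hB : HasFDerivAt (fun w => cross (nrm f w) (tangent f w 0)) _ u :=
    cross.hasFDerivAt_of_bilinear hn.hasFDerivAt h0.hasFDerivAt
  rw [fderiv_inner_apply ℝ hX hA.differentiableAt, fderiv_inner_apply ℝ hX hB.differentiableAt,
    hA.fderiv, hB.fderiv]
  simp only [add_apply, ContinuousLinearMap.precompR_apply,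
    ContinuousLinearMap.precompL_apply, ContinuousLinearMap.compL_apply,
    ContinuousLinearMap.comp_apply]
  have e1 : fderiv ℝ (fun w => tangent f w 1) u (ee 0) = hess f u 0 1 := rfl
  have e2 : fderiv ℝ (fun w => tangent f w 0) u (ee 1) = hess f u 0 1 := by
    rw [hess_symm hf]; rfl
  have hW : ‖areaVec (fderiv ℝ f u)‖ ≠ 0 := norm_ne_zero_iff.2 h
  have key := cross_normal_deriv (a := tangent f u 0) (b := tangent f u 1) (norm_unitVec h) hW
    (areaVec_eq h) (inner_fderiv_nrm_nrm hf h (ee 0)) (inner_fderiv_nrm_nrm hf h (ee 1))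
    (inner_fderiv_nrm_tangent hf h 0 0) (inner_fderiv_nrm_tangent hf h 0 1)
    (by rw [inner_fderiv_nrm_tangent hf h 1 0, hess_symm hf])
    (inner_fderiv_nrm_tangent hf h 1 1)
  have key2 : lapl f u * ‖areaVec (fderiv ℝ f u)‖ * ⟪X u, nrm f u⟫ =
      ⟪X u, cross (tangent f u 1) (fderiv ℝ (nrm f) u (ee 0)) +
        cross (fderiv ℝ (nrm f) u (ee 1)) (tangent f u 0)⟫ := by
    rw [key, inner_smul_right, lapl]
    simp only [nrm]
    field_simp
  rw [key2, e1, e2]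
  simp only [inner_add_right, cross_swap (nrm f u) (hess f u 0 1), inner_neg_right]
  ring

/-- The mean curvature vector of a surface in `ℍ³` in Euclidean terms. -/
theorem neg_meanCurvature_smul {f : E2 → E3} {u : E2} (hf : ContDiffAt ℝ ∞ f u)
    (h : areaVec (fderiv ℝ f u) ≠ 0) (hx : 0 < f u 2) :
    -(meanCurvature f u (f u 2 • nrm f u) • (f u 2 • nrm f u)) =
      (f u 2 ^ 2 / 2 * lapl f u + f u 2 * nrm f u 2) • nrm f u := by
  have hW : ‖areaVec (fderiv ℝ f u)‖ ≠ 0 := norm_ne_zero_iff.2 h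
  rw [smul_smul, ← neg_smul]
  congr 1
  -- Against the normal, only the ⟪v, w⟫e₂ term of the Christoffel symbols survives. It adds a
  -- multiple of the first fundamental form, whose trace produces the term with the vertical
  -- component of the normal.
  have hs : ∀ i j, secondForm f u (f u 2 • nrm f u) i j =
      -(⟪hess f u i j, nrm f u⟫ / f u 2
        + ⟪tangent f u i, tangent f u j⟫ * nrm f u 2 / f u 2 ^ 2) := by
    intro i j
    simp only [secondForm, Matrix.of_apply, metric, covDeriv, christoffel, inner_add_left,
      inner_smul_right, inner_smul_left, inner_sub_left, tangent_inner_nrm]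
    have : ⟪(EuclideanSpace.single (2 : Fin 3) (1 : ℝ) : E3), nrm f u⟫ = nrm f u 2 := by
      simp [inner_coord]
    rw [this]
    change -(f u 2 * (⟪hess f u i j, nrm f u⟫ + _) / f u 2 ^ 2) = _
    simp only [conj_trivial]
    field_simp; ring
  have hg : ∀ i j, firstForm f u i j = ⟪tangent f u i, tangent f u j⟫ / f u 2 ^ 2 :=
    fun i j => rfl
  have hdet : (firstForm f u).det ≠ 0 := by
    rw [firstForm_det]; positivity
  rw [meanCurvature, Matrix.inv_def, Matrix.adjugate_fin_two, firstForm_det, lapl]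
  simp only [Matrix.smul_mul, Matrix.trace_smul, Matrix.trace_fin_two, Matrix.mul_apply,
    Fin.sum_univ_two, Matrix.of_apply, Matrix.cons_val', Matrix.cons_val_zero,
    Matrix.cons_val_one, Matrix.cons_val_fin_one, hs, hg, Ring.inverse_eq_inv', smul_eq_mul]
  rw [hess_symm hf 1 0, real_inner_comm (tangent f u 0) (tangent f u 1)]
  have hWW : ⟪tangent f u 0, tangent f u 0⟫ * ⟪tangent f u 1, tangent f u 1⟫ =
      ‖areaVec (fderiv ℝ f u)‖ ^ 2 + ⟪tangent f u 0, tangent f u 1⟫ ^ 2 := by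
    rw [areaVec, norm_cross_sq]; simp only [tangent, ee]; ring
  set W := ‖areaVec (fderiv ℝ f u)‖
  set E := ⟪tangent f u 0, tangent f u 0⟫
  set F := ⟪tangent f u 0, tangent f u 1⟫
  set G := ⟪tangent f u 1, tangent f u 1⟫
  set x := f u 2
  have hx' : x ≠ 0 := hx.ne'
  field_simp
  linear_combination (2 * nrm f u 2) * hWW

/-- The mean curvature does not depend on the parametrization. -/
theorem meanCurvature_comp {f : E2 → E3} {τ : E2 → E2} {u : E2} {ν : E3}
    (hf : ContDiffAt ℝ ∞ f (τ u)) (hτ : ContDiffAt ℝ ∞ τ u) (hdet : (fderiv ℝ τ u).det ≠ 0)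
    (hν : IsUnitNormal f (τ u) ν) (hx : 0 < f (τ u) 2) :
    meanCurvature (f ∘ τ) u ν = meanCurvature f (τ u) ν := by
  set J : Matrix (Fin 2) (Fin 2) ℝ := Matrix.of fun k i => fderiv ℝ τ u (ee i) k with hJ
  have hτd := hτ.differentiableAt (n := ∞) (by simp)
  have hfd := hf.differentiableAt (n := ∞) (by simp)
  have hJdet : IsUnit J.det := by
    rw [isUnit_iff_ne_zero, hJ, Matrix.det_fin_two]
    rw [det_plane] at hdet
    simpa using hdet
  have hν' : ∀ ξ, ⟪fderiv ℝ f (τ u) ξ, ν⟫ = 0 := by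
    intro ξ
    have h0 := hν.2 0
    have h1 := hν.2 1
    simp only [metric, tangent, div_eq_zero_iff, pow_eq_zero_iff two_ne_zero, hx.ne', or_false]
      at h0 h1
    rw [eq_sum_ee ξ, map_add, map_smul, map_smul, inner_add_left, inner_smul_left,
      inner_smul_left, h0, h1]; simp
  have hexp : ∀ i, fderiv ℝ τ u (ee i) = J 0 i • ee 0 + J 1 i • ee 1 := by
    intro i; exact eq_sum_ee _
  have htan : ∀ i, tangent (f ∘ τ) u i = J 0 i • tangent f (τ u) 0 + J 1 i • tangent f (τ u) 1 := by
    intro i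
    rw [tangent, fderiv_comp u hfd hτd, ContinuousLinearMap.comp_apply, hexp, map_add, map_smul,
      map_smul]; rfl
  have hhess : ∀ i j, ⟪hess (f ∘ τ) u i j, ν⟫ =
      J 0 i * J 0 j * ⟪hess f (τ u) 0 0, ν⟫ + J 0 i * J 1 j * ⟪hess f (τ u) 0 1, ν⟫
      + J 1 i * J 0 j * ⟪hess f (τ u) 1 0, ν⟫ + J 1 i * J 1 j * ⟪hess f (τ u) 1 1, ν⟫ := by
    intro i j
    have hev : (fun w => tangent (f ∘ τ) w j) =ᶠ[𝓝 u]
        fun w => fderiv ℝ f (τ w) (fderiv ℝ τ w (ee j)) := by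
      have h1 : ∀ᶠ w in 𝓝 u, DifferentiableAt ℝ τ w :=
        (hτ.of_le (m := 1) (by simp)).eventually (by simp) |>.mono
          fun w hw => hw.differentiableAt (by simp)
      have h2 : ∀ᶠ w in 𝓝 (τ u), DifferentiableAt ℝ f w :=
        (hf.of_le (m := 1) (by simp)).eventually (by simp) |>.mono
          fun w hw => hw.differentiableAt (by simp)
      filter_upwards [h1, hτd.continuousAt.eventually h2] with w hw1 hw2
      rw [tangent, fderiv_comp w hw2 hw1]; rfl
    have hd1 : DifferentiableAt ℝ (fderiv ℝ f) (τ u) :=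
      (hf.fderiv_right (m := ∞) (by simp)).differentiableAt (by simp)
    have hd2 : DifferentiableAt ℝ (fun w => fderiv ℝ τ w (ee j)) u :=
      ((hτ.fderiv_right (m := ∞) (by simp)).clm_apply contDiffAt_const).differentiableAt (by simp)
    have hd3 : HasFDerivAt (fun w => fderiv ℝ f (τ w)) _ u := hd1.hasFDerivAt.comp u hτd.hasFDerivAt
    -- The second derivative of `τ` contributes a vector in the image of the tangent map, which the
    -- normal kills. Hence the normal part of the Hessian transforms as a tensor.
    rw [hess, hev.fderiv_eq, (hd3.clm_apply hd2.hasFDerivAt).fderiv]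
    simp only [add_apply, ContinuousLinearMap.comp_apply, ContinuousLinearMap.flip_apply,
      inner_add_left, hν', zero_add]
    simp only [hess_eq hf]
    rw [hexp i, hexp j]
    simp only [map_add, map_smul, add_apply, smul_apply, inner_add_left, inner_smul_left,
      conj_trivial]
    ring
  have hg : firstForm (f ∘ τ) u = J.transpose * firstForm f (τ u) * J := by
    ext i j
    simp only [firstForm, Matrix.mul_apply, Fin.sum_univ_two, Matrix.of_apply, metric,
      Matrix.transpose_apply, htan, inner_add_left, inner_add_right, inner_smul_left,
      inner_smul_right, conj_trivial, Function.comp]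
    ring
  have hh : secondForm (f ∘ τ) u ν = J.transpose * secondForm f (τ u) ν * J := by
    have hs : ∀ (g : E2 → E3) (w : E2) (i j : Fin 2), secondForm g w ν i j =
      -((⟪hess g w i j, ν⟫ + ⟪christoffel (g w) (tangent g w i) (tangent g w j), ν⟫) / g w 2 ^ 2) := by
      intro g w i j
      rw [← inner_add_left]; rfl
    ext i j
    simp only [Matrix.mul_apply, Fin.sum_univ_two, Matrix.transpose_apply, hs, hhess, htan,
      Function.comp]
    simp only [christoffel, inner_add_left, inner_add_right, inner_smul_left, inner_sub_left,
      inner_smul_right, conj_trivial, PiLp.add_apply, PiLp.smul_apply, smul_eq_mul, tangent, hν']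
    ring
  -- The shape matrix changes by conjugation with `J`, which preserves the trace.
  rw [meanCurvature, meanCurvature, hg, hh, Matrix.mul_inv_rev, Matrix.mul_inv_rev]
  congr 1
  have hJt : IsUnit J.transpose.det := by rwa [Matrix.det_transpose]
  rw [show J⁻¹ * ((firstForm f (τ u))⁻¹ * J.transpose⁻¹) * (J.transpose * secondForm f (τ u) ν * J)
    = J⁻¹ * ((firstForm f (τ u))⁻¹ * (J.transpose⁻¹ * J.transpose) * secondForm f (τ u) ν * J) by
      simp only [Matrix.mul_assoc], Matrix.nonsing_inv_mul _ hJt, Matrix.mul_one,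
    Matrix.trace_mul_comm, Matrix.mul_assoc, Matrix.mul_nonsing_inv _ hJdet, Matrix.mul_one]

/-! ### One-parameter families of parametrized surfaces -/

section Family

variable {E' : Type*} [NormedAddCommGroup E'] [NormedSpace ℝ E']

theorem uniqueDiffOn_slab {T : ℝ} {U : Set E2} (hU : IsOpen U) :
    UniqueDiffOn ℝ (Ico 0 T ×ˢ U) := (uniqueDiffOn_Ico 0 T).prod hU.uniqueDiffOn

/-- Space is open although time is half-open: the spatial derivative is a genuine one even at t = 0,
where the full derivative exists only within the slab. -/
theorem fderiv_slice_eq {T : ℝ} {U : Set E2} (hU : IsOpen U) {K : ℝ × E2 → E'}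
    (hK : ContDiffOn ℝ ∞ K (Ico 0 T ×ˢ U)) {q : ℝ × E2} (hq : q ∈ Ico 0 T ×ˢ U) :
    HasFDerivAt (fun w => K (q.1, w))
      ((fderivWithin ℝ K (Ico 0 T ×ˢ U) q).comp (ContinuousLinearMap.inr ℝ ℝ E2)) q.2 := by
  have h1 := (hK.differentiableOn (by simp) q hq).hasFDerivWithinAt
  have h2 : HasFDerivWithinAt (fun w : E2 => (q.1, w)) (ContinuousLinearMap.inr ℝ ℝ E2) U q.2 :=
    (hasFDerivAt_prodMk_right q.1 q.2).hasFDerivWithinAt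
  have hm : MapsTo (fun w : E2 => (q.1, w)) U (Ico 0 T ×ˢ U) := fun w hw => ⟨hq.1, hw⟩
  have h3 := HasFDerivWithinAt.comp (g := K) q.2 h1 h2 hm
  exact h3.hasFDerivAt (hU.mem_nhds hq.2)

theorem contDiffOn_fderiv_slice {T : ℝ} {U : Set E2} (hU : IsOpen U) {K : ℝ × E2 → E'}
    (hK : ContDiffOn ℝ ∞ K (Ico 0 T ×ˢ U)) :
    ContDiffOn ℝ ∞ (fun q : ℝ × E2 => fderiv ℝ (fun w => K (q.1, w)) q.2) (Ico 0 T ×ˢ U) := by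
  have h1 : ContDiffOn ℝ ∞ (fun q => (fderivWithin ℝ K (Ico 0 T ×ˢ U) q).comp
      (ContinuousLinearMap.inr ℝ ℝ E2)) (Ico 0 T ×ˢ U) :=
    (hK.fderivWithin (uniqueDiffOn_slab hU) (by simp)).clm_comp contDiffOn_const
  exact h1.congr fun q hq => (fderiv_slice_eq hU hK hq).fderiv

theorem hasDerivWithinAt_slice {T : ℝ} {U : Set E2} {K : ℝ × E2 → E'}
    (hK : ContDiffOn ℝ ∞ K (Ico 0 T ×ˢ U)) {q : ℝ × E2} (hq : q ∈ Ico 0 T ×ˢ U) :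
    HasDerivWithinAt (fun s => K (s, q.2)) (fderivWithin ℝ K (Ico 0 T ×ˢ U) q (1, 0))
      (Ico 0 T) q.1 := by
  have h1 := (hK.differentiableOn (by simp) q hq).hasFDerivWithinAt
  have h2 : HasFDerivWithinAt (fun s : ℝ => (s, q.2)) (ContinuousLinearMap.inl ℝ ℝ E2)
      (Ico 0 T) q.1 := (hasFDerivAt_prodMk_left q.1 q.2).hasFDerivWithinAt
  have hm : MapsTo (fun s : ℝ => (s, q.2)) (Ico 0 T) (Ico 0 T ×ˢ U) := fun w hw => ⟨hw, hq.2⟩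
  have h3 := (HasFDerivWithinAt.comp (g := K) q.1 h1 h2 hm).hasDerivWithinAt
  simp only [ContinuousLinearMap.comp_apply, ContinuousLinearMap.inl_apply] at h3
  exact h3

theorem derivWithin_slice_eq {T : ℝ} {U : Set E2} {K : ℝ × E2 → E'}
    (hK : ContDiffOn ℝ ∞ K (Ico 0 T ×ˢ U)) {q : ℝ × E2} (hq : q ∈ Ico 0 T ×ˢ U) :
    derivWithin (fun s => K (s, q.2)) (Ico 0 T) q.1 =
      fderivWithin ℝ K (Ico 0 T ×ˢ U) q (1, 0) :=
  (hasDerivWithinAt_slice hK hq).derivWithin (uniqueDiffOn_Ico 0 T _ hq.1)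

theorem contDiffOn_derivWithin_slice {T : ℝ} {U : Set E2} (hU : IsOpen U) {K : ℝ × E2 → E'}
    (hK : ContDiffOn ℝ ∞ K (Ico 0 T ×ˢ U)) :
    ContDiffOn ℝ ∞ (fun q : ℝ × E2 => derivWithin (fun s => K (s, q.2)) (Ico 0 T) q.1)
      (Ico 0 T ×ˢ U) := by
  have h1 : ContDiffOn ℝ ∞ (fun q => fderivWithin ℝ K (Ico 0 T ×ˢ U) q (1, 0))
      (Ico 0 T ×ˢ U) :=
    (hK.fderivWithin (uniqueDiffOn_slab hU) (by simp)).clm_apply contDiffOn_const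
  exact h1.congr fun q hq => derivWithin_slice_eq hK hq

/-- Symmetry of the second derivative of `K` in the directions (1, 0) and (0, ξ). At interior times
the derivatives within the slab are ordinary ones. -/
theorem hasDerivAt_fderiv_slice {T : ℝ} {U : Set E2} (hU : IsOpen U) {K : ℝ × E2 → E'}
    (hK : ContDiffOn ℝ ∞ K (Ico 0 T ×ˢ U)) {t : ℝ} {u : E2} (ht : t ∈ Ioo 0 T) (hu : u ∈ U)
    (ξ : E2) :
    HasDerivAt (fun s => fderiv ℝ (fun w => K (s, w)) u ξ)
      (fderiv ℝ (fun w => derivWithin (fun s => K (s, w)) (Ico 0 T) t) u ξ) t := by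
  have hS : IsOpen (Ioo 0 T ×ˢ U) := isOpen_Ioo.prod hU
  have hsub : Ioo 0 T ×ˢ U ⊆ Ico 0 T ×ˢ U := prod_mono Ioo_subset_Ico_self le_rfl
  have hnhds : ∀ q ∈ Ioo 0 T ×ˢ U, Ico 0 T ×ˢ U ∈ 𝓝 q := fun q hq =>
    mem_of_superset (hS.mem_nhds hq) hsub
  have hq : (t, u) ∈ Ioo 0 T ×ˢ U := ⟨ht, hu⟩
  have hKa : ContDiffAt ℝ ∞ K (t, u) := hK.contDiffAt (hnhds _ hq)
  have hd : DifferentiableAt ℝ (fderiv ℝ K) (t, u) :=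
    (hKa.fderiv_right (m := ∞) (by simp)).differentiableAt (by simp)
  have hsymm := hKa.isSymmSndFDerivAt (by simp; exact two_le_infty)
  have hfw : ∀ q ∈ Ioo 0 T ×ˢ U, fderivWithin ℝ K (Ico 0 T ×ˢ U) q = fderiv ℝ K q :=
    fun q hq => fderivWithin_of_mem_nhds (hnhds q hq)
  have h1 : HasDerivAt (fun s => fderiv ℝ K (s, u) (0, ξ))
      (fderiv ℝ (fderiv ℝ K) (t, u) (1, 0) (0, ξ)) t := by
    have a1 : HasFDerivAt (fun q => fderiv ℝ K q (0, ξ)) _ (t, u) :=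
      hd.hasFDerivAt.clm_apply (hasFDerivAt_const (0, ξ) _)
    have a2 := a1.comp t (hasFDerivAt_prodMk_left (𝕜 := ℝ) t u)
    have a3 := a2.hasDerivAt
    simp at a3
    exact a3
  have h2 : HasFDerivAt (fun w => fderiv ℝ K (t, w) (1, 0)) _ u :=
    (hd.hasFDerivAt.clm_apply (hasFDerivAt_const ((1 : ℝ), (0 : E2)) _)).comp u
      (hasFDerivAt_prodMk_right (𝕜 := ℝ) t u)
  have e1 : (fun w => derivWithin (fun s => K (s, w)) (Ico 0 T) t) =ᶠ[𝓝 u]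
      fun w => fderiv ℝ K (t, w) (1, 0) := by
    filter_upwards [hU.mem_nhds hu] with w hw
    rw [← hfw (t, w) ⟨ht, hw⟩]
    exact derivWithin_slice_eq (q := (t, w)) hK ⟨⟨ht.1.le, ht.2⟩, hw⟩
  have e2 : (fun s => fderiv ℝ (fun w => K (s, w)) u ξ) =ᶠ[𝓝 t]
      fun s => fderiv ℝ K (s, u) (0, ξ) := by
    filter_upwards [isOpen_Ioo.mem_nhds ht] with s hs
    rw [← hfw (s, u) ⟨hs, hu⟩]
    have := (fderiv_slice_eq (q := (s, u)) hU hK ⟨⟨hs.1.le, hs.2⟩, hu⟩).fderiv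
    rw [this]; simp
  refine (h1.congr_of_eventuallyEq e2).congr_deriv ?_
  rw [e1.fderiv_eq, h2.fderiv]
  simp
  exact hsymm.eq _ _

end Family

theorem contDiffAt_slice {T : ℝ} {U : Set E2} (hU : IsOpen U) {G : ℝ → E2 → E3}
    (hG : ContDiffOn ℝ ∞ (fun q : ℝ × E2 => G q.1 q.2) (Ico 0 T ×ˢ U)) {t : ℝ} {u : E2}
    (ht : t ∈ Ico 0 T) (hu : u ∈ U) : ContDiffAt ℝ ∞ (G t) u := by
  have : ContDiffOn ℝ ∞ (fun w => G t w) U :=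
    hG.comp (contDiff_prodMk_right t).contDiffOn fun w hw => ⟨ht, hw⟩
  exact this.contDiffAt (hU.mem_nhds hu)

/-- The evolution of the area element under mean curvature flow. -/
theorem hasDerivAt_areaElement {T : ℝ} {U : Set E2} (hU : IsOpen U) {G : ℝ → E2 → E3}
    (hG : ContDiffOn ℝ ∞ (fun q : ℝ × E2 => G q.1 q.2) (Ico 0 T ×ˢ U)) {t : ℝ} {u : E2}
    (ht : t ∈ Ioo 0 T) (hu : u ∈ U)
    (hflow : ∀ w ∈ U, derivWithin (fun s => G s w) (Ico 0 T) t =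
      (G t w 2 ^ 2 / 2 * lapl (G t) w + G t w 2 * nrm (G t) w 2) • nrm (G t) w)
    (himm : areaVec (fderiv ℝ (G t) u) ≠ 0) (hpos : 0 < G t u 2) :
    HasDerivAt (fun s => ‖areaVec (fderiv ℝ (G s) u)‖ / G s u 2 ^ 2)
      (-2 * (‖derivWithin (fun s => G s u) (Ico 0 T) t‖ ^ 2 / G t u 2 ^ 2) *
        (‖areaVec (fderiv ℝ (G t) u)‖ / G t u 2 ^ 2)) t := by
  have ht' : t ∈ Ico 0 T := ⟨ht.1.le, ht.2⟩
  set X : E2 → E3 := fun w => derivWithin (fun s => G s w) (Ico 0 T) t with hXdef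
  have hf := contDiffAt_slice hU hG ht' hu
  have hXd : DifferentiableAt ℝ X u := by
    have h1 := contDiffOn_derivWithin_slice hU hG
    have h2 : ContDiffOn ℝ ∞ X U :=
      h1.comp (contDiff_prodMk_right t).contDiffOn fun w hw => ⟨ht', hw⟩
    exact (h2.contDiffAt (hU.mem_nhds hu)).differentiableAt (by simp)
  have h0 := hasDerivAt_fderiv_slice hU hG ht hu (ee 0)
  have h1 := hasDerivAt_fderiv_slice hU hG ht hu (ee 1)
  have hcross : ∀ w ∈ U, ∀ y : E3, ⟪y, nrm (G t) w⟫ = 0 → ⟪X w, y⟫ = 0 := by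
    intro w hw y hy
    simp only [hXdef]
    rw [hflow w hw, inner_smul_left, real_inner_comm, hy, mul_zero]
  have hdiv := fderiv_conormal_add hf himm hXd
  -- The velocity is normal, so both conormal pairings vanish identically. The divergence formula
  -- then expresses the derivative of the Euclidean area element through the Laplacian times the
  -- normal speed.
  have z1 : (fun w => ⟪X w, cross (tangent (G t) w 1) (nrm (G t) w)⟫) =ᶠ[𝓝 u] fun _ => (0 : ℝ) := by
    filter_upwards [hU.mem_nhds hu] with w hw
    exact hcross w hw _ (inner_cross_right _ _)
  have z2 : (fun w => ⟪X w, cross (nrm (G t) w) (tangent (G t) w 0)⟫) =ᶠ[𝓝 u] fun _ => (0 : ℝ) := by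
    filter_upwards [hU.mem_nhds hu] with w hw
    exact hcross w hw _ (inner_cross_left _ _)
  rw [z1.fderiv_eq, z2.fderiv_eq] at hdiv
  have hω : HasDerivAt (fun s => areaVec (fderiv ℝ (G s) u)) _ t :=
    HasFDerivAt.hasDerivAt (cross.hasFDerivAt_of_bilinear h0.hasFDerivAt h1.hasFDerivAt)
  have hsq := hω.norm_sq
  have hW : ‖areaVec (fderiv ℝ (G t) u)‖ ≠ 0 := norm_ne_zero_iff.2 himm
  have hnorm := hsq.sqrt (pow_ne_zero 2 hW)
  have hx : HasDerivAt (fun s => G s u 2) (X u 2) t := by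
    have a := (hasDerivWithinAt_slice (q := (t, u)) hG ⟨ht', hu⟩)
    have b := (a.hasDerivAt (Ico_mem_nhds ht.1 ht.2))
    have c : X u = _ := derivWithin_slice_eq (q := (t, u)) hG ⟨ht', hu⟩
    rw [← c] at b
    exact (EuclideanSpace.proj (2 : Fin 3) : E3 →L[ℝ] ℝ).hasFDerivAt.comp_hasDerivAt t b
  have hfin := hnorm.div (hx.pow 2) (pow_ne_zero 2 hpos.ne')
  simp only [Real.sqrt_sq (norm_nonneg _)] at hfin
  refine hfin.congr_deriv ?_
  have hXu := hflow u hu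
  change X u = _ at hXu
  set lam := G t u 2 ^ 2 / 2 * lapl (G t) u + G t u 2 * nrm (G t) u 2 with hlam
  have hn1 : ‖nrm (G t) u‖ = 1 := norm_unitVec himm
  have hXn : ‖X u‖ ^ 2 = lam ^ 2 := by
    rw [hXu, norm_smul, hn1, mul_one, Real.norm_eq_abs, sq_abs]
  have hXin : ⟪X u, nrm (G t) u⟫ = lam := by
    rw [hXu, inner_smul_left, real_inner_self_eq_norm_sq, hn1]; simp
  have hX2 : X u 2 = lam * nrm (G t) u 2 := by rw [hXu]; simp
  have hinner : ∀ a b : E3, ⟪areaVec (fderiv ℝ (G t) u), cross a b⟫ =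
      ‖areaVec (fderiv ℝ (G t) u)‖ * ⟪nrm (G t) u, cross a b⟫ := by
    intro a b
    conv_lhs => rw [areaVec_eq himm, inner_smul_left]
    rfl
  have r1 : ⟪nrm (G t) u, cross (fderiv ℝ X u (ee 0)) (tangent (G t) u 1)⟫ =
      ⟪fderiv ℝ X u (ee 0), cross (tangent (G t) u 1) (nrm (G t) u)⟫ := by
    rw [real_inner_comm, inner_cross_rotate]
  have r2 : ⟪nrm (G t) u, cross (tangent (G t) u 0) (fderiv ℝ X u (ee 1))⟫ =
      ⟪fderiv ℝ X u (ee 1), cross (nrm (G t) u) (tangent (G t) u 0)⟫ := by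
    rw [← inner_cross_rotate, real_inner_comm]
  simp only [add_apply, ContinuousLinearMap.precompR_apply, ContinuousLinearMap.precompL_apply,
    ContinuousLinearMap.compL_apply, ContinuousLinearMap.comp_apply, inner_add_right,
    ContinuousLinearMap.toSpanSingleton_apply, one_smul]
  have hs0 : fderiv ℝ (G t) u (ee 0) = tangent (G t) u 0 := rfl
  have hs1 : fderiv ℝ (G t) u (ee 1) = tangent (G t) u 1 := rfl
  have hη : fderiv ℝ (fun w => derivWithin (fun s => G s w) (Ico 0 T) t) u = fderiv ℝ X u := rfl
  simp only [hη]
  change (2 * (⟪areaVec (fderiv ℝ (G t) u), cross (tangent (G t) u 0) (fderiv ℝ X u (ee 1))⟫ +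
    ⟪areaVec (fderiv ℝ (G t) u), cross (fderiv ℝ X u (ee 0)) (tangent (G t) u 1)⟫) / _ * _ - _) / _
      = _
  rw [hinner, hinner, r1, r2]
  have hd2 : ⟪fderiv ℝ X u (ee 1), cross (nrm (G t) u) (tangent (G t) u 0)⟫ =
      -⟪fderiv ℝ X u (ee 0), cross (tangent (G t) u 1) (nrm (G t) u)⟫
      - lapl (G t) u * ‖areaVec (fderiv ℝ (G t) u)‖ * lam := by
    simp at hdiv
    rw [hXin] at hdiv
    linarith
  rw [hd2, hX2]
  change _ = -2 * (‖X u‖ ^ 2 / _) * _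
  rw [hXn]
  -- Solving the flow equation for the Laplacian. Its vertical term cancels against the derivative
  -- of the conformal factor, leaving only the square of the speed.
  have hl : lapl (G t) u = 2 * (lam - G t u 2 * nrm (G t) u 2) / G t u 2 ^ 2 := by
    rw [hlam]; field_simp; ring
  rw [hl]
  have hxx : ((fun s => G s u 2) ^ 2) t = G t u 2 ^ 2 := rfl
  rw [hxx]
  set x := G t u 2
  set W := ‖areaVec (fderiv ℝ (G t) u)‖
  have hx0 : x ≠ 0 := hpos.ne'
  clear_value lam x W
  field_simp
  ring

/-! ### Surfaces in charts -/

theorem meanCurvature_congr {f g : E2 → E3} {u : E2} (h : f =ᶠ[𝓝 u] g) (ν : E3) :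
    meanCurvature f u ν = meanCurvature g u ν := by
  have ht : ∀ i, (fun w => tangent f w i) =ᶠ[𝓝 u] fun w => tangent g w i := fun i => by
    filter_upwards [h.fderiv (𝕜 := ℝ)] with w hw
    rw [tangent, tangent, hw]
  have h1 : firstForm f u = firstForm g u := by
    ext i j
    simp only [firstForm, Matrix.of_apply, (ht i).eq_of_nhds, (ht j).eq_of_nhds, h.eq_of_nhds]
  have h2 : secondForm f u ν = secondForm g u ν := by
    ext i j
    simp only [secondForm, Matrix.of_apply, covDeriv, (ht i).eq_of_nhds, (ht j).eq_of_nhds,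
      h.eq_of_nhds, (ht j).fderiv_eq]
  rw [meanCurvature, meanCurvature, h1, h2]

section Charts

variable {N : Type*} [TopologicalSpace N] [ChartedSpace E2 N]

/-- The preferred chart at a point of a surface. -/
abbrev ch (c : N) : PartialEquiv N E2 := extChartAt (𝓡 2) c

/-- The change of charts. -/
def trans (c d : N) : E2 → E2 := ch d ∘ (ch c).symm

/-- The differential of a map in the preferred chart at a point. -/
def dL (f : N → E3) (x : N) : E2 →L[ℝ] E3 := fderiv ℝ (inChart f x) (ch x x)

theorem mem_source_symm {c : N} {u : E2} (hu : u ∈ (ch c).target) :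
    (ch c).symm u ∈ (ch c).source := (ch c).map_target hu

theorem inChart_ch (f : N → E3) {c x : N} (hx : x ∈ (ch c).source) :
    inChart f c (ch c x) = f x := by
  rw [inChart, Function.comp_apply, (ch c).left_inv hx]

theorem eventually_mem_source {c x : N} (d : N) (hc : x ∈ (ch c).source) (hd : x ∈ (ch d).source) :
    ∀ᶠ w in 𝓝 (ch c x), (ch c).symm w ∈ (ch d).source := by
  have h1 : ContinuousAt (ch c).symm (ch c x) :=
    continuousAt_extChartAt_symm' hc
  have h2 : (ch d).source ∈ 𝓝 ((ch c).symm (ch c x)) := by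
    rw [(ch c).left_inv hc]
    exact (isOpen_extChartAt_source d).mem_nhds hd
  exact h1.eventually h2

theorem inChart_eventuallyEq (f : N → E3) {c d x : N} (hc : x ∈ (ch c).source)
    (hd : x ∈ (ch d).source) : inChart f c =ᶠ[𝓝 (ch c x)] inChart f d ∘ trans c d := by
  filter_upwards [eventually_mem_source d hc hd] with w hw
  simp only [inChart, trans, Function.comp_apply]
  rw [(ch d).left_inv hw]

theorem trans_apply {c d x : N} (hc : x ∈ (ch c).source) : trans c d (ch c x) = ch d x := by
  rw [trans, Function.comp_apply, (ch c).left_inv hc]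

variable [IsManifold (𝓡 2) ∞ N]

theorem contDiffAt_trans {c d x : N} (hc : x ∈ (ch c).source) (hd : x ∈ (ch d).source) :
    ContDiffAt ℝ ∞ (trans c d) (ch c x) := by
  have h := contDiffWithinAt_ext_coord_change (I := 𝓡 2) (n := ∞) d c (y := ch c x) (by
    rw [PartialEquiv.trans_source]
    refine ⟨(ch c).map_source hc, ?_⟩
    rw [mem_preimage, (ch c).left_inv hc]; exact hd)
  rwa [ModelWithCorners.range_eq_univ, contDiffWithinAt_univ] at h

theorem det_fderiv_trans_ne_zero {c d x : N} (hc : x ∈ (ch c).source) (hd : x ∈ (ch d).source) :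
    (fderiv ℝ (trans c d) (ch c x)).det ≠ 0 := by
  have h1 := (contDiffAt_trans hc hd).differentiableAt (by simp)
  have h2 := (contDiffAt_trans hd hc).differentiableAt (by simp)
  have h3 : trans d c ∘ trans c d =ᶠ[𝓝 (ch c x)] id := by
    filter_upwards [eventually_mem_source d hc hd,
      (isOpen_extChartAt_target c).mem_nhds ((ch c).map_source hc)] with w hw hw'
    simp only [trans, Function.comp_apply]
    rw [(ch d).left_inv hw, (ch c).right_inv hw', id]
  have h4 := h3.fderiv_eq (𝕜 := ℝ)
  rw [fderiv_comp _ (by rwa [trans_apply hc]) h1, fderiv_id] at h4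
  intro h0
  have h5 := congrArg ContinuousLinearMap.det h4
  have h6 : ∀ A B : E2 →L[ℝ] E2, (A.comp B).det = A.det * B.det := fun A B =>
    LinearMap.det_comp _ _
  rw [h6, h0, mul_zero] at h5
  have : (ContinuousLinearMap.id ℝ E2).det = 1 := LinearMap.det_id
  rw [this] at h5
  exact zero_ne_one h5

theorem contDiffOn_inChart {f : N → E3} (hf : ContMDiff (𝓡 2) 𝓘(ℝ, E3) ∞ f) (c : N) :
    ContDiffOn ℝ ∞ (inChart f c) (ch c).target :=
  contMDiffOn_iff_contDiffOn.1 (hf.comp_contMDiffOn (contMDiffOn_extChartAt_symm c))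

theorem contDiffAt_inChart {f : N → E3} (hf : ContMDiff (𝓡 2) 𝓘(ℝ, E3) ∞ f) {c : N} {u : E2}
    (hu : u ∈ (ch c).target) : ContDiffAt ℝ ∞ (inChart f c) u :=
  (contDiffOn_inChart hf c).contDiffAt ((isOpen_extChartAt_target c).mem_nhds hu)

theorem fderiv_inChart {f : N → E3} (hf : ContMDiff (𝓡 2) 𝓘(ℝ, E3) ∞ f) {c d x : N}
    (hc : x ∈ (ch c).source) (hd : x ∈ (ch d).source) :
    fderiv ℝ (inChart f c) (ch c x) =
      (fderiv ℝ (inChart f d) (ch d x)).comp (fderiv ℝ (trans c d) (ch c x)) := by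
  rw [(inChart_eventuallyEq f hc hd).fderiv_eq, fderiv_comp, trans_apply hc]
  · rw [trans_apply hc]
    exact (contDiffAt_inChart hf ((ch d).map_source hd)).differentiableAt (by simp)
  · exact (contDiffAt_trans hc hd).differentiableAt (by simp)

/-- An immersed surface in `ℍ³`. -/
structure IsSurface (f : N → E3) : Prop where
  smooth : ContMDiff (𝓡 2) 𝓘(ℝ, E3) ∞ f
  area : ∀ x, areaVec (dL f x) ≠ 0
  pos : ∀ x, 0 < f x 2

theorem IsSurface.areaVec_ne {f : N → E3} (hf : IsSurface f) {c : N} {u : E2}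
    (hu : u ∈ (ch c).target) : areaVec (fderiv ℝ (inChart f c) u) ≠ 0 := by
  have hx := mem_source_symm hu
  set x := (ch c).symm u with hxdef
  have hu' : ch c x = u := (ch c).right_inv hu
  rw [← hu', fderiv_inChart hf.smooth hx (mem_extChartAt_source x), areaVec_comp]
  exact smul_ne_zero (det_fderiv_trans_ne_zero hx (mem_extChartAt_source x)) (hf.area x)

omit [IsManifold (𝓡 2) ∞ N] in
theorem inChart_pos {f : N → E3} (hf : IsSurface f) (c : N) (u : E2) : 0 < inChart f c u 2 :=
  hf.pos _

omit [IsManifold (𝓡 2) ∞ N] in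
theorem dL_injective_of_mfderiv {f : N → E3} (hf : ContMDiff (𝓡 2) 𝓘(ℝ, E3) ∞ f) {x : N}
    (h : Function.Injective (mfderiv (𝓡 2) 𝓘(ℝ, E3) f x)) : Function.Injective (dL f x) := by
  rw [(hf.mdifferentiable (by simp) x).mfderiv] at h
  simp only [ModelWithCorners.range_eq_univ, fderivWithin_univ] at h
  exact h

end Charts

/-! ### Mean curvature flow in arbitrary charts -/

section Flow

variable {N : Type*} [TopologicalSpace N] [ChartedSpace E2 N] [IsManifold (𝓡 2) ∞ N]
  {T : ℝ} {F : ℝ → N → E3}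

/-- The velocity of a flow. -/
def vel (T : ℝ) (F : ℝ → N → E3) (t : ℝ) (x : N) : E3 := derivWithin (fun s => F s x) (Ico 0 T) t

omit [IsManifold (𝓡 2) ∞ N] in
theorem IsMeanCurvatureFlow.slice_smooth (hF : IsMeanCurvatureFlow T F) {t : ℝ}
    (ht : t ∈ Ico 0 T) : ContMDiff (𝓡 2) 𝓘(ℝ, E3) ∞ (F t) := by
  have h1 : ContMDiffOn (𝓡 2) (𝓘(ℝ, ℝ).prod (𝓡 2)) ∞ (fun x : N => (t, x)) univ :=
    (contMDiff_const.prodMk contMDiff_id).contMDiffOn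
  have h2 := hF.smooth.comp h1 (fun x _ => ⟨ht, mem_univ _⟩)
  exact contMDiffOn_univ.1 h2

omit [IsManifold (𝓡 2) ∞ N] in
theorem IsMeanCurvatureFlow.isSurface (hF : IsMeanCurvatureFlow T F) {t : ℝ}
    (ht : t ∈ Ico 0 T) : IsSurface (F t) :=
  ⟨hF.slice_smooth ht,
    fun x => areaVec_ne_zero (dL_injective_of_mfderiv (hF.slice_smooth ht) (hF.immersion t ht x)),
    fun x => hF.mem t ht x⟩

theorem IsMeanCurvatureFlow.contDiffOn (hF : IsMeanCurvatureFlow T F) (c : N) :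
    ContDiffOn ℝ ∞ (fun q : ℝ × E2 => inChart (F q.1) c q.2) (Ico 0 T ×ˢ (ch c).target) := by
  have h0 : ContMDiffOn 𝓘(ℝ, ℝ × E2) (𝓘(ℝ, ℝ).prod (𝓡 2)) ∞
      (fun q : ℝ × E2 => (q.1, (ch c).symm q.2)) (Ico 0 T ×ˢ (ch c).target) := by
    have a1 : ContMDiffOn 𝓘(ℝ, ℝ × E2) 𝓘(ℝ, ℝ) ∞ (fun q : ℝ × E2 => q.1)
        (Ico 0 T ×ˢ (ch c).target) := contDiff_fst.contMDiff.contMDiffOn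
    have a2 : ContMDiffOn 𝓘(ℝ, ℝ × E2) (𝓡 2) ∞ (fun q : ℝ × E2 => (ch c).symm q.2)
        (Ico 0 T ×ˢ (ch c).target) :=
      (contMDiffOn_extChartAt_symm (n := ∞) (I := 𝓡 2) c).comp
        contDiff_snd.contMDiff.contMDiffOn (fun q hq => hq.2)
    exact a1.prodMk a2
  have h2 := hF.smooth.comp h0 (fun q hq => ⟨hq.1, mem_univ _⟩)
  exact contMDiffOn_iff_contDiffOn.1 h2

/-- Mean curvature flow in an arbitrary chart, in Euclidean terms. -/
theorem IsMeanCurvatureFlow.vel_inChart (hF : IsMeanCurvatureFlow T F) {t : ℝ}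
    (ht : t ∈ Ico 0 T) {c : N} {w : E2} (hw : w ∈ (ch c).target) :
    HasDerivWithinAt (fun s => inChart (F s) c w)
      ((inChart (F t) c w 2 ^ 2 / 2 * lapl (inChart (F t) c) w +
        inChart (F t) c w 2 * nrm (inChart (F t) c) w 2) • nrm (inChart (F t) c) w) (Ico 0 T) t := by
  have hS := hF.isSurface ht
  have hx := mem_source_symm hw
  set x := (ch c).symm w with hxdef
  have hxx := mem_extChartAt_source (I := 𝓡 2) x
  have hw' : ch c x = w := (ch c).right_inv hw
  have hτw : trans x c (ch x x) = w := by rw [trans_apply hxx, hw']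
  have hτ := contDiffAt_trans hxx hx
  have hev := inChart_eventuallyEq (F t) hxx hx
  have hfc := contDiffAt_inChart hS.smooth hw
  have harea := hS.areaVec_ne hw
  have hpos := inChart_pos hS c w
  have hval : inChart (F t) x (ch x x) = inChart (F t) c w := by
    rw [inChart_ch _ hxx]; rfl
  set ν := inChart (F t) c w 2 • nrm (inChart (F t) c) w with hν
  have hνc : IsUnitNormal (inChart (F t) c) w ν := isUnitNormal_smul_nrm harea hpos
  have hνx : IsUnitNormal (inChart (F t) x) (ch x x) ν := by
    refine ⟨?_, fun i => ?_⟩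
    · rw [hval]; exact hνc.1
    · rw [tangent, fderiv_inChart hS.smooth hxx hx, hw', metric, hν, inner_smul_right,
        ContinuousLinearMap.comp_apply, nrm, inner_unitVec]
      simp
  -- The flow equation is given only in the preferred chart at the point itself; invariance of the
  -- mean curvature carries it to the chart at `c`.
  have hH : meanCurvature (inChart (F t) x) (ch x x) ν = meanCurvature (inChart (F t) c) w ν := by
    rw [meanCurvature_congr hev]
    have h1 := meanCurvature_comp (f := inChart (F t) c) (τ := trans x c) (u := ch x x) (ν := ν)
      (by rw [hτw]; exact hfc) hτ (det_fderiv_trans_ne_zero hxx hx) (by rw [hτw]; exact hνc)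
      (by rw [hτw]; exact hpos)
    rw [h1, hτw]
  have hmain := hF.evolution t ht x ν hνx
  rw [hH, hν, neg_meanCurvature_smul hfc harea hpos] at hmain
  exact hmain

theorem IsMeanCurvatureFlow.derivWithin_inChart (hF : IsMeanCurvatureFlow T F) {t : ℝ}
    (ht : t ∈ Ico 0 T) {c : N} {w : E2} (hw : w ∈ (ch c).target) :
    derivWithin (fun s => inChart (F s) c w) (Ico 0 T) t =
      (inChart (F t) c w 2 ^ 2 / 2 * lapl (inChart (F t) c) w +
        inChart (F t) c w 2 * nrm (inChart (F t) c) w 2) • nrm (inChart (F t) c) w :=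
  (hF.vel_inChart ht hw).derivWithin (uniqueDiffOn_Ico 0 T t ht)

end Flow

/-! ### The area measure on the parameter surface -/

theorem continuous_areaVec : Continuous areaVec := by
  unfold areaVec
  exact (cross.continuous.comp (ContinuousLinearMap.apply ℝ E3 (ee 0)).continuous).clm_apply
    (ContinuousLinearMap.apply ℝ E3 (ee 1)).continuous

theorem measurable_norm_areaVec (f : E2 → E3) :
    Measurable fun u => ‖areaVec (fderiv ℝ f u)‖ :=
  (continuous_areaVec.norm).measurable.comp (measurable_fderiv ℝ f)

section

variable {N : Type*} [TopologicalSpace N] [ChartedSpace E2 N]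

theorem measurableSet_target (c : N) : MeasurableSet (ch c).target :=
  (isOpen_extChartAt_target c).measurableSet

theorem continuous_of_charts {X : Type*} [TopologicalSpace X] {g : N → X}
    (h : ∀ c : N, ContinuousOn (fun u => g ((ch c).symm u)) (ch c).target) : Continuous g := by
  rw [continuous_iff_continuousAt]
  intro x
  have h1 : ContinuousAt (fun u => g ((ch x).symm u)) (ch x x) :=
    (h x).continuousAt (extChartAt_target_mem_nhds x)
  have h2 : ContinuousAt (fun y => g ((ch x).symm (ch x y))) x :=
    ContinuousAt.comp (f := fun y => ch x y) h1 (continuousAt_extChartAt x)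
  refine h2.congr ?_
  filter_upwards [extChartAt_source_mem_nhds (I := 𝓡 2) x] with y hy
  rw [(ch x).left_inv hy]

/-- The ratio of the Euclidean area elements of two maps. -/
def jac (f₀ f : N → E3) (x : N) : ℝ := ‖areaVec (dL f x)‖ / ‖areaVec (dL f₀ x)‖

theorem jac_pos [IsManifold (𝓡 2) ∞ N] {f₀ f : N → E3} (h₀ : IsSurface f₀) (h : IsSurface f)
    (x : N) : 0 < jac f₀ f x :=
  div_pos (norm_pos_iff.2 (h.area x)) (norm_pos_iff.2 (h₀.area x))

/-- Under a change of chart both area vectors are multiplied by the same determinant, so their ratio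
is a function on the surface. It allows all times to be integrated against one fixed measure. -/
theorem jac_chart [IsManifold (𝓡 2) ∞ N] {f₀ f : N → E3} (h₀ : IsSurface f₀) (h : IsSurface f)
    {c : N} {u : E2} (hu : u ∈ (ch c).target) :
    jac f₀ f ((ch c).symm u) * ‖areaVec (fderiv ℝ (inChart f₀ c) u)‖ =
      ‖areaVec (fderiv ℝ (inChart f c) u)‖ := by
  have hx := mem_source_symm hu
  set x := (ch c).symm u with hxdef
  have hu' : ch c x = u := (ch c).right_inv hu
  have hxx := mem_extChartAt_source (I := 𝓡 2) x
  have h0 := norm_pos_iff.2 (h₀.area x)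
  rw [← hu', fderiv_inChart h.smooth hx hxx, fderiv_inChart h₀.smooth hx hxx, areaVec_comp,
    areaVec_comp, norm_smul, norm_smul, jac]
  change _ * (_ * ‖areaVec (dL f₀ x)‖) = _ * ‖areaVec (dL f x)‖
  field_simp

variable [MeasurableSpace N] [BorelSpace N]

theorem measurableSet_source (c : N) : MeasurableSet (ch c).source :=
  (isOpen_extChartAt_source c).measurableSet

theorem aemeasurable_symm (c : N) : AEMeasurable (ch c).symm (volume.restrict (ch c).target) :=
  (continuousOn_extChartAt_symm c).aemeasurable (measurableSet_target c)

theorem measurableSet_preimage_symm (c : N) {E : Set N} (hE : MeasurableSet E) :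
    MeasurableSet ((ch c).target ∩ (ch c).symm ⁻¹' E) := by
  have h1 := (continuousOn_iff_continuous_domRestrict.1 (continuousOn_extChartAt_symm (I := 𝓡 2) c))
  have h2 := (measurableSet_target c).subtype_image (h1.measurable hE)
  convert h2 using 1
  ext u
  constructor
  · rintro ⟨h, h'⟩; exact ⟨⟨u, h⟩, h', rfl⟩
  · rintro ⟨⟨v, hv⟩, h', rfl⟩; exact ⟨hv, h'⟩

/-- The area measure of `f` in a chart. -/
def chartMeas (f : N → E3) (c : N) : Measure N :=
  Measure.map (ch c).symm ((volume.restrict (ch c).target).withDensity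
    fun u => ENNReal.ofReal ‖areaVec (fderiv ℝ (inChart f c) u)‖)

theorem aemeasurable_symm' (f : N → E3) (c : N) :
    AEMeasurable (ch c).symm ((volume.restrict (ch c).target).withDensity
    fun u => ENNReal.ofReal ‖areaVec (fderiv ℝ (inChart f c) u)‖) :=
  (aemeasurable_symm c).mono_ac (withDensity_absolutelyContinuous _ _)

theorem chartMeas_apply (f : N → E3) (c : N) {E : Set N} (hE : MeasurableSet E) :
    chartMeas f c E = ∫⁻ u in (ch c).target ∩ (ch c).symm ⁻¹' E,
      ENNReal.ofReal ‖areaVec (fderiv ℝ (inChart f c) u)‖ := by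
  rw [chartMeas, Measure.map_apply_of_aemeasurable (aemeasurable_symm' f c) hE]
  have hS := measurableSet_preimage_symm c hE
  have h1 : ((volume.restrict (ch c).target).withDensity
      fun u => ENNReal.ofReal ‖areaVec (fderiv ℝ (inChart f c) u)‖) ((ch c).symm ⁻¹' E) =
      ((volume.restrict (ch c).target).withDensity
      fun u => ENNReal.ofReal ‖areaVec (fderiv ℝ (inChart f c) u)‖)
        ((ch c).target ∩ (ch c).symm ⁻¹' E) := by
    have h0 : ∀ᵐ u ∂((volume.restrict (ch c).target).withDensity
        fun u => ENNReal.ofReal ‖areaVec (fderiv ℝ (inChart f c) u)‖), u ∈ (ch c).target :=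
      (withDensity_absolutelyContinuous _ _).ae_le (ae_restrict_mem (measurableSet_target c))
    apply measure_congr
    filter_upwards [h0] with u hu
    apply propext
    exact ⟨fun h => ⟨hu, h⟩, fun h => h.2⟩
  rw [h1, withDensity_apply _ hS, Measure.restrict_restrict hS,
    inter_eq_left.2 inter_subset_left]

variable [IsManifold (𝓡 2) ∞ N]

/-- Change of variables for the transition map, whose Jacobian determinant is exactly the factor by
which the area vector changes. -/
theorem chartMeas_eq {f : N → E3} (hf : IsSurface f) {c d : N} {E : Set N} (hE : MeasurableSet E)
    (hc : E ⊆ (ch c).source) (hd : E ⊆ (ch d).source) : chartMeas f c E = chartMeas f d E := by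
  rw [chartMeas_apply f c hE, chartMeas_apply f d hE]
  set S := (ch c).target ∩ (ch c).symm ⁻¹' E with hS
  have himg : trans c d '' S = (ch d).target ∩ (ch d).symm ⁻¹' E := by
    ext w
    constructor
    · rintro ⟨u, ⟨hu, huE⟩, rfl⟩
      refine ⟨(ch d).map_source (hd huE), ?_⟩
      rw [mem_preimage, trans, Function.comp_apply, (ch d).left_inv (hd huE)]; exact huE
    · rintro ⟨hw, hwE⟩
      refine ⟨ch c ((ch d).symm w), ⟨(ch c).map_source (hc hwE), ?_⟩, ?_⟩
      · rw [mem_preimage, (ch c).left_inv (hc hwE)]; exact hwE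
      · rw [trans_apply (hc hwE), (ch d).right_inv hw]
  have hx : ∀ u ∈ S, (ch c).symm u ∈ E ∧ ch c ((ch c).symm u) = u :=
    fun u hu => ⟨hu.2, (ch c).right_inv hu.1⟩
  have hder : ∀ u ∈ S, HasFDerivWithinAt (trans c d) (fderiv ℝ (trans c d) u) S u := by
    intro u hu
    obtain ⟨h1, h2⟩ := hx u hu
    have := (contDiffAt_trans (hc h1) (hd h1)).differentiableAt (by simp)
    rw [h2] at this
    exact this.hasFDerivAt.hasFDerivWithinAt
  have hinj : InjOn (trans c d) S := by
    intro u hu v hv huv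
    obtain ⟨h1, h2⟩ := hx u hu
    obtain ⟨h3, h4⟩ := hx v hv
    have h5 := (ch d).injOn (hd h1) (hd h3) huv
    rw [← h2, ← h4, h5]
  rw [← himg, lintegral_image_eq_lintegral_abs_det_fderiv_mul volume
    (measurableSet_preimage_symm c hE) hder hinj]
  refine setLIntegral_congr_fun (measurableSet_preimage_symm c hE) fun u hu => ?_
  obtain ⟨h1, h2⟩ := hx u hu
  have h3 := fderiv_inChart hf.smooth (hc h1) (hd h1)
  rw [h2] at h3
  have h4 : trans c d u = ch d ((ch c).symm u) := rfl
  rw [h4, h3, areaVec_comp, norm_smul, ENNReal.ofReal_mul (norm_nonneg _), Real.norm_eq_abs]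

/-- The area measure of `f` with respect to a sequence of charts. -/
def areaMeas (f : N → E3) (cs : ℕ → N) : Measure N :=
  Measure.sum fun k => (chartMeas f (cs k)).restrict (disjointed (fun k => (ch (cs k)).source) k)

/-- The chart measures agree on overlaps, so it does not matter which chart `disjointed` assigns to
which piece. -/
theorem areaMeas_apply {f : N → E3} (hf : IsSurface f) {cs : ℕ → N}
    (hcs : ⋃ k, (ch (cs k)).source = univ) {c : N} {E : Set N} (hE : MeasurableSet E)
    (hc : E ⊆ (ch c).source) : areaMeas f cs E = chartMeas f c E := by
  have hB : ∀ k, MeasurableSet (disjointed (fun k => (ch (cs k)).source) k) :=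
    MeasurableSet.disjointed fun k => measurableSet_source (cs k)
  rw [areaMeas, Measure.sum_apply _ hE]
  have h1 : ∀ k, (chartMeas f (cs k)).restrict (disjointed (fun k => (ch (cs k)).source) k) E =
      chartMeas f c (E ∩ disjointed (fun k => (ch (cs k)).source) k) := by
    intro k
    rw [Measure.restrict_apply hE]
    exact chartMeas_eq hf (hE.inter (hB k))
      (inter_subset_right.trans (disjointed_subset _ _)) (inter_subset_left.trans hc)
  simp_rw [h1]
  rw [← measure_iUnion (fun i j hij => ((disjoint_disjointed _) hij).mono inter_subset_right
    inter_subset_right) (fun k => hE.inter (hB k)), ← inter_iUnion, iUnion_disjointed, hcs,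
    inter_univ]

theorem areaMeas_restrict {f : N → E3} (hf : IsSurface f) {cs : ℕ → N}
    (hcs : ⋃ k, (ch (cs k)).source = univ) (c : N) :
    (areaMeas f cs).restrict (ch c).source = chartMeas f c := by
  ext E hE
  rw [Measure.restrict_apply hE, areaMeas_apply hf hcs (hE.inter (measurableSet_source c))
    inter_subset_right, chartMeas_apply f c hE,
    chartMeas_apply f c (hE.inter (measurableSet_source c))]
  congr 2
  ext u
  constructor
  · rintro ⟨h1, h2⟩; exact ⟨h1, h2.1⟩
  · rintro ⟨h1, h2⟩; exact ⟨h1, h2, mem_source_symm h1⟩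

omit [MeasurableSpace N] [BorelSpace N] in
theorem continuousOn_norm_areaVec {f : N → E3} (hf : IsSurface f) (c : N) :
    ContinuousOn (fun u => ‖areaVec (fderiv ℝ (inChart f c) u)‖) (ch c).target :=
  continuous_areaVec.norm.comp_continuousOn
    ((contDiffOn_inChart hf.smooth c).continuousOn_fderiv_of_isOpen
      (isOpen_extChartAt_target c) (by simp))

omit [MeasurableSpace N] [BorelSpace N] in
theorem continuous_jac {f₀ f : N → E3} (h₀ : IsSurface f₀) (hf : IsSurface f) :
    Continuous (jac f₀ f) := by
  refine continuous_of_charts fun c => ?_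
  refine ((continuousOn_norm_areaVec hf c).div (continuousOn_norm_areaVec h₀ c)
    fun u hu => norm_ne_zero_iff.2 (h₀.areaVec_ne hu)).congr fun u hu => ?_
  rw [Pi.div_apply, ← jac_chart h₀ hf hu, mul_div_cancel_right₀ _ (norm_ne_zero_iff.2 (h₀.areaVec_ne hu))]

theorem lintegral_areaMeas {f₀ f : N → E3} (h₀ : IsSurface f₀) (hf : IsSurface f) {cs : ℕ → N}
    (hcs : ⋃ k, (ch (cs k)).source = univ) {c : N} {E : Set N} (hE : MeasurableSet E)
    (hc : E ⊆ (ch c).source) {h : N → ℝ≥0∞} (hh : Measurable h) :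
    ∫⁻ x in E, h x * ENNReal.ofReal (jac f₀ f x) ∂(areaMeas f₀ cs) =
      ∫⁻ u in (ch c).target ∩ (ch c).symm ⁻¹' E, h ((ch c).symm u) *
        ENNReal.ofReal ‖areaVec (fderiv ℝ (inChart f c) u)‖ := by
  have hg : Measurable fun x => h x * ENNReal.ofReal (jac f₀ f x) :=
    hh.mul (continuous_jac h₀ hf).measurable.ennreal_ofReal
  have hS := measurableSet_preimage_symm c hE
  rw [← Measure.restrict_restrict_of_subset hc, areaMeas_restrict h₀ hcs,
    ← lintegral_indicator hE, chartMeas,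
    lintegral_map' (hg.indicator hE).aemeasurable (aemeasurable_symm' f₀ c),
    lintegral_withDensity_eq_lintegral_mul_non_measurable _
      (measurable_norm_areaVec _).ennreal_ofReal (by simp),
    ← lintegral_indicator (measurableSet_target c), ← lintegral_indicator hS]
  refine lintegral_congr fun u => ?_
  by_cases hu : u ∈ (ch c).target
  · by_cases hu' : (ch c).symm u ∈ E
    · rw [indicator_of_mem hu, indicator_of_mem (show u ∈ _ ∩ _ from ⟨hu, hu'⟩), Pi.mul_apply,
        indicator_of_mem hu', ← jac_chart h₀ hf hu,
        ENNReal.ofReal_mul (jac_pos h₀ hf _).le]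
      ring
    · rw [indicator_of_mem hu, indicator_of_notMem (fun h => hu' h.2), Pi.mul_apply,
        indicator_of_notMem hu', mul_zero]
  · rw [indicator_of_notMem hu, indicator_of_notMem (fun h => hu h.1)]

theorem integral_areaMeas {f₀ f : N → E3} (h₀ : IsSurface f₀) (hf : IsSurface f) {cs : ℕ → N}
    (hcs : ⋃ k, (ch (cs k)).source = univ) {c : N} {h : N → ℝ} (hh : Measurable h)
    (hc : ∀ x ∉ (ch c).source, h x = 0) :
    ∫ x, h x * jac f₀ f x ∂(areaMeas f₀ cs) =
      ∫ u in (ch c).target, h ((ch c).symm u) * ‖areaVec (fderiv ℝ (inChart f c) u)‖ := by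
  have hg : Measurable fun x => h x * jac f₀ f x := hh.mul (continuous_jac h₀ hf).measurable
  rw [← setIntegral_eq_integral_of_forall_compl_eq_zero (s := (ch c).source)
    (fun x hx => by rw [hc x hx, zero_mul]), areaMeas_restrict h₀ hcs, chartMeas,
    integral_map (aemeasurable_symm' f₀ c) hg.aestronglyMeasurable,
    integral_withDensity_eq_integral_toReal_smul
      (measurable_norm_areaVec _).ennreal_ofReal (by simp)]
  refine setIntegral_congr_fun (measurableSet_target c) fun u hu => ?_
  simp only [ENNReal.toReal_ofReal (norm_nonneg _), smul_eq_mul]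
  rw [← jac_chart h₀ hf hu]; ring

/-- Local finiteness suffices on a compact space; near each point a closed ball in the chart target
bounds the continuous density. -/
theorem isFiniteMeasure_areaMeas [CompactSpace N] {f : N → E3} (hf : IsSurface f) {cs : ℕ → N}
    (hcs : ⋃ k, (ch (cs k)).source = univ) : IsFiniteMeasure (areaMeas f cs) := by
  refine ⟨isCompact_univ.measure_lt_top_of_nhdsWithin fun x _ => ?_⟩
  obtain ⟨r, hr, hb⟩ := Metric.nhds_basis_closedBall.mem_iff.1
    (extChartAt_target_mem_nhds (I := 𝓡 2) x)
  set E := (ch x).source ∩ (ch x) ⁻¹' Metric.ball (ch x x) r with hE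
  have hEo : IsOpen E := (continuousOn_extChartAt x).isOpen_inter_preimage
    (isOpen_extChartAt_source x) Metric.isOpen_ball
  refine ⟨E, mem_nhdsWithin_of_mem_nhds (hEo.mem_nhds ⟨mem_extChartAt_source x,
    Metric.mem_ball_self hr⟩), ?_⟩
  rw [areaMeas_apply hf hcs hEo.measurableSet inter_subset_left, chartMeas_apply _ _
    hEo.measurableSet]
  refine lt_of_le_of_lt (lintegral_mono_set (t := Metric.closedBall (ch x x) r) ?_) ?_
  · rintro u ⟨hu, hu'⟩
    have := hu'.2
    rw [mem_preimage, (ch x).right_inv hu] at this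
    exact Metric.ball_subset_closedBall this
  · have := ((continuousOn_norm_areaVec hf x).mono hb).integrableOn_compact
      (μ := volume) (isCompact_closedBall _ _)
    exact this.setLIntegral_lt_top

theorem isOpenPosMeasure_areaMeas {f : N → E3} (hf : IsSurface f) {cs : ℕ → N}
    (hcs : ⋃ k, (ch (cs k)).source = univ) : (areaMeas f cs).IsOpenPosMeasure := by
  refine ⟨fun U hU ⟨x, hx⟩ h0 => ?_⟩
  have hEo : IsOpen (U ∩ (ch x).source) := hU.inter (isOpen_extChartAt_source x)
  have h1 := measure_mono_null inter_subset_left h0 (t := U) (s := U ∩ (ch x).source)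
  rw [areaMeas_apply hf hcs hEo.measurableSet inter_subset_right, chartMeas_apply _ _
    hEo.measurableSet] at h1
  have hS : IsOpen ((ch x).target ∩ (ch x).symm ⁻¹' (U ∩ (ch x).source)) :=
    (continuousOn_extChartAt_symm x).isOpen_inter_preimage (isOpen_extChartAt_target x) hEo
  have hne : ((ch x).target ∩ (ch x).symm ⁻¹' (U ∩ (ch x).source)).Nonempty :=
    ⟨ch x x, mem_extChartAt_target x, by
      rw [mem_preimage, (ch x).left_inv (mem_extChartAt_source x)]
      exact ⟨hx, mem_extChartAt_source x⟩⟩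
  have h2 := (setLIntegral_pos_iff (μ := volume)
    (s := (ch x).target ∩ (ch x).symm ⁻¹' (U ∩ (ch x).source))
    (measurable_norm_areaVec (inChart f x)).ennreal_ofReal).2 (by
      refine lt_of_lt_of_le (hS.measure_pos volume hne) (measure_mono fun u hu => ⟨?_, hu⟩)
      simp only [Function.mem_support, ne_eq, ENNReal.ofReal_eq_zero, not_le]
      exact norm_pos_iff.2 (hf.areaVec_ne hu.1))
  exact h2.ne' h1

end

/-! ### The divergence theorem on a closed surface -/

/-- Extension by zero is C¹ on the whole plane because the support is a compact subset of `U`. The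
integral of a directional derivative is then integration by parts against the constant 1. -/
theorem integral_fderiv_eq_zero_of_support {U K : Set E2} (hU : IsOpen U) (hK : IsCompact K)
    (hKU : K ⊆ U) {P : E2 → ℝ} (hP : ContDiffOn ℝ 1 P U) (h0 : ∀ u ∈ U \ K, P u = 0) (e : E2) :
    IntegrableOn (fun u => fderiv ℝ P u e) U ∧ ∫ u in U, fderiv ℝ P u e = 0 := by
  set Q : E2 → ℝ := U.indicator P with hQ
  have hQK : ∀ u ∉ K, Q u = 0 := by
    intro u hu
    by_cases huU : u ∈ U
    · rw [hQ, indicator_of_mem huU, h0 u ⟨huU, hu⟩]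
    · rw [hQ, indicator_of_notMem huU]
  have hev : ∀ u ∈ U, Q =ᶠ[𝓝 u] P := fun u hu => by
    filter_upwards [hU.mem_nhds hu] with w hw
    rw [hQ, indicator_of_mem hw]
  have hev0 : ∀ u ∉ K, Q =ᶠ[𝓝 u] fun _ => 0 := fun u hu => by
    filter_upwards [hK.isClosed.isOpen_compl.mem_nhds hu] with w hw
    exact hQK w hw
  have hQc : ContDiff ℝ 1 Q := by
    rw [contDiff_iff_contDiffAt]
    intro u
    by_cases hu : u ∈ U
    · exact (hP.contDiffAt (hU.mem_nhds hu)).congr_of_eventuallyEq (hev u hu)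
    · exact contDiffAt_const.congr_of_eventuallyEq (hev0 u fun h => hu (hKU h))
  have hsupp : HasCompactSupport Q := HasCompactSupport.intro hK hQK
  have hdc : Continuous fun u => fderiv ℝ Q u e :=
    (hQc.continuous_fderiv (by simp)).clm_apply continuous_const
  have hds : HasCompactSupport fun u => fderiv ℝ Q u e := hsupp.fderiv_apply (𝕜 := ℝ) e
  have hint : Integrable fun u => fderiv ℝ Q u e := hdc.integrable_of_hasCompactSupport hds
  have hQint : Integrable Q := hQc.continuous.integrable_of_hasCompactSupport hsupp
  have hzero := integral_mul_fderiv_eq_neg_fderiv_mul_of_integrable (μ := volume) (𝕜 := ℝ)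
    (f := fun _ : E2 => (1 : ℝ)) (g := Q) (v := e) (by simp) (by simpa using hint)
    (by simpa using hQint) (by simp) (fun x _ => hQc.differentiable (by simp) x)
  simp at hzero
  have heq : ∀ u ∈ U, fderiv ℝ Q u e = fderiv ℝ P u e := fun u hu => by
    rw [(hev u hu).fderiv_eq]
  refine ⟨hint.integrableOn.congr_fun heq hU.measurableSet, ?_⟩
  rw [← setIntegral_congr_fun hU.measurableSet heq,
    setIntegral_eq_integral_of_forall_compl_eq_zero, hzero]
  intro u hu
  rw [(hev0 u fun h => hu (hKU h)).fderiv_eq]; simp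

/-- The gradient along a surface: the tangent vector dual to a linear form on the plane. -/
def surfGrad (L : E2 →L[ℝ] E3) (α : E2 →L[ℝ] ℝ) : E3 :=
  (‖areaVec L‖ ^ 2)⁻¹ • cross (α (ee 0) • L (ee 1) - α (ee 1) • L (ee 0)) (areaVec L)

theorem surfGrad_comp (L : E2 →L[ℝ] E3) (α : E2 →L[ℝ] ℝ) {A : E2 →L[ℝ] E2} (hA : A.det ≠ 0) :
    surfGrad (L.comp A) (α.comp A) = surfGrad L α := by
  have h : ∀ i, L (A (ee i)) = A (ee i) 0 • L (ee 0) + A (ee i) 1 • L (ee 1) := by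
    intro i
    conv_lhs => rw [eq_sum_ee (A (ee i))]
    rw [map_add, map_smul, map_smul]
  have h' : ∀ i, α (A (ee i)) = A (ee i) 0 * α (ee 0) + A (ee i) 1 * α (ee 1) := by
    intro i
    conv_lhs => rw [eq_sum_ee (A (ee i))]
    rw [map_add, map_smul, map_smul]; simp
  have h2 : (α.comp A) (ee 0) • (L.comp A) (ee 1) - (α.comp A) (ee 1) • (L.comp A) (ee 0) =
      A.det • (α (ee 0) • L (ee 1) - α (ee 1) • L (ee 0)) := by
    rw [det_plane]
    simp only [ContinuousLinearMap.comp_apply, h, h']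
    module
  rw [surfGrad, surfGrad, h2, areaVec_comp, norm_smul]
  simp only [map_smul, smul_apply, smul_smul]
  congr 1
  rw [Real.norm_eq_abs, mul_pow, sq_abs, mul_inv]
  field_simp

theorem surfGrad_sum {ι : Type*} (s : Finset ι) (L : E2 →L[ℝ] E3) (α : ι → E2 →L[ℝ] ℝ) :
    ∑ i ∈ s, surfGrad L (α i) = surfGrad L (∑ i ∈ s, α i) := by
  simp only [surfGrad, ← Finset.smul_sum, sum_apply]
  congr 1
  simp only [Finset.sum_smul, ← Finset.sum_sub_distrib, map_sum, sum_apply]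

theorem surfGrad_zero (L : E2 →L[ℝ] E3) : surfGrad L 0 = 0 := by simp [surfGrad]

/-- The right-hand side is what the product rule leaves when a cutoff function is differentiated in
the coordinate divergence. Written with `surfGrad`, it becomes independent of the chart. -/
theorem norm_mul_inner_surfGrad {L : E2 →L[ℝ] E3} (h : areaVec L ≠ 0) (α : E2 →L[ℝ] ℝ) (x : E3) :
    ‖areaVec L‖ * ⟪x, surfGrad L α⟫ = α (ee 0) * ⟪x, cross (L (ee 1)) (unitVec L)⟫ +
      α (ee 1) * ⟪x, cross (unitVec L) (L (ee 0))⟫ := by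
  have hW := norm_ne_zero_iff.2 h
  rw [surfGrad, unitVec, cross_swap _ (L (ee 0))]
  simp only [map_sub, map_smul, sub_apply, smul_apply, inner_smul_right, inner_sub_right,
    inner_neg_right]
  field_simp
  ring

/-- The divergence of a vector field of space along the plane orthogonal to `n`. -/
def planeDiv (D : E3 →L[ℝ] E3) (n : E3) : ℝ :=
  (∑ j, D (EuclideanSpace.single j 1) j) - ⟪D n, n⟫

theorem planeDiv_neg (D : E3 →L[ℝ] E3) (n : E3) : planeDiv D (-n) = planeDiv D n := by
  simp [planeDiv]

theorem inner_map_conormal_add {L : E2 →L[ℝ] E3} (h : areaVec L ≠ 0) (D : E3 →L[ℝ] E3) :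
    ⟪D (L (ee 0)), cross (L (ee 1)) (unitVec L)⟫ + ⟪D (L (ee 1)), cross (unitVec L) (L (ee 0))⟫ =
      ‖areaVec L‖ * planeDiv D (unitVec L) := by
  have hW := norm_ne_zero_iff.2 h
  have := inner_map_cross_add (a := L (ee 0)) (b := L (ee 1)) D
  rw [← areaVec] at this
  rw [planeDiv, unitVec]
  simp only [map_smul, smul_apply, inner_smul_right, inner_smul_left, conj_trivial]
  rw [← mul_add, this]
  field_simp

section

variable {N : Type*} [TopologicalSpace N] [ChartedSpace E2 N] [IsManifold (𝓡 2) ∞ N]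

/-- The differential of a function in the preferred chart at a point. -/
def dS (ρ : N → ℝ) (x : N) : E2 →L[ℝ] ℝ := fderiv ℝ (ρ ∘ (ch x).symm) (ch x x)

theorem contDiffAt_comp_symm {ρ : N → ℝ} (hρ : ContMDiff (𝓡 2) 𝓘(ℝ, ℝ) ∞ ρ) {c : N} {u : E2}
    (hu : u ∈ (ch c).target) : ContDiffAt ℝ ∞ (ρ ∘ (ch c).symm) u :=
  (contMDiffOn_iff_contDiffOn.1 (hρ.comp_contMDiffOn (contMDiffOn_extChartAt_symm c))).contDiffAt
    ((isOpen_extChartAt_target c).mem_nhds hu)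

theorem fderiv_comp_symm {ρ : N → ℝ} (hρ : ContMDiff (𝓡 2) 𝓘(ℝ, ℝ) ∞ ρ) {c x : N}
    (hc : x ∈ (ch c).source) :
    fderiv ℝ (ρ ∘ (ch c).symm) (ch c x) =
      (dS ρ x).comp (fderiv ℝ (trans c x) (ch c x)) := by
  have hd := mem_extChartAt_source (I := 𝓡 2) x
  have hev : ρ ∘ (ch c).symm =ᶠ[𝓝 (ch c x)] (ρ ∘ (ch x).symm) ∘ trans c x := by
    filter_upwards [eventually_mem_source x hc hd] with w hw
    simp only [trans, Function.comp_apply]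
    rw [(ch x).left_inv hw]
  rw [hev.fderiv_eq, fderiv_comp, trans_apply hc]
  · rfl
  · rw [trans_apply hc]
    exact (contDiffAt_comp_symm hρ ((ch x).map_source hd)).differentiableAt (by simp)
  · exact (contDiffAt_trans hc hd).differentiableAt (by simp)

/-- The unit normal of a surface (up to sign, in the preferred charts). -/
def normalAt (f : N → E3) (x : N) : E3 := unitVec (dL f x)

theorem nrm_inChart {f : N → E3} (hf : IsSurface f) {c : N} {u : E2} (hu : u ∈ (ch c).target) :
    nrm (inChart f c) u = normalAt f ((ch c).symm u) ∨
      nrm (inChart f c) u = -normalAt f ((ch c).symm u) := by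
  have hx := mem_source_symm hu
  have hu' : ch c ((ch c).symm u) = u := (ch c).right_inv hu
  have hxx := mem_extChartAt_source (I := 𝓡 2) ((ch c).symm u)
  have h := fderiv_inChart hf.smooth hx hxx
  rw [hu'] at h
  rw [nrm, h]
  have h2 := det_fderiv_trans_ne_zero hx hxx
  rw [hu'] at h2
  exact unitVec_comp _ h2

theorem surfGrad_inChart {f : N → E3} (hf : IsSurface f) {ρ : N → ℝ}
    (hρ : ContMDiff (𝓡 2) 𝓘(ℝ, ℝ) ∞ ρ) {c : N} {u : E2} (hu : u ∈ (ch c).target) :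
    surfGrad (fderiv ℝ (inChart f c) u) (fderiv ℝ (ρ ∘ (ch c).symm) u) =
      surfGrad (dL f ((ch c).symm u)) (dS ρ ((ch c).symm u)) := by
  have hx := mem_source_symm hu
  have hu' : ch c ((ch c).symm u) = u := (ch c).right_inv hu
  have hxx := mem_extChartAt_source (I := 𝓡 2) ((ch c).symm u)
  have h := fderiv_inChart hf.smooth hx hxx
  have h1 := fderiv_comp_symm hρ hx
  have h2 := det_fderiv_trans_ne_zero hx hxx
  rw [hu'] at h h1 h2
  rw [h, h1, surfGrad_comp _ _ h2]; rfl

variable [CompactSpace N] [T2Space N] [MeasurableSpace N] [BorelSpace N]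

/-- The divergence theorem on a closed surface, for the restriction of a vector field of space.
The vector field `V` is the Laplacian of the position vector. -/
theorem integral_planeDiv_add_inner {f₀ f : N → E3} (h₀ : IsSurface f₀) (hf : IsSurface f)
    {cs : ℕ → N} (hcs : ⋃ k, (ch (cs k)).source = univ) {V : N → E3} (hVc : Continuous V)
    (hV : ∀ (c : N), ∀ u ∈ (ch c).target,
      V ((ch c).symm u) = lapl (inChart f c) u • nrm (inChart f c) u)
    {Ω : Set E3} (hΩ : IsOpen Ω) {X : E3 → E3} (hX : ContDiffOn ℝ ∞ X Ω) (hfΩ : ∀ x, f x ∈ Ω) :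
    ∫ x, (planeDiv (fderiv ℝ X (f x)) (normalAt f x) + ⟪X (f x), V x⟫) * jac f₀ f x
      ∂(areaMeas f₀ cs) = 0 := by
  -- Localizing with a partition of unity costs gradient terms `gr i`; they are kept as globally
  -- defined functions so that they can be summed at the end.
  obtain ⟨ρ, hρ⟩ := SmoothPartitionOfUnity.exists_isSubordinate_chartAt_source (𝓡 2) N
  have hfin : {i | (Function.support (ρ i)).Nonempty}.Finite :=
    ρ.locallyFinite.finite_nonempty_of_compact
  set I := hfin.toFinset with hI
  have hsum : ∀ x, ∑ i ∈ I, ρ i x = 1 := by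
    intro x
    rw [← ρ.sum_eq_one (mem_univ x), finsum_eq_sum_of_support_subset]
    intro i hi
    rw [hI, Finite.coe_toFinset]
    exact ⟨x, hi⟩
  have hsm : ∀ i, ContMDiff (𝓡 2) 𝓘(ℝ, ℝ) ∞ (ρ i) := fun i => (ρ i).contMDiff
  have hsrc : ∀ i, tsupport (ρ i) ⊆ (ch i).source := by
    intro i
    rw [extChartAt_source]; exact hρ i
  set dv : N → ℝ := fun x => planeDiv (fderiv ℝ X (f x)) (normalAt f x) + ⟪X (f x), V x⟫ with hdv
  set gr : N → N → ℝ := fun i x => ⟪X (f x), surfGrad (dL f x) (dS (ρ i) x)⟫ with hgr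
  have hfc : Continuous f := hf.smooth.continuous
  have hcX : Continuous fun x => X (f x) :=
    hX.continuousOn.comp_continuous hfc hfΩ
  have hfdc : ∀ c, ContinuousOn (fun u => fderiv ℝ (inChart f c) u) (ch c).target := fun c =>
    (contDiffOn_inChart hf.smooth c).continuousOn_fderiv_of_isOpen
      (isOpen_extChartAt_target c) (by simp)
  have hcdv : Continuous dv := by
    refine Continuous.add ?_ (hcX.inner hVc)
    refine continuous_of_charts fun c => ?_
    have h1 : ContinuousOn (fun u => planeDiv (fderiv ℝ X (inChart f c u)) (nrm (inChart f c) u))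
        (ch c).target := by
      have hD : ContinuousOn (fun u => fderiv ℝ X (inChart f c u)) (ch c).target :=
        (hX.continuousOn_fderiv_of_isOpen hΩ (by simp)).comp
          (contDiffOn_inChart hf.smooth c).continuousOn fun u _ => hfΩ _
      have hn : ContinuousOn (nrm (inChart f c)) (ch c).target := fun u hu =>
        (nrm_contDiffAt (contDiffAt_inChart hf.smooth hu)
          (hf.areaVec_ne hu)).continuousAt.continuousWithinAt
      unfold planeDiv
      refine ContinuousOn.sub ?_ ((hD.clm_apply hn).inner hn)
      refine continuousOn_finsetSum _ fun j _ => ?_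
      exact (EuclideanSpace.proj (𝕜 := ℝ) j).continuous.comp_continuousOn
        (hD.clm_apply continuousOn_const)
    refine h1.congr fun u hu => ?_
    simp only
    rcases nrm_inChart hf hu with h | h
    · rw [h]; rfl
    · rw [h, planeDiv_neg]; rfl
  have hcgr : ∀ i, Continuous (gr i) := by
    intro i
    refine continuous_of_charts fun c => ?_
    have h1 : ContinuousOn (fun u => ⟪X (inChart f c u),
        surfGrad (fderiv ℝ (inChart f c) u) (fderiv ℝ (ρ i ∘ (ch c).symm) u)⟫) (ch c).target := by
      have hα : ContinuousOn (fun u => fderiv ℝ (ρ i ∘ (ch c).symm) u) (ch c).target :=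
        (contMDiffOn_iff_contDiffOn.1 ((hsm i).comp_contMDiffOn
          (contMDiffOn_extChartAt_symm c))).continuousOn_fderiv_of_isOpen
            (isOpen_extChartAt_target c) (by simp)
      have hA : ContinuousOn (fun u => areaVec (fderiv ℝ (inChart f c) u)) (ch c).target :=
        continuous_areaVec.comp_continuousOn (hfdc c)
      refine ContinuousOn.inner (𝕜 := ℝ)
        (hX.continuousOn.comp (contDiffOn_inChart hf.smooth c).continuousOn fun u _ => hfΩ _) ?_
      unfold surfGrad
      refine ((hA.norm.pow 2).inv₀ fun u hu =>
        pow_ne_zero 2 (norm_ne_zero_iff.2 (hf.areaVec_ne hu))).smul ?_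
      refine (ContinuousOn.clm_apply (continuousOn_const (c := cross)) ?_).clm_apply hA
      exact ((hα.clm_apply continuousOn_const).smul ((hfdc c).clm_apply continuousOn_const)).sub
        ((hα.clm_apply continuousOn_const).smul ((hfdc c).clm_apply continuousOn_const))
    refine h1.congr fun u hu => ?_
    simp only [hgr]
    rw [surfGrad_inChart hf (hsm i) hu]; rfl
  have hcρ : ∀ i, Continuous (ρ i) := fun i => (hsm i).continuous
  have := isFiniteMeasure_areaMeas h₀ hcs
  -- Each piece is the coordinate divergence of the tangential part of `ρ i • X`, which has compact
  -- support in a single chart.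
  have hpiece : ∀ i, ∫ x, (ρ i x * dv x + gr i x) * jac f₀ f x ∂(areaMeas f₀ cs) = 0 := by
    intro i
    have hnear : ∀ x ∉ tsupport (ρ i), dS (ρ i) x = 0 := by
      intro x hx
      have h1 : ∀ᶠ y in 𝓝 x, ρ i y = 0 := by
        filter_upwards [(isClosed_tsupport _).isOpen_compl.mem_nhds hx] with y hy
        exact image_eq_zero_of_notMem_tsupport hy
      have h2 : ρ i ∘ (ch x).symm =ᶠ[𝓝 (ch x x)] fun _ => 0 := by
        have h3 : Tendsto (ch x).symm (𝓝 (ch x x)) (𝓝 x) := by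
          have := continuousAt_extChartAt_symm (I := 𝓡 2) x
          rwa [ContinuousAt, extChartAt_to_inv] at this
        exact h3.eventually h1
      rw [dS, h2.fderiv_eq]; simp
    rw [integral_areaMeas h₀ hf hcs (c := i) (h := fun x => ρ i x * dv x + gr i x)
      (((hcρ i).mul hcdv).add (hcgr i)).measurable]
    swap
    · intro x hx
      have hx' : x ∉ tsupport (ρ i) := fun h => hx (hsrc i h)
      simp only [hgr]
      rw [image_eq_zero_of_notMem_tsupport hx', hnear x hx', surfGrad_zero]; simp
    set φ : E2 → ℝ := ρ i ∘ (ch i).symm with hφ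
    set g := inChart f i with hg
    set U := (ch i).target with hU
    have hUo : IsOpen U := isOpen_extChartAt_target i
    set K := (ch i) '' tsupport (ρ i) with hKdef
    have hK : IsCompact K := (isClosed_tsupport _).isCompact.image_of_continuousOn
      ((continuousOn_extChartAt i).mono (hsrc i))
    have hKU : K ⊆ U := by
      rintro _ ⟨x, hx, rfl⟩; exact (ch i).map_source (hsrc i hx)
    have hφ0 : ∀ u ∈ U \ K, φ u = 0 := by
      rintro u ⟨hu, huK⟩
      change ρ i ((ch i).symm u) = 0
      apply image_eq_zero_of_notMem_tsupport
      intro h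
      exact huK ⟨_, h, (ch i).right_inv hu⟩
    have hφs : ∀ u ∈ U, ContDiffAt ℝ ∞ φ u := fun u hu => contDiffAt_comp_symm (hsm i) hu
    have hgs : ∀ u ∈ U, ContDiffAt ℝ ∞ g u := fun u hu => contDiffAt_inChart hf.smooth hu
    have hXg : ∀ u ∈ U, ContDiffAt ℝ ∞ (fun w => X (g w)) u := fun u hu =>
      (hX.contDiffAt (hΩ.mem_nhds (hfΩ _))).comp u (hgs u hu)
    set Y : E2 → E3 := fun w => φ w • X (g w) with hY
    have hYs : ∀ u ∈ U, ContDiffAt ℝ ∞ Y u := fun u hu => (hφs u hu).smul (hXg u hu)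
    set P0 : E2 → ℝ := fun w => ⟪Y w, cross (tangent g w 1) (nrm g w)⟫ with hP0
    set P1 : E2 → ℝ := fun w => ⟪Y w, cross (nrm g w) (tangent g w 0)⟫ with hP1
    have hns : ∀ u ∈ U, ContDiffAt ℝ ∞ (nrm g) u := fun u hu =>
      nrm_contDiffAt (hgs u hu) (hf.areaVec_ne hu)
    have hP0s : ContDiffOn ℝ 1 P0 U := fun u hu => (((hYs u hu).inner ℝ
      ((contDiffAt_const.clm_apply (tangent_differentiableAt (hgs u hu) 1)).clm_apply
        (hns u hu))).of_le (by simp)).contDiffWithinAt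
    have hP1s : ContDiffOn ℝ 1 P1 U := fun u hu => (((hYs u hu).inner ℝ
      ((contDiffAt_const.clm_apply (hns u hu)).clm_apply
        (tangent_differentiableAt (hgs u hu) 0))).of_le (by simp)).contDiffWithinAt
    obtain ⟨hi0, hz0⟩ := integral_fderiv_eq_zero_of_support hUo hK hKU hP0s
      (fun u hu => by simp only [hP0, hY]; rw [hφ0 u hu]; simp) (ee 0)
    obtain ⟨hi1, hz1⟩ := integral_fderiv_eq_zero_of_support hUo hK hKU hP1s
      (fun u hu => by simp only [hP1, hY]; rw [hφ0 u hu]; simp) (ee 1)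
    rw [show (0 : ℝ) = ∫ u in U, (fderiv ℝ P0 u (ee 0) + fderiv ℝ P1 u (ee 1)) by
      rw [integral_add hi0 hi1, hz0, hz1, add_zero]]
    refine setIntegral_congr_fun hUo.measurableSet fun u hu => ?_
    have harea := hf.areaVec_ne hu
    have hmain := fderiv_conormal_add (hgs u hu) harea ((hYs u hu).differentiableAt (by simp))
    change fderiv ℝ P0 u (ee 0) + fderiv ℝ P1 u (ee 1) = _ at hmain
    rw [hmain]
    have hφd := (hφs u hu).differentiableAt (n := ∞) (by simp)
    have hXd : HasFDerivAt (fun w => X (g w)) ((fderiv ℝ X (g u)).comp (fderiv ℝ g u)) u :=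
      ((hX.contDiffAt (hΩ.mem_nhds (hfΩ _))).differentiableAt (by simp)).hasFDerivAt.comp u
        ((hgs u hu).differentiableAt (by simp)).hasFDerivAt
    have hYd : ∀ ξ, fderiv ℝ Y u ξ = φ u • fderiv ℝ X (g u) (fderiv ℝ g u ξ) +
        fderiv ℝ φ u ξ • X (g u) := by
      intro ξ
      have hYf : HasFDerivAt Y _ u := hφd.hasFDerivAt.smul hXd
      rw [hYf.fderiv]; simp
    have hdvu : dv ((ch i).symm u) = planeDiv (fderiv ℝ X (g u)) (nrm g u) +
        lapl g u * ⟪X (g u), nrm g u⟫ := by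
      simp only [hdv]
      rw [hV i u hu, inner_smul_right]
      rcases nrm_inChart hf hu with h | h
      · rw [← hg] at h; rw [h]; rfl
      · rw [← hg] at h; rw [h, planeDiv_neg]; rfl
    have hgru : gr i ((ch i).symm u) = ⟪X (g u), surfGrad (fderiv ℝ g u) (fderiv ℝ φ u)⟫ := by
      simp only [hgr]
      rw [hg, hφ, surfGrad_inChart hf (hsm i) hu]; rfl
    have k1 := norm_mul_inner_surfGrad harea (fderiv ℝ φ u) (X (g u))
    have k2 := inner_map_conormal_add harea (fderiv ℝ X (g u))
    rw [hdvu, hgru, hYd, hYd]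
    simp only [inner_add_left, inner_smul_left, conj_trivial, hY]
    change (φ u * _ + _) * _ = _
    rw [add_mul, mul_comm ⟪X (g u), surfGrad _ _⟫, k1]
    change _ = φ u * ⟪_, cross (fderiv ℝ g u (ee 1)) (unitVec _)⟫ + _ * ⟪_, cross (fderiv ℝ g u (ee 1)) (unitVec _)⟫ +
      (φ u * ⟪_, cross (unitVec _) (fderiv ℝ g u (ee 0))⟫ + _ * ⟪_, cross (unitVec _) (fderiv ℝ g u (ee 0))⟫) + _
    simp only [nrm]
    linear_combination (-φ u) * k2
  have hjc := continuous_jac h₀ hf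
  have hint : ∀ i, Integrable (fun x => (ρ i x * dv x + gr i x) * jac f₀ f x) (areaMeas f₀ cs) :=
    fun i => ((((hcρ i).mul hcdv).add (hcgr i)).mul hjc).integrable_of_hasCompactSupport
      (HasCompactSupport.of_compactSpace _)
  rw [show (0 : ℝ) = ∑ i ∈ I, ∫ x, (ρ i x * dv x + gr i x) * jac f₀ f x ∂(areaMeas f₀ cs) by
    simp [hpiece], ← integral_finsetSum _ fun i _ => hint i]
  refine integral_congr_ae (Eventually.of_forall fun x => ?_)
  simp only
  rw [← Finset.sum_mul, Finset.sum_add_distrib, ← Finset.sum_mul, hsum, one_mul]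
  -- The partition functions sum to a constant, so their gradients cancel.
  have hgr0 : ∑ i ∈ I, gr i x = 0 := by
    simp only [hgr]
    rw [← inner_sum, surfGrad_sum]
    have : ∑ i ∈ I, dS (ρ i) x = 0 := by
      have h1 : ∀ i ∈ I, DifferentiableAt ℝ (ρ i ∘ (ch x).symm) (ch x x) := fun i _ =>
        (contDiffAt_comp_symm (hsm i) (mem_extChartAt_target x)).differentiableAt (by simp)
      simp only [dS]
      rw [← fderiv_fun_sum h1]
      have h2 : (fun w => ∑ i ∈ I, (ρ i ∘ (ch x).symm) w) = fun _ => 1 := by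
        funext w; exact hsum _
      rw [h2]; simp
    rw [this, surfGrad_zero, inner_zero_right]
  rw [hgr0, add_zero]

end

/-! ### The Willmore identity -/

/-- The hyperbolic gradient of `log (|y - p|² / y₂)`, up to the factor `y₂²`. -/
def inversionField (p y : E3) : E3 :=
  (2 / ‖y - p‖ ^ 2) • (y - p) - (1 / y 2) • EuclideanSpace.single (2 : Fin 3) (1 : ℝ)

theorem contDiffOn_inversionField (p : E3) :
    ContDiffOn ℝ ∞ (inversionField p) {y : E3 | y ≠ p ∧ 0 < y 2} := by
  intro y hy
  apply ContDiffAt.contDiffWithinAt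
  have h1 : ContDiffAt ℝ ∞ (fun y : E3 => y - p) y := contDiffAt_id.sub contDiffAt_const
  have h2 : ContDiffAt ℝ ∞ (fun y : E3 => y 2) y :=
    (EuclideanSpace.proj (𝕜 := ℝ) (2 : Fin 3)).contDiff.contDiffAt
  unfold inversionField
  exact ((contDiffAt_const.div (h1.norm_sq ℝ)
    (pow_ne_zero 2 (norm_ne_zero_iff.2 (sub_ne_zero.2 hy.1)))).smul h1).sub
    ((contDiffAt_const.div h2 hy.2.ne').smul contDiffAt_const)

theorem fderiv_inversionField {p y : E3} (hy : y ≠ p) (hy2 : 0 < y 2) (h : E3) :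
    fderiv ℝ (inversionField p) y h = (2 / ‖y - p‖ ^ 2) • h -
      (4 * ⟪y - p, h⟫ / ‖y - p‖ ^ 4) • (y - p) +
      (h 2 / y 2 ^ 2) • EuclideanSpace.single (2 : Fin 3) (1 : ℝ) := by
  have hr : ‖y - p‖ ≠ 0 := norm_ne_zero_iff.2 (sub_ne_zero.2 hy)
  have h1 : HasFDerivAt (fun y : E3 => y - p) (ContinuousLinearMap.id ℝ E3) y :=
    (hasFDerivAt_id y).sub_const p
  have h2 : HasFDerivAt (fun y : E3 => y 2) (EuclideanSpace.proj (𝕜 := ℝ) (2 : Fin 3)) y :=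
    (EuclideanSpace.proj (𝕜 := ℝ) (2 : Fin 3)).hasFDerivAt
  have h3 := h1.norm_sq
  have h4 := ((hasDerivAt_inv (pow_ne_zero 2 hr)).comp_hasFDerivAt y h3).const_mul (2 : ℝ)
  have h5 := (hasDerivAt_inv hy2.ne').comp_hasFDerivAt y h2
  have h6 : HasFDerivAt (fun y : E3 => (2 * (‖y - p‖ ^ 2)⁻¹) • (y - p) -
      ((y 2)⁻¹) • EuclideanSpace.single (2 : Fin 3) (1 : ℝ)) _ y :=
    (h4.smul h1).sub (h5.smul_const (EuclideanSpace.single (2 : Fin 3) (1 : ℝ)))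
  have h7 : inversionField p = fun y : E3 => (2 * (‖y - p‖ ^ 2)⁻¹) • (y - p) -
      ((y 2)⁻¹) • EuclideanSpace.single (2 : Fin 3) (1 : ℝ) := by
    funext z; simp only [inversionField, div_eq_mul_inv, one_mul]
  rw [h7, h6.fderiv]
  simp only [Function.comp_apply, sub_apply, add_apply, smul_apply,
    ContinuousLinearMap.smulRight_apply, ContinuousLinearMap.id_apply,
    ContinuousLinearMap.comp_apply, innerSL_apply_apply, smul_eq_mul]
  have hpr : (EuclideanSpace.proj (𝕜 := ℝ) (2 : Fin 3)) h = h 2 := rfl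
  rw [hpr]
  ext i
  simp only [PiLp.add_apply, PiLp.sub_apply, PiLp.smul_apply, smul_eq_mul, nsmul_eq_mul]
  push_cast
  field_simp
  ring

/-- The terms in |y-p|⁻² have coefficient 3·2 - 4 - 2 = 0. This cancellation is special to surfaces
in three-space and leaves only the square that is completed in `willmore_pointwise`. -/
theorem planeDiv_inversionField {p y n : E3} (hy : y ≠ p) (hy2 : 0 < y 2) (hn : ‖n‖ = 1) :
    planeDiv (fderiv ℝ (inversionField p) y) n =
      4 * ⟪y - p, n⟫ ^ 2 / ‖y - p‖ ^ 4 + (1 - n 2 ^ 2) / y 2 ^ 2 := by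
  have hr : ‖y - p‖ ≠ 0 := norm_ne_zero_iff.2 (sub_ne_zero.2 hy)
  have hnn : ⟪n, n⟫ = (1 : ℝ) := by rw [real_inner_self_eq_norm_sq, hn]; norm_num
  have hen : ⟪(EuclideanSpace.single (2 : Fin 3) (1 : ℝ) : E3), n⟫ = n 2 := by
    simp [inner_coord]
  have hD := fderiv_inversionField hy hy2
  generalize fderiv ℝ (inversionField p) y = D at *
  generalize y - p = z at *
  have hsq := norm_sq_coord z
  have e : ∀ i : Fin 3, ⟪z, (EuclideanSpace.single i (1 : ℝ) : E3)⟫ = z i := by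
    intro i; fin_cases i <;> simp [inner_coord]
  rw [planeDiv, Fin.sum_univ_three]
  simp only [hD, inner_add_left, inner_sub_left, inner_smul_left, conj_trivial, hnn, hen, e,
    PiLp.add_apply, PiLp.sub_apply, PiLp.smul_apply, smul_eq_mul]
  simp
  field_simp
  linear_combination (4 * y 2 ^ 2) * hsq

/-! ### Mean curvature vectors and the deviation from tangent spheres -/

section

variable {N : Type*} [TopologicalSpace N] [ChartedSpace E2 N] [IsManifold (𝓡 2) ∞ N]

/-- `v` is the mean curvature vector (for the hyperbolic metric) of the surface `f`. -/
structure HasCurvatureVector (f v : N → E3) : Prop where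
  cont : Continuous v
  chart : ∀ (c : N), ∀ u ∈ (ch c).target, v ((ch c).symm u) =
    (inChart f c u 2 ^ 2 / 2 * lapl (inChart f c) u +
        inChart f c u 2 * nrm (inChart f c) u 2) • nrm (inChart f c) u

/-- The scalar mean curvature, up to sign. -/
def kap (f v : N → E3) (x : N) : ℝ := ⟪v x, normalAt f x⟫ / f x 2

/-- The hyperbolic area density with respect to the Euclidean area of `f₀`. -/
def hjac (f₀ f : N → E3) (x : N) : ℝ := jac f₀ f x / f x 2 ^ 2

omit [IsManifold (𝓡 2) ∞ N] in
theorem norm_normalAt {f : N → E3} (hf : IsSurface f) (x : N) : ‖normalAt f x‖ = 1 :=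
  norm_unitVec (hf.area x)

omit [IsManifold (𝓡 2) ∞ N] in
theorem HasCurvatureVector.eq_smul {f v : N → E3} (hf : IsSurface f)
    (hv : HasCurvatureVector f v) (x : N) : v x = ⟪v x, normalAt f x⟫ • normalAt f x := by
  have h := hv.chart x (ch x x) (mem_extChartAt_target x)
  rw [extChartAt_to_inv] at h
  have hn : nrm (inChart f x) (ch x x) = normalAt f x := rfl
  rw [hn] at h
  conv_rhs => rw [h, inner_smul_left, real_inner_self_eq_norm_sq, norm_normalAt hf]
  rw [h]; simp

omit [IsManifold (𝓡 2) ∞ N] in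
theorem HasCurvatureVector.norm_sq {f v : N → E3} (hf : IsSurface f)
    (hv : HasCurvatureVector f v) (x : N) : ‖v x‖ ^ 2 / f x 2 ^ 2 = kap f v x ^ 2 := by
  conv_lhs => rw [hv.eq_smul hf x, norm_smul, norm_normalAt hf, mul_one, Real.norm_eq_abs, sq_abs]
  rw [kap, div_pow]

/-- The position Laplacian of a surface in terms of its hyperbolic mean curvature vector. -/
def posLapl (f v : N → E3) (x : N) : E3 :=
  (2 / f x 2 ^ 2) • (v x - (f x 2 * normalAt f x 2) • normalAt f x)

theorem posLapl_chart {f v : N → E3} (hf : IsSurface f) (hv : HasCurvatureVector f v) {c : N}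
    {u : E2} (hu : u ∈ (ch c).target) :
    posLapl f v ((ch c).symm u) = lapl (inChart f c) u • nrm (inChart f c) u := by
  have hx : (f ((ch c).symm u) 2) ≠ 0 := (hf.pos _).ne'
  have h1 : (f ((ch c).symm u) 2 * normalAt f ((ch c).symm u) 2) • normalAt f ((ch c).symm u) =
      (inChart f c u 2 * nrm (inChart f c) u 2) • nrm (inChart f c) u := by
    rcases nrm_inChart hf hu with h | h
    · rw [h]; rfl
    · rw [h]; simp [inChart]
  rw [posLapl, h1, hv.chart c u hu, ← sub_smul, smul_smul]
  congr 1
  change 2 / f ((ch c).symm u) 2 ^ 2 * (f ((ch c).symm u) 2 ^ 2 / 2 * _ + _ - _) = _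
  field_simp
  simp [inChart]

theorem continuous_posLapl {f v : N → E3} (hf : IsSurface f) (hv : HasCurvatureVector f v) :
    Continuous (posLapl f v) := by
  refine continuous_of_charts fun c => ?_
  have hg : ContinuousOn (fun u => inChart f c u 2) (ch c).target :=
    (EuclideanSpace.proj (𝕜 := ℝ) (2 : Fin 3)).continuous.comp_continuousOn
      (contDiffOn_inChart hf.smooth c).continuousOn
  have hn : ContinuousOn (nrm (inChart f c)) (ch c).target := fun u hu =>
    (nrm_contDiffAt (contDiffAt_inChart hf.smooth hu)
      (hf.areaVec_ne hu)).continuousAt.continuousWithinAt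
  have hn2 : ContinuousOn (fun u => nrm (inChart f c) u 2) (ch c).target :=
    (EuclideanSpace.proj (𝕜 := ℝ) (2 : Fin 3)).continuous.comp_continuousOn hn
  have hv' : ContinuousOn (fun u => v ((ch c).symm u)) (ch c).target :=
    hv.cont.comp_continuousOn (continuousOn_extChartAt_symm c)
  have h1 : ContinuousOn (fun u => (2 / inChart f c u 2 ^ 2) • (v ((ch c).symm u) -
      (inChart f c u 2 * nrm (inChart f c) u 2) • nrm (inChart f c) u)) (ch c).target :=
    (continuousOn_const.div (hg.pow 2) fun u _ => pow_ne_zero 2 (inChart_pos hf c u).ne').smul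
      (hv'.sub ((hg.mul hn2).smul hn))
  refine h1.congr fun u hu => ?_
  simp only [posLapl]
  rcases nrm_inChart hf hu with h | h
  · rw [h]; rfl
  · rw [h]; simp [inChart]

theorem continuousAt_inner_normalAt_sq {f : N → E3} (hf : IsSurface f) {Y : N → E3} {x : N}
    (hY : ContinuousAt Y x) : ContinuousAt (fun y => ⟪Y y, normalAt f y⟫ ^ 2) x := by
  have h1 : ContinuousAt (nrm (inChart f x)) (ch x x) :=
    (nrm_contDiffAt (contDiffAt_inChart hf.smooth (mem_extChartAt_target x))
      (hf.areaVec_ne (mem_extChartAt_target x))).continuousAt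
  have h2 : ContinuousAt (fun y => nrm (inChart f x) (ch x y)) x :=
    ContinuousAt.comp (f := fun y => ch x y) h1 (continuousAt_extChartAt x)
  refine ((hY.inner (𝕜 := ℝ) h2).pow 2).congr ?_
  filter_upwards [extChartAt_source_mem_nhds (I := 𝓡 2) x] with y hy
  have h3 := nrm_inChart hf ((ch x).map_source hy)
  rw [(ch x).left_inv hy] at h3
  rcases h3 with h | h
  · change ⟪Y y, nrm (inChart f x) (ch x y)⟫ ^ 2 = _
    rw [h]
  · change ⟪Y y, nrm (inChart f x) (ch x y)⟫ ^ 2 = _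
    rw [h, inner_neg_right, neg_sq]

omit [ChartedSpace E2 N] [IsManifold (𝓡 2) ∞ N] in
theorem continuous_coord {f : N → E3} (hf : Continuous f) (i : Fin 3) :
    Continuous fun x => f x i :=
  (EuclideanSpace.proj (𝕜 := ℝ) i).continuous.comp hf

theorem continuous_hjac {f₀ f : N → E3} (h₀ : IsSurface f₀) (hf : IsSurface f) :
    Continuous (hjac f₀ f) :=
  (continuous_jac h₀ hf).div ((continuous_coord hf.smooth.continuous 2).pow 2)
    fun x => pow_ne_zero 2 (hf.pos x).ne'

theorem hjac_pos {f₀ f : N → E3} (h₀ : IsSurface f₀) (hf : IsSurface f) (x : N) :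
    0 < hjac f₀ f x := div_pos (jac_pos h₀ hf x) (pow_pos (hf.pos x) 2)

/-- The deviation from the sphere through `p` and tangent to the surface at `f x`. -/
def deviation (f v : N → E3) (p : E3) (x : N) : ℝ :=
  kap f v x + 2 * f x 2 * ⟪f x - p, normalAt f x⟫ / ‖f x - p‖ ^ 2 - normalAt f x 2

omit [IsManifold (𝓡 2) ∞ N] in
theorem deviation_eq_inner (f v : N → E3) (p : E3) (x : N) :
    deviation f v p x = ⟪(1 / f x 2) • v x + (2 * f x 2 / ‖f x - p‖ ^ 2) • (f x - p) -
      EuclideanSpace.single (2 : Fin 3) (1 : ℝ), normalAt f x⟫ := by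
  have hen : ⟪(EuclideanSpace.single (2 : Fin 3) (1 : ℝ) : E3), normalAt f x⟫ =
      normalAt f x 2 := by simp [inner_coord]
  rw [inner_sub_left, inner_add_left, inner_smul_left, inner_smul_left, hen, deviation, kap]
  simp only [conj_trivial]
  ring

theorem continuousAt_deviation_sq {f v : N → E3} (hf : IsSurface f) (hv : HasCurvatureVector f v)
    {p : E3} {x : N} (hp : f x ≠ p) : ContinuousAt (fun y => deviation f v p y ^ 2) x := by
  simp_rw [deviation_eq_inner]
  have hfc := hf.smooth.continuous.continuousAt (x := x)
  have h2 := (continuous_coord hf.smooth.continuous 2).continuousAt (x := x)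
  have hs : ContinuousAt (fun y => f y - p) x := hfc.sub continuousAt_const
  refine continuousAt_inner_normalAt_sq hf ?_
  exact (((continuousAt_const.div h2 (hf.pos x).ne').smul hv.cont.continuousAt).add
    (((continuousAt_const.mul h2).div (hs.norm.pow 2)
      (pow_ne_zero 2 (norm_ne_zero_iff.2 (sub_ne_zero.2 hp)))).smul hs)).sub continuousAt_const

omit [IsManifold (𝓡 2) ∞ N] in
-- With b = 2 f₂⟪f-p, n⟫/|f-p|², the left side times f₂² is (b-n₂)² + 2κ(b-n₂) + 1. Completing the
-- square in κ gives (κ+b-n₂)² + 1 - κ².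
theorem willmore_pointwise {f v : N → E3} (hf : IsSurface f) (hv : HasCurvatureVector f v)
    {p : E3} {x : N} (hp : f x ≠ p) :
    planeDiv (fderiv ℝ (inversionField p) (f x)) (normalAt f x) +
      ⟪inversionField p (f x), posLapl f v x⟫ =
      (deviation f v p x ^ 2 + 1 - kap f v x ^ 2) / f x 2 ^ 2 := by
  have hn := norm_normalAt hf x
  have hx := hf.pos x
  have hr : ‖f x - p‖ ≠ 0 := norm_ne_zero_iff.2 (sub_ne_zero.2 hp)
  have hen : ⟪(EuclideanSpace.single (2 : Fin 3) (1 : ℝ) : E3), normalAt f x⟫ =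
      normalAt f x 2 := by simp [inner_coord]
  have hk : ⟪v x, normalAt f x⟫ = kap f v x * f x 2 := by rw [kap]; field_simp
  have hI : ⟪inversionField p (f x), normalAt f x⟫ =
      2 / ‖f x - p‖ ^ 2 * ⟪f x - p, normalAt f x⟫ - 1 / f x 2 * normalAt f x 2 := by
    rw [inversionField, inner_sub_left _ _ (normalAt f x), inner_smul_left, inner_smul_left, hen]
    simp only [conj_trivial]
  rw [planeDiv_inversionField hp hx hn, posLapl, inner_smul_right, hv.eq_smul hf x, ← sub_smul,
    inner_smul_right, hI, hk, deviation]
  field_simp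
  ring

variable [CompactSpace N] [T2Space N] [MeasurableSpace N] [BorelSpace N]

/-- The divergence theorem applied to `inversionField p`, legitimate because p is off the surface
and the field is smooth there. The right-hand side does not depend on p, which is what permits p to
approach the surface. -/
theorem integral_deviation_sq {f₀ f v : N → E3} (h₀ : IsSurface f₀) (hf : IsSurface f)
    {cs : ℕ → N} (hcs : ⋃ k, (ch (cs k)).source = univ) (hv : HasCurvatureVector f v)
    {p : E3} (hp : ∀ x, f x ≠ p) :
    Integrable (fun x => deviation f v p x ^ 2 * hjac f₀ f x) (areaMeas f₀ cs) ∧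
    ∫ x, deviation f v p x ^ 2 * hjac f₀ f x ∂(areaMeas f₀ cs) =
      ∫ x, ‖v x‖ ^ 2 / f x 2 ^ 2 * hjac f₀ f x ∂(areaMeas f₀ cs) -
        ∫ x, hjac f₀ f x ∂(areaMeas f₀ cs) := by
  have hΩ : IsOpen {y : E3 | y ≠ p ∧ 0 < y 2} :=
    isOpen_ne.inter (isOpen_lt continuous_const (EuclideanSpace.proj (𝕜 := ℝ) (2 : Fin 3)).continuous)
  have hX := contDiffOn_inversionField p
  have hfΩ : ∀ x, f x ∈ {y : E3 | y ≠ p ∧ 0 < y 2} := fun x => ⟨hp x, hf.pos x⟩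
  have key := integral_planeDiv_add_inner h₀ hf hcs (continuous_posLapl hf hv)
    (fun c u hu => posLapl_chart hf hv hu) hΩ hX hfΩ
  have := isFiniteMeasure_areaMeas h₀ hcs
  have hi1 : Integrable (fun x => hjac f₀ f x) (areaMeas f₀ cs) :=
    (continuous_hjac h₀ hf).integrable_of_hasCompactSupport (HasCompactSupport.of_compactSpace _)
  have hi2 : Integrable (fun x => ‖v x‖ ^ 2 / f x 2 ^ 2 * hjac f₀ f x) (areaMeas f₀ cs) :=
    (((hv.cont.norm.pow 2).div ((continuous_coord hf.smooth.continuous 2).pow 2)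
      fun x => pow_ne_zero 2 (hf.pos x).ne').mul
      (continuous_hjac h₀ hf)).integrable_of_hasCompactSupport (HasCompactSupport.of_compactSpace _)
  have heq : ∀ x, (planeDiv (fderiv ℝ (inversionField p) (f x)) (normalAt f x) +
      ⟪inversionField p (f x), posLapl f v x⟫) * jac f₀ f x =
      deviation f v p x ^ 2 * hjac f₀ f x -
        (‖v x‖ ^ 2 / f x 2 ^ 2 * hjac f₀ f x - hjac f₀ f x) := by
    intro x
    rw [willmore_pointwise hf hv (hp x), hv.norm_sq hf, hjac]
    have hx := hf.pos x
    field_simp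
    ring
  have hcont : Continuous fun x => deviation f v p x ^ 2 * hjac f₀ f x :=
    (continuous_iff_continuousAt.2 fun x => continuousAt_deviation_sq hf hv (hp x)).mul
      (continuous_hjac h₀ hf)
  have hi3 : Integrable (fun x => deviation f v p x ^ 2 * hjac f₀ f x) (areaMeas f₀ cs) :=
    hcont.integrable_of_hasCompactSupport (HasCompactSupport.of_compactSpace _)
  refine ⟨hi3, ?_⟩
  simp_rw [heq] at key
  have e1 := integral_sub hi3 (hi2.sub hi1)
  have e2 := integral_sub hi2 hi1
  simp only [Pi.sub_apply] at e1
  linarith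

end

/-! ### The Willmore inequality for embedded surfaces -/

/-- Superadditivity of liminf, for the application of Fatou's lemma on two disjoint regions under a
common bound. -/
theorem ennreal_liminf_add_le {a b : ℕ → ℝ≥0∞} {C : ℝ≥0∞} (h : ∀ k, a k + b k ≤ C) :
    liminf a atTop + liminf b atTop ≤ C := by
  rw [liminf_eq_iSup_iInf_of_nat, liminf_eq_iSup_iInf_of_nat, ENNReal.iSup_add_iSup_of_monotone]
  · refine iSup_le fun n => (add_le_add (iInf₂_le n le_rfl) (iInf₂_le n le_rfl)).trans (h n)
  · exact fun m n hmn => biInf_mono fun i hi => hmn.trans hi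
  · exact fun m n hmn => biInf_mono fun i hi => hmn.trans hi

/-- The integrand is the area density of the unit sphere in stereographic projection. In polar
coordinates the radial integrand has primitive -2/(1+r²). -/
theorem lintegral_stereographic :
    ∫⁻ z : E2, ENNReal.ofReal (4 / (1 + ‖z‖ ^ 2) ^ 2) = ENNReal.ofReal (4 * Real.pi) := by
  have hd : ∀ x ∈ Ici (0 : ℝ), HasDerivAt (fun y : ℝ => -(2 / (1 + y ^ 2)))
      (x ^ (Module.finrank ℝ E2 - 1) • (4 / (1 + x ^ 2) ^ 2)) x := by
    intro x _
    have h0 : (1 + x ^ 2) ≠ 0 := by positivity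
    have h1 : HasDerivAt (fun y : ℝ => 1 + y ^ 2) (2 * x) x := by
      simpa using (hasDerivAt_pow 2 x).const_add 1
    have h2 := ((hasDerivAt_const x (2 : ℝ)).div h1 h0).neg
    refine h2.congr_deriv ?_
    rw [finrank_euclideanSpace_fin, smul_eq_mul]
    field_simp
    ring
  have hpos : ∀ x ∈ Ioi (0 : ℝ), 0 ≤ x ^ (Module.finrank ℝ E2 - 1) • (4 / (1 + x ^ 2) ^ 2) := by
    intro x hx
    have hx' : (0 : ℝ) < x := hx
    rw [smul_eq_mul]; positivity
  have hlim : Tendsto (fun y : ℝ => -(2 / (1 + y ^ 2))) atTop (𝓝 0) := by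
    rw [← neg_zero]
    refine Tendsto.neg (Tendsto.const_div_atTop ?_ _)
    exact tendsto_atTop_add_const_left _ _ (tendsto_pow_atTop two_ne_zero)
  have hI := integral_Ioi_of_hasDerivAt_of_nonneg' hd hpos hlim
  have hin := integrableOn_Ioi_deriv_of_nonneg' hd hpos hlim
  have hint : Integrable (fun z : E2 => (fun y : ℝ => 4 / (1 + y ^ 2) ^ 2) ‖z‖) volume :=
    (integrable_fun_norm_addHaar volume).2 hin
  have h3 := integral_fun_norm_addHaar (E := E2) volume (fun y : ℝ => 4 / (1 + y ^ 2) ^ 2)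
  rw [hI, Measure.real, EuclideanSpace.volume_ball_fin_two, finrank_euclideanSpace_fin] at h3
  rw [← ofReal_integral_eq_lintegral_ofReal hint (ae_of_all _ fun z => by positivity), h3]
  congr 1
  simp [ENNReal.toReal_ofReal Real.pi_pos.le]
  ring

/-- A linear immersion of the plane factors through an isometric immersion. -/
theorem exists_comp_isometry (L : E2 →L[ℝ] E3) (hL : areaVec L ≠ 0) :
    ∃ M : E2 →L[ℝ] E2, (∀ w, ‖M w‖ = ‖L w‖) ∧ |M.det| = ‖areaVec L‖ := by
  have hinj : Function.Injective L := by
    rw [injective_iff_map_eq_zero]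
    intro w hw
    by_contra hne
    apply hL
    have hsum : w 0 • L (ee 0) + w 1 • L (ee 1) = 0 := by
      rw [← hw]; conv_rhs => rw [eq_sum_ee w]
      simp
    have h0 : cross (w 0 • L (ee 0) + w 1 • L (ee 1)) (L (ee 1)) = w 0 • areaVec L := by
      simp [areaVec, cross_self]
    have h1 : cross (L (ee 0)) (w 0 • L (ee 0) + w 1 • L (ee 1)) = w 1 • areaVec L := by
      simp [areaVec, cross_self]
    rw [hsum] at h0 h1
    simp only [map_zero, zero_apply] at h0 h1
    by_contra hA
    have a0 := (smul_eq_zero.1 h0.symm).resolve_right hA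
    have a1 := (smul_eq_zero.1 h1.symm).resolve_right hA
    exact hne (by rw [eq_sum_ee w, a0, a1]; simp)
  have hfr : Module.finrank ℝ (LinearMap.range (L : E2 →ₗ[ℝ] E3)) = 2 := by
    rw [LinearMap.finrank_range_of_inj hinj, finrank_euclideanSpace_fin]
  let b := (stdOrthonormalBasis ℝ (LinearMap.range (L : E2 →ₗ[ℝ] E3))).reindex (finCongr hfr)
  let ι : E2 →L[ℝ] E3 := (Submodule.subtypeL (LinearMap.range (L : E2 →ₗ[ℝ] E3))).comp
    (b.repr.symm.toContinuousLinearEquiv : E2 →L[ℝ] _)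
  let M : E2 →L[ℝ] E2 := (b.repr.toContinuousLinearEquiv : _ →L[ℝ] E2).comp
    (L.codRestrict (LinearMap.range (L : E2 →ₗ[ℝ] E3)) fun x => ⟨x, rfl⟩)
  have hι : ∀ x y, ⟪ι x, ι y⟫ = ⟪x, y⟫ := by
    intro x y
    change ⟪((b.repr.symm x : _) : E3), (b.repr.symm y : _)⟫ = _
    rw [← Submodule.coe_inner, LinearIsometryEquiv.inner_map_map]
  have hLM : L = ι.comp M := by
    ext1 x
    change L x = ((b.repr.symm (b.repr _) : _) : E3)
    rw [LinearIsometryEquiv.symm_apply_apply]; rfl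
  refine ⟨M, fun w => ?_, ?_⟩
  · change ‖b.repr _‖ = _
    rw [LinearIsometryEquiv.norm_map]; rfl
  · have h1 : ‖areaVec ι‖ = 1 := by
      have : ‖areaVec ι‖ ^ 2 = 1 := by
        rw [areaVec, norm_cross_sq, hι, hι, hι]
        simp [ee, EuclideanSpace.inner_single_left]
      nlinarith [norm_nonneg (areaVec ι)]
    rw [hLM, areaVec_comp, norm_smul, h1, mul_one, Real.norm_eq_abs]

theorem lintegral_stereographic_comp (L : E2 →L[ℝ] E3) (hL : areaVec L ≠ 0) :
    ∫⁻ w : E2, ENNReal.ofReal (4 * ‖areaVec L‖ / (1 + ‖L w‖ ^ 2) ^ 2) =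
      ENNReal.ofReal (4 * Real.pi) := by
  obtain ⟨M, hM, hdet⟩ := exists_comp_isometry L hL
  have hdet0 : M.det ≠ 0 := by rw [← abs_pos, hdet]; exact norm_pos_iff.2 hL
  have hinj : Function.Injective M := by
    have := (LinearMap.isUnit_iff_isUnit_det (M : E2 →ₗ[ℝ] E2)).2 (isUnit_iff_ne_zero.2 hdet0)
    exact ((Module.End.isUnit_iff _).1 this).1
  have hsurj : Function.Surjective M := (LinearMap.injective_iff_surjective (f := (M : E2 →ₗ[ℝ] E2))).1 hinj
  have h1 := lintegral_image_eq_lintegral_abs_det_fderiv_mul volume (s := univ) (f := M)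
    (f' := fun _ => M) MeasurableSet.univ (fun x _ => M.hasFDerivAt.hasFDerivWithinAt)
    hinj.injOn (fun z => ENNReal.ofReal (4 / (1 + ‖z‖ ^ 2) ^ 2))
  rw [image_univ, hsurj.range_eq, setLIntegral_univ, setLIntegral_univ,
    lintegral_stereographic] at h1
  rw [h1]
  refine lintegral_congr fun w => ?_
  rw [hM, hdet, ← ENNReal.ofReal_mul (norm_nonneg _)]
  congr 1; ring

/-- A rescaling of the integral over a ball of the plane. -/
theorem setLIntegral_ball_rescale (u₀ : E2) (δ : ℝ) {ε : ℝ} (hε : 0 < ε) (g : E2 → ℝ≥0∞) :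
    ∫⁻ u in Metric.ball u₀ δ, g u = ∫⁻ w in Metric.ball 0 (δ / ε),
      ENNReal.ofReal (ε ^ 2) * g (u₀ + ε • w) := by
  have him : (fun w : E2 => u₀ + ε • w) '' Metric.ball 0 (δ / ε) = Metric.ball u₀ δ := by
    ext u
    simp only [mem_image, Metric.mem_ball, dist_eq_norm, sub_zero]
    constructor
    · rintro ⟨w, hw, rfl⟩
      rw [add_sub_cancel_left, norm_smul, Real.norm_of_nonneg hε.le]
      rwa [lt_div_iff₀ hε, mul_comm] at hw
    · intro h
      refine ⟨ε⁻¹ • (u - u₀), ?_, ?_⟩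
      · rw [norm_smul, norm_inv, Real.norm_of_nonneg hε.le, inv_mul_eq_div]
        exact div_lt_div_of_pos_right h hε
      · rw [smul_inv_smul₀ hε.ne']; abel
  have hder : ∀ w ∈ Metric.ball (0 : E2) (δ / ε), HasFDerivWithinAt (fun w : E2 => u₀ + ε • w)
      (ε • ContinuousLinearMap.id ℝ E2) (Metric.ball 0 (δ / ε)) w := fun w _ =>
    (((hasFDerivAt_id w).const_smul ε).const_add u₀).hasFDerivWithinAt
  have hinj : InjOn (fun w : E2 => u₀ + ε • w) (Metric.ball 0 (δ / ε)) := by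
    intro w _ w' _ h
    exact smul_right_injective E2 hε.ne' (add_left_cancel h)
  rw [← him, lintegral_image_eq_lintegral_abs_det_fderiv_mul volume measurableSet_ball hder hinj]
  have hdet : (ε • ContinuousLinearMap.id ℝ E2).det = ε ^ 2 := by
    rw [ContinuousLinearMap.det, ContinuousLinearMap.toLinearMap_smul, LinearMap.det_smul,
      finrank_euclideanSpace_fin, ContinuousLinearMap.coe_id, LinearMap.det_id, mul_one]
  simp_rw [hdet, abs_of_nonneg (sq_nonneg ε)]

/-- Near a point of an immersion, the curve along the normal leaves the surface. -/
theorem eventually_normal_notMem {φ : E2 → E3} {u₀ : E2} (hφ : ContDiffAt ℝ ∞ φ u₀)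
    (hA : areaVec (fderiv ℝ φ u₀) ≠ 0) :
    ∀ᶠ u in 𝓝 u₀, ∀ ε : ℝ, 0 < ε → φ u ≠ φ u₀ + ε • nrm φ u₀ := by
  set L := fderiv ℝ φ u₀ with hL
  obtain ⟨M, hM, hdet⟩ := exists_comp_isometry L hA
  have hker : (L : E2 →ₗ[ℝ] E3).ker = ⊥ := by
    have hd : M.det ≠ 0 := by rw [← abs_pos, hdet]; exact norm_pos_iff.2 hA
    have hu := (LinearMap.isUnit_iff_isUnit_det (M : E2 →ₗ[ℝ] E2)).2 (isUnit_iff_ne_zero.2 hd)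
    have hinj : Function.Injective M := ((Module.End.isUnit_iff _).1 hu).1
    rw [LinearMap.ker_eq_bot']
    intro w hw
    apply hinj
    rw [map_zero, ← norm_eq_zero, hM]
    exact norm_eq_zero.2 hw
  obtain ⟨K, hK, hanti⟩ := LinearMap.exists_antilipschitzWith (L : E2 →ₗ[ℝ] E3) hker
  have hK' : (0 : ℝ) < K := hK
  have hlow : ∀ w, ‖w‖ ≤ K * ‖L w‖ := by
    intro w
    have := hanti.le_mul_dist w 0
    simpa [dist_eq_norm] using this
  have hd := (hφ.differentiableAt (by simp)).hasFDerivAt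
  have hlit := hd.isLittleO.def (c := 1 / (4 * K)) (by positivity)
  filter_upwards [hlit] with u hu ε hε heq
  have hn : ‖nrm φ u₀‖ = 1 := norm_unitVec hA
  set w := u - u₀
  have hdiff : φ u - φ u₀ = ε • nrm φ u₀ := by rw [heq]; abel
  rw [hdiff] at hu
  -- Pairing the first-order remainder with the normal isolates `ε`, because the linear part is
  -- tangential. The constant 1/(4K) makes the resulting bounds force both `w` and `ε` to vanish.
  have h1 : |ε| ≤ 1 / (4 * K) * ‖w‖ := by
    have h2 : ⟪ε • nrm φ u₀ - L w, nrm φ u₀⟫ = ε := by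
      have : ⟪L w, nrm φ u₀⟫ = 0 := inner_unitVec L w
      rw [inner_sub_left, this, inner_smul_left, real_inner_self_eq_norm_sq, hn]; simp
    calc |ε| = |⟪ε • nrm φ u₀ - L w, nrm φ u₀⟫| := by rw [h2]
      _ ≤ ‖ε • nrm φ u₀ - L w‖ * ‖nrm φ u₀‖ := abs_real_inner_le_norm _ _
      _ ≤ _ := by rw [hn, mul_one]; exact hu
  have h3 : ‖L w‖ ≤ |ε| + 1 / (4 * K) * ‖w‖ := by
    have : L w = ε • nrm φ u₀ - (ε • nrm φ u₀ - L w) := by abel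
    calc ‖L w‖ = ‖ε • nrm φ u₀ - (ε • nrm φ u₀ - L w)‖ := by rw [← this]
      _ ≤ ‖ε • nrm φ u₀‖ + ‖ε • nrm φ u₀ - L w‖ := norm_sub_le _ _
      _ ≤ _ := by rw [norm_smul, hn, mul_one, Real.norm_eq_abs]; gcongr
  have h4 := hlow w
  have h5 : K * ‖L w‖ ≤ 1 / 2 * ‖w‖ := by
    calc K * ‖L w‖ ≤ K * (1 / (4 * K) * ‖w‖ + 1 / (4 * K) * ‖w‖) := by gcongr; linarith
      _ = 1 / 2 * ‖w‖ := by field_simp; ring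
  have h6 : ‖w‖ = 0 := by linarith [norm_nonneg w]
  rw [h6, mul_zero] at h1
  exact absurd (abs_nonpos_iff.1 h1) hε.ne'

/-- The blow-up limit of the deviation at a point of the surface. -/
theorem tendsto_blowup {φ V : E2 → E3} {u₀ : E2} (hφ : ContDiffAt ℝ ∞ φ u₀)
    (hA : areaVec (fderiv ℝ φ u₀) ≠ 0) (hV : ContinuousAt V u₀) (hpos : φ u₀ 2 ≠ 0) (w : E2)
    {e : ℕ → ℝ} (he : Tendsto e atTop (𝓝 0)) (he0 : ∀ k, 0 < e k) :
    Tendsto (fun k => e k ^ 2 * (⟪(1 / φ (u₀ + e k • w) 2) • V (u₀ + e k • w) +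
        (2 * φ (u₀ + e k • w) 2 / ‖φ (u₀ + e k • w) - (φ u₀ + e k • nrm φ u₀)‖ ^ 2) •
          (φ (u₀ + e k • w) - (φ u₀ + e k • nrm φ u₀)) -
        EuclideanSpace.single (2 : Fin 3) (1 : ℝ), nrm φ (u₀ + e k • w)⟫ ^ 2 /
        φ (u₀ + e k • w) 2 ^ 2 * ‖areaVec (fderiv ℝ φ (u₀ + e k • w))‖)) atTop
      (𝓝 (4 * ‖areaVec (fderiv ℝ φ u₀)‖ / (1 + ‖fderiv ℝ φ u₀ w‖ ^ 2) ^ 2)) := by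
  set L := fderiv ℝ φ u₀ with hL
  set n := nrm φ u₀ with hn
  have hn1 : ‖n‖ = 1 := norm_unitVec hA
  have hnn : ⟪n, n⟫ = (1 : ℝ) := by rw [real_inner_self_eq_norm_sq, hn1]; norm_num
  have hLn : ⟪L w, n⟫ = 0 := inner_unitVec L w
  have hu : Tendsto (fun k => u₀ + e k • w) atTop (𝓝 u₀) := by
    simpa using (he.smul_const w).const_add u₀
  have t1 : Tendsto (fun k => φ (u₀ + e k • w)) atTop (𝓝 (φ u₀)) := hφ.continuousAt.tendsto.comp hu
  have t2 : Tendsto (fun k => φ (u₀ + e k • w) 2) atTop (𝓝 (φ u₀ 2)) :=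
    ((EuclideanSpace.proj (𝕜 := ℝ) (2 : Fin 3)).continuous.tendsto _).comp t1
  have t3 : Tendsto (fun k => nrm φ (u₀ + e k • w)) atTop (𝓝 n) :=
    (nrm_contDiffAt hφ hA).continuousAt.tendsto.comp hu
  have t4 : Tendsto (fun k => V (u₀ + e k • w)) atTop (𝓝 (V u₀)) := hV.tendsto.comp hu
  have t5 : Tendsto (fun k => ‖areaVec (fderiv ℝ φ (u₀ + e k • w))‖) atTop (𝓝 ‖areaVec L‖) :=
    ((continuous_areaVec.norm.continuousAt (x := L)).tendsto).comp
      ((hφ.fderiv_right (m := ∞) (by simp)).continuousAt.tendsto.comp hu)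
  have t6 : Tendsto (fun k => (e k)⁻¹ • (φ (u₀ + e k • w) - φ u₀)) atTop (𝓝 (L w)) := by
    have := (hφ.differentiableAt (by simp)).hasFDerivAt.lim w (c := fun k => (e k)⁻¹) (l := atTop) (by
      have h1 : Tendsto (fun k => (e k)⁻¹) atTop atTop :=
        (tendsto_nhdsWithin_iff.2 ⟨he, Eventually.of_forall he0⟩ :
          Tendsto e atTop (𝓝[>] 0)).inv_tendsto_nhdsGT_zero
      exact tendsto_norm_atTop_atTop.comp h1)
    simpa using this
  have t7 : Tendsto (fun k => (e k)⁻¹ • (φ (u₀ + e k • w) - φ u₀) - n) atTop (𝓝 (L w - n)) :=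
    t6.sub_const n
  have hz : ‖L w - n‖ ^ 2 = 1 + ‖L w‖ ^ 2 := by
    rw [norm_sub_sq_real, hLn, hn1]; ring
  have hz0 : ‖L w - n‖ ^ 2 ≠ 0 := by rw [hz]; positivity
  -- This is the deviation multiplied by `e k`. The curvature and vertical terms carry the factor `e
  -- k` and disappear; the inversion term is scale invariant and survives.
  have t8 : Tendsto (fun k => ⟪e k • ((1 / φ (u₀ + e k • w) 2) • V (u₀ + e k • w) -
        EuclideanSpace.single (2 : Fin 3) (1 : ℝ)) +
        (2 * φ (u₀ + e k • w) 2 / ‖(e k)⁻¹ • (φ (u₀ + e k • w) - φ u₀) - n‖ ^ 2) •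
          ((e k)⁻¹ • (φ (u₀ + e k • w) - φ u₀) - n), nrm φ (u₀ + e k • w)⟫) atTop
      (𝓝 ⟪(0 : ℝ) • ((1 / φ u₀ 2) • V u₀ - EuclideanSpace.single (2 : Fin 3) (1 : ℝ)) +
        (2 * φ u₀ 2 / ‖L w - n‖ ^ 2) • (L w - n), n⟫) :=
    ((he.smul (((tendsto_const_nhds.div t2 hpos).smul t4).sub_const _)).add
      (((t2.const_mul 2).div (t7.norm.pow 2) hz0).smul t7)).inner t3
  have t9 := ((t8.pow 2).div (t2.pow 2) (pow_ne_zero 2 hpos)).mul t5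
  have hlim : ⟪(0 : ℝ) • ((1 / φ u₀ 2) • V u₀ - EuclideanSpace.single (2 : Fin 3) (1 : ℝ)) +
        (2 * φ u₀ 2 / ‖L w - n‖ ^ 2) • (L w - n), n⟫ ^ 2 / φ u₀ 2 ^ 2 * ‖areaVec L‖ =
      4 * ‖areaVec L‖ / (1 + ‖L w‖ ^ 2) ^ 2 := by
    rw [zero_smul, zero_add, inner_smul_left, inner_sub_left, hLn, hnn, hz]
    have : (1 + ‖L w‖ ^ 2) ≠ 0 := by positivity
    simp only [conj_trivial]
    field_simp
    norm_num
  rw [hlim] at t9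
  refine t9.congr fun k => ?_
  simp only [Pi.div_apply]
  have hk := (he0 k).ne'
  set a := φ (u₀ + e k • w) - φ u₀ with ha
  have ha' : φ (u₀ + e k • w) - (φ u₀ + e k • n) = e k • ((e k)⁻¹ • a - n) := by
    rw [smul_sub, smul_inv_smul₀ hk, ha]; abel
  rw [ha', norm_smul, Real.norm_of_nonneg (he0 k).le]
  generalize (e k)⁻¹ • a - n = b
  have hb : (2 * φ (u₀ + e k • w) 2 / (e k * ‖b‖) ^ 2) • (e k • b) =
      (e k)⁻¹ • ((2 * φ (u₀ + e k • w) 2 / ‖b‖ ^ 2) • b) := by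
    rw [smul_smul, smul_smul]; congr 1
    by_cases hb0 : ‖b‖ = 0
    · simp [hb0]
    · field_simp
  have hs : (1 / φ (u₀ + e k • w) 2) • V (u₀ + e k • w) +
      (2 * φ (u₀ + e k • w) 2 / (e k * ‖b‖) ^ 2) • (e k • b) -
        EuclideanSpace.single (2 : Fin 3) (1 : ℝ) = (e k)⁻¹ •
        (e k • ((1 / φ (u₀ + e k • w) 2) • V (u₀ + e k • w) -
        EuclideanSpace.single (2 : Fin 3) (1 : ℝ)) +
        (2 * φ (u₀ + e k • w) 2 / ‖b‖ ^ 2) • b) := by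
    rw [hb, smul_add, inv_smul_smul₀ hk]; abel
  rw [hs, inner_smul_left]
  simp only [conj_trivial]
  field_simp

/-! ### Blow-up at a point of a closed embedded surface -/

section

variable {N : Type*} [TopologicalSpace N] [ChartedSpace E2 N] [IsManifold (𝓡 2) ∞ N]
variable [CompactSpace N] [T2Space N] [MeasurableSpace N] [BorelSpace N]

omit [T2Space N] [MeasurableSpace N] [BorelSpace N] in
-- Near `a` the normal segment leaves the immersed sheet; the rest of the surface is compact and, by
-- injectivity, does not contain `f a`.
theorem eventually_forall_ne {f : N → E3} (hf : IsSurface f) (hinj : Function.Injective f) (a : N) :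
    ∀ᶠ ε in 𝓝[>] (0 : ℝ), ∀ x, f x ≠ f a + ε • normalAt f a := by
  have hφ : ContDiffAt ℝ ∞ (inChart f a) (ch a a) :=
    contDiffAt_inChart hf.smooth (mem_extChartAt_target a)
  have hnear := eventually_normal_notMem hφ (hf.area a)
  have hn2 : ∀ᶠ x in 𝓝 a, ∀ ε : ℝ, 0 < ε → f x ≠ f a + ε • normalAt f a := by
    filter_upwards [(continuousAt_extChartAt (I := 𝓡 2) a).eventually hnear,
      extChartAt_source_mem_nhds (I := 𝓡 2) a] with x hx hs ε hε
    have := hx ε hε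
    rw [inChart_ch f hs, inChart_ch f (mem_extChartAt_source a)] at this
    exact this
  obtain ⟨O, hO, hOo, haO⟩ := eventually_nhds_iff.1 hn2
  have hK : IsCompact (f '' Oᶜ) := hOo.isClosed_compl.isCompact.image hf.smooth.continuous
  have hnot : f a ∈ (f '' Oᶜ)ᶜ := by
    rintro ⟨x, hx, he⟩
    exact hx (hinj he ▸ haO)
  have hcont : Tendsto (fun ε : ℝ => f a + ε • normalAt f a) (𝓝[>] 0) (𝓝 (f a)) := by
    have : Continuous fun ε : ℝ => f a + ε • normalAt f a := by fun_prop
    simpa using (this.tendsto 0).mono_left nhdsWithin_le_nhds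
  filter_upwards [hcont.eventually (hK.isClosed.isOpen_compl.mem_nhds hnot),
    self_mem_nhdsWithin] with ε h1 h2 x hx
  by_cases hxO : x ∈ O
  · exact hO x hxO ε h2 hx
  · exact h1 ⟨x, hxO, hx⟩

end

section

variable {N : Type*} [TopologicalSpace N] [ChartedSpace E2 N] [IsManifold (𝓡 2) ∞ N]
variable [CompactSpace N] [T2Space N] [MeasurableSpace N] [BorelSpace N]

omit [CompactSpace N] [T2Space N] [MeasurableSpace N] [BorelSpace N] in
theorem deviation_sq_chart {f v : N → E3} (hf : IsSurface f) (p : E3) {c : N} {u : E2}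
    (hu : u ∈ (ch c).target) : deviation f v p ((ch c).symm u) ^ 2 =
      ⟪(1 / inChart f c u 2) • v ((ch c).symm u) +
        (2 * inChart f c u 2 / ‖inChart f c u - p‖ ^ 2) • (inChart f c u - p) -
        EuclideanSpace.single (2 : Fin 3) (1 : ℝ), nrm (inChart f c) u⟫ ^ 2 := by
  rw [deviation_eq_inner]
  rcases nrm_inChart hf hu with h | h
  · rw [h]; rfl
  · rw [h, inner_neg_right, neg_sq]; rfl

/-- The poles p = f(a) + e·n tend to f(a) from off the surface, and the deviation integral has the
same value for all of them. A chart ball around `a`, rescaled by e, captures 4π in the limit. The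
complement retains the integral with the pole f(a), which is the term that yields rigidity. -/
theorem lintegral_deviation_sq_le {f₀ f v : N → E3} (h₀ : IsSurface f₀) (hf : IsSurface f)
    (hinj : Function.Injective f)
    {cs : ℕ → N} (hcs : ⋃ k, (ch (cs k)).source = univ) (hv : HasCurvatureVector f v) (a : N)
    {δ : ℝ} (hδ : 0 < δ) (hball : Metric.ball (ch a a) δ ⊆ (ch a).target) :
    ENNReal.ofReal (4 * Real.pi) +
      ∫⁻ x in ((ch a).source ∩ ch a ⁻¹' Metric.ball (ch a a) δ)ᶜ,
        ENNReal.ofReal (deviation f v (f a) x ^ 2 * hjac f₀ f x) ∂(areaMeas f₀ cs) ≤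
    ENNReal.ofReal (∫ x, ‖v x‖ ^ 2 / f x 2 ^ 2 * hjac f₀ f x ∂(areaMeas f₀ cs) -
        ∫ x, hjac f₀ f x ∂(areaMeas f₀ cs)) := by
  set E := (ch a).source ∩ ch a ⁻¹' Metric.ball (ch a a) δ with hE
  have hEo : IsOpen E := (continuousOn_extChartAt a).isOpen_inter_preimage
    (isOpen_extChartAt_source a) Metric.isOpen_ball
  have haE : a ∈ E := ⟨mem_extChartAt_source a, Metric.mem_ball_self hδ⟩
  have hpre : (ch a).target ∩ (ch a).symm ⁻¹' E = Metric.ball (ch a a) δ := by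
    ext u
    constructor
    · rintro ⟨hu, hu'⟩
      have := hu'.2
      rwa [mem_preimage, (ch a).right_inv hu] at this
    · intro hu
      refine ⟨hball hu, mem_source_symm (hball hu), ?_⟩
      rwa [mem_preimage, (ch a).right_inv (hball hu)]
  obtain ⟨η, hη, hηs⟩ := mem_nhdsGT_iff_exists_Ioo_subset.1 (eventually_forall_ne hf hinj a)
  have hη' : (0 : ℝ) < η := hη
  -- The shift by 2 keeps the scale strictly below `η` already for k = 0.
  set e : ℕ → ℝ := fun k => η / ((k : ℝ) + 2) with he
  have he0 : ∀ k, 0 < e k := fun k => by positivity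
  have heη : ∀ k, e k < η := fun k => by
    rw [he]; simp only
    rw [div_lt_iff₀ (by positivity)]
    nlinarith [Nat.cast_nonneg (α := ℝ) k]
  have het : Tendsto e atTop (𝓝 0) := by
    refine Tendsto.const_div_atTop ?_ _
    exact tendsto_atTop_add_const_right _ _ tendsto_natCast_atTop_atTop
  set p : ℕ → E3 := fun k => f a + e k • normalAt f a with hp
  have hpne : ∀ k x, f x ≠ p k := fun k => hηs ⟨he0 k, heη k⟩
  have hpt : Tendsto p atTop (𝓝 (f a)) := by
    simpa using (het.smul_const (normalAt f a)).const_add (f a)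
  set φ := inChart f a with hφ
  set u₀ := ch a a with hu₀
  have hφa : φ u₀ = f a := inChart_ch f (mem_extChartAt_source a)
  have hna : nrm φ u₀ = normalAt f a := rfl
  set G : ℕ → E2 → ℝ≥0∞ := fun k u => ENNReal.ofReal
    (deviation f v (p k) ((ch a).symm u) ^ 2 / f ((ch a).symm u) 2 ^ 2) *
      ENNReal.ofReal ‖areaVec (fderiv ℝ φ u)‖ with hG
  set g : ℕ → E2 → ℝ≥0∞ := fun k => (Metric.ball (0 : E2) (δ / e k)).indicator
    fun w => ENNReal.ofReal (e k ^ 2) * G k (u₀ + e k • w) with hg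
  have hdc : ∀ k, Continuous fun x => deviation f v (p k) x ^ 2 := fun k =>
    continuous_iff_continuousAt.2 fun x => continuousAt_deviation_sq hf hv (hpne k x)
  have hdc2 : ∀ k, Continuous fun x => deviation f v (p k) x ^ 2 / f x 2 ^ 2 := fun k =>
    (hdc k).div ((continuous_coord hf.smooth.continuous 2).pow 2)
      fun x => pow_ne_zero 2 (hf.pos x).ne'
  have hbound : ∀ k, (∫⁻ w, g k w) + ∫⁻ x in Eᶜ,
      ENNReal.ofReal (deviation f v (p k) x ^ 2 * hjac f₀ f x) ∂(areaMeas f₀ cs) ≤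
      ENNReal.ofReal (∫ x, ‖v x‖ ^ 2 / f x 2 ^ 2 * hjac f₀ f x ∂(areaMeas f₀ cs) -
        ∫ x, hjac f₀ f x ∂(areaMeas f₀ cs)) := by
    intro k
    obtain ⟨hi, hI⟩ := integral_deviation_sq h₀ hf hcs hv (hpne k)
    have h1 := lintegral_areaMeas h₀ hf hcs hEo.measurableSet inter_subset_left
      (hdc2 k).measurable.ennreal_ofReal
    rw [hpre, setLIntegral_ball_rescale _ _ (he0 k)] at h1
    have h2 : ∫⁻ w, g k w = ∫⁻ x in E, ENNReal.ofReal (deviation f v (p k) x ^ 2 * hjac f₀ f x)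
        ∂(areaMeas f₀ cs) := by
      rw [hg]
      simp only
      rw [lintegral_indicator measurableSet_ball]
      refine h1.symm.trans (lintegral_congr fun x => ?_)
      rw [← ENNReal.ofReal_mul (by positivity), hjac]
      congr 1; ring
    rw [h2, lintegral_add_compl _ hEo.measurableSet, ← hI,
      ofReal_integral_eq_lintegral_ofReal hi
        (ae_of_all _ fun x => mul_nonneg (sq_nonneg _) (hjac_pos h₀ hf x).le)]
  have hsum := ennreal_liminf_add_le hbound
  -- Fatou's lemma in both regions: on the rescaled ball the integrands converge pointwise by
  -- `tendsto_blowup`, on the complement because the pole tends to `f a` and `f x ≠ f a`.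
  refine le_trans (add_le_add ?_ ?_) hsum
  · rw [← lintegral_stereographic_comp (fderiv ℝ φ u₀) (hf.area a)]
    have hgm : ∀ k, AEMeasurable (g k) volume := by
      intro k
      have hmem : ∀ w ∈ Metric.ball (0 : E2) (δ / e k), u₀ + e k • w ∈ Metric.ball u₀ δ := by
        intro w hw
        rw [mem_ball_zero_iff, lt_div_iff₀ (he0 k)] at hw
        rw [mem_ball_iff_norm, add_sub_cancel_left, norm_smul, Real.norm_of_nonneg (he0 k).le,
          mul_comm]
        exact hw
      rw [hg]
      refine (aemeasurable_indicator_iff measurableSet_ball).2 ?_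
      have haff : Continuous fun w : E2 => u₀ + e k • w := by fun_prop
      have hc1 : ContinuousOn (fun w : E2 => deviation f v (p k) ((ch a).symm (u₀ + e k • w)) ^ 2 /
          f ((ch a).symm (u₀ + e k • w)) 2 ^ 2) (Metric.ball (0 : E2) (δ / e k)) :=
        (hdc2 k).comp_continuousOn ((continuousOn_extChartAt_symm a).comp haff.continuousOn
          fun w hw => hball (hmem w hw))
      have hm1 := (hc1.aemeasurable measurableSet_ball (μ := volume)).ennreal_ofReal
      have hm2 : Measurable fun w : E2 =>
          ENNReal.ofReal ‖areaVec (fderiv ℝ φ (u₀ + e k • w))‖ :=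
        ((measurable_norm_areaVec φ).comp haff.measurable).ennreal_ofReal
      exact (hm1.mul hm2.aemeasurable).const_mul _
    refine le_trans (lintegral_mono fun w => ?_) (lintegral_liminf_le' hgm)
    refine le_of_eq (Tendsto.liminf_eq ?_).symm
    have hV : ContinuousAt (fun u => v ((ch a).symm u)) u₀ :=
      hv.cont.continuousAt.comp (continuousAt_extChartAt_symm a)
    have hb := tendsto_blowup (contDiffAt_inChart hf.smooth (mem_extChartAt_target a)) (hf.area a)
      hV (inChart_pos hf a _).ne' w het he0
    refine (ENNReal.tendsto_ofReal hb).congr' ?_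
    have hw : ∀ᶠ k in atTop, w ∈ Metric.ball (0 : E2) (δ / e k) := by
      have h1 : Tendsto (fun k => e k * ‖w‖) atTop (𝓝 0) := by simpa using het.mul_const ‖w‖
      filter_upwards [h1.eventually (gt_mem_nhds hδ)] with k hk
      rw [mem_ball_zero_iff, lt_div_iff₀ (he0 k), mul_comm]
      exact hk
    filter_upwards [hw] with k hk
    have hmem : u₀ + e k • w ∈ (ch a).target := by
      apply hball
      rw [mem_ball_zero_iff, lt_div_iff₀ (he0 k)] at hk
      rw [mem_ball_iff_norm, add_sub_cancel_left, norm_smul, Real.norm_of_nonneg (he0 k).le,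
        mul_comm]
      exact hk
    rw [hg]
    simp only
    rw [indicator_of_mem hk, hG]
    simp only
    rw [deviation_sq_chart hf _ hmem, ← ENNReal.ofReal_mul (by positivity),
      ← ENNReal.ofReal_mul (by positivity)]
    have hpk : p k = φ u₀ + e k • nrm φ u₀ := by rw [hφa, hna]
    rw [hpk]
    rfl
  · have hm : ∀ k, AEMeasurable (fun x => ENNReal.ofReal (deviation f v (p k) x ^ 2 * hjac f₀ f x))
        ((areaMeas f₀ cs).restrict Eᶜ) := fun k =>
      ((hdc k).mul (continuous_hjac h₀ hf)).measurable.ennreal_ofReal.aemeasurable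
    refine le_trans (setLIntegral_mono_ae' hEo.measurableSet.compl (ae_of_all _ fun x hx => ?_))
      (lintegral_liminf_le' hm)
    refine le_of_eq (Tendsto.liminf_eq ?_).symm
    refine ENNReal.tendsto_ofReal (Tendsto.mul_const _ (Tendsto.pow ?_ 2))
    have hne : f x ≠ f a := fun h => hx (hinj h ▸ haE)
    have hs : Tendsto (fun k => f x - p k) atTop (𝓝 (f x - f a)) := hpt.const_sub _
    exact ((((hs.inner tendsto_const_nhds).const_mul _).div (hs.norm.pow 2)
      (pow_ne_zero 2 (norm_ne_zero_iff.2 (sub_ne_zero.2 hne)))).const_add _).sub_const _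

theorem willmore_ge {f₀ f v : N → E3} (h₀ : IsSurface f₀) (hf : IsSurface f)
    (hinj : Function.Injective f)
    {cs : ℕ → N} (hcs : ⋃ k, (ch (cs k)).source = univ) (hv : HasCurvatureVector f v) [Nonempty N] :
    4 * Real.pi ≤ ∫ x, ‖v x‖ ^ 2 / f x 2 ^ 2 * hjac f₀ f x ∂(areaMeas f₀ cs) -
        ∫ x, hjac f₀ f x ∂(areaMeas f₀ cs) := by
  obtain ⟨a⟩ := ‹Nonempty N›
  obtain ⟨δ, hδ, hb⟩ := Metric.nhds_basis_ball.mem_iff.1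
    (extChartAt_target_mem_nhds (I := 𝓡 2) a)
  have := (self_le_add_right _ _).trans (lintegral_deviation_sq_le h₀ hf hinj hcs hv a hδ hb)
  exact (ENNReal.ofReal_le_ofReal_iff'.1 this).resolve_right (not_le.2 (by positivity))

/-- Equality leaves no room for the remaining integral, so it vanishes. A nonzero deviation at `b`
would be nonzero on an open set, which has positive measure. -/
theorem deviation_eq_zero {f₀ f v : N → E3} (h₀ : IsSurface f₀) (hf : IsSurface f)
    (hinj : Function.Injective f)
    {cs : ℕ → N} (hcs : ⋃ k, (ch (cs k)).source = univ) (hv : HasCurvatureVector f v)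
    (hW : ∫ x, ‖v x‖ ^ 2 / f x 2 ^ 2 * hjac f₀ f x ∂(areaMeas f₀ cs) -
        ∫ x, hjac f₀ f x ∂(areaMeas f₀ cs) ≤ 4 * Real.pi) {a b : N} (hab : b ≠ a) :
    deviation f v (f a) b = 0 := by
  by_contra hne
  have hcont := continuousAt_deviation_sq hf hv (p := f a) (x := b) fun h => hab (hinj h)
  have hpos : ∀ᶠ x in 𝓝 b, 0 < deviation f v (f a) x ^ 2 :=
    hcont.eventually (lt_mem_nhds (by positivity))
  -- The excised chart ball around `a` must miss a whole neighbourhood of `b`.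
  obtain ⟨A, B, hA, hB, haA, hbB, hAB⟩ := t2_separation hab.symm
  have hA' : (ch a).target ∩ (ch a).symm ⁻¹' A ∈ 𝓝 (ch a a) := by
    refine inter_mem (extChartAt_target_mem_nhds a) ?_
    refine (continuousAt_extChartAt_symm a).preimage_mem_nhds ?_
    rw [extChartAt_to_inv]; exact hA.mem_nhds haA
  obtain ⟨δ, hδ, hb⟩ := Metric.nhds_basis_ball.mem_iff.1 hA'
  have key := lintegral_deviation_sq_le h₀ hf hinj hcs hv a hδ (hb.trans inter_subset_left)
  have h0 : ∫⁻ x in ((ch a).source ∩ ch a ⁻¹' Metric.ball (ch a a) δ)ᶜ,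
        ENNReal.ofReal (deviation f v (f a) x ^ 2 * hjac f₀ f x) ∂(areaMeas f₀ cs) = 0 := by
    have := key.trans (ENNReal.ofReal_le_ofReal hW)
    by_contra hc
    exact absurd this (not_le.2 (ENNReal.lt_add_right ENNReal.ofReal_ne_top hc))
  obtain ⟨O, hO, hOo, hbO⟩ := eventually_nhds_iff.1 hpos
  have hsub : O ∩ B ⊆ ((ch a).source ∩ ch a ⁻¹' Metric.ball (ch a a) δ)ᶜ := by
    rintro x ⟨_, hxB⟩ ⟨hxs, hx⟩
    have := (hb hx).2
    rw [mem_preimage, (ch a).left_inv hxs] at this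
    exact disjoint_left.1 hAB this hxB
  have := isOpenPosMeasure_areaMeas h₀ hcs
  have hmeas : 0 < areaMeas f₀ cs (O ∩ B) := (hOo.inter hB).measure_pos _ ⟨b, hbO, hbB⟩
  have hOB : MeasurableSet (O ∩ B) := (hOo.inter hB).measurableSet
  have h1 := lintegral_mono_set (μ := areaMeas f₀ cs) (f := fun x =>
    ENNReal.ofReal (deviation f v (f a) x ^ 2 * hjac f₀ f x)) hsub
  rw [h0, nonpos_iff_eq_zero] at h1
  have hcO : ContinuousOn (fun x => deviation f v (f a) x ^ 2 * hjac f₀ f x) (O ∩ B) := by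
    intro x hx
    refine ContinuousAt.continuousWithinAt ?_
    refine (continuousAt_deviation_sq hf hv fun h => ?_).mul (continuous_hjac h₀ hf).continuousAt
    exact disjoint_left.1 hAB haA (hinj h ▸ hx.2)
  rw [lintegral_eq_zero_iff' (hcO.aemeasurable hOB).ennreal_ofReal] at h1
  have h2 : ∀ᵐ x ∂(areaMeas f₀ cs).restrict (O ∩ B), False := by
    filter_upwards [h1, ae_restrict_mem hOB] with x hx hxO
    exact absurd hx (ENNReal.ofReal_pos.2 (mul_pos (hO x hxO.1) (hjac_pos h₀ hf x))).ne'
  rw [ae_iff] at h2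
  simp only [not_false_eq_true, ofPred_true, Measure.restrict_apply_univ] at h2
  exact hmeas.ne' h2

end

/-! ### Geodesic spheres are Euclidean spheres -/

/-- The Euclidean centre of a geodesic sphere. -/
def euclCentre (q : E3) (r : ℝ) : E3 := q + (q 2 * (Real.cosh r - 1)) • EuclideanSpace.single 2 (1 : ℝ)

theorem euclCentre_two (q : E3) (r : ℝ) : euclCentre q r 2 = q 2 * Real.cosh r := by
  simp [euclCentre]; ring

theorem norm_sub_euclCentre_sq (q x : E3) (r : ℝ) :
    ‖x - euclCentre q r‖ ^ 2 = ‖x - q‖ ^ 2 - 2 * q 2 * x 2 * (Real.cosh r - 1) +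
      (q 2 * Real.sinh r) ^ 2 := by
  have hc := Real.cosh_sq r
  have h : x - euclCentre q r = (x - q) -
      (q 2 * (Real.cosh r - 1)) • EuclideanSpace.single 2 (1 : ℝ) := by
    rw [euclCentre]; abel
  rw [h, norm_sub_sq_real, inner_smul_right, norm_smul]
  simp only [EuclideanSpace.inner_single_right, PiLp.norm_single, PiLp.sub_apply]
  simp only [Real.norm_eq_abs, mul_pow, sq_abs, abs_one, one_mul, conj_trivial]
  linear_combination (q 2 ^ 2) * (Real.cosh_sq r)

theorem mem_H3_of_norm_sub {c x : E3} {R : ℝ} (hR : R < c 2) (h : ‖x - c‖ ≤ R) : x ∈ H3 := by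
  have h1 : |(x - c) 2| ≤ ‖x - c‖ := by
    have := PiLp.norm_apply_le (x - c) (2 : Fin 3)
    simpa using this
  rw [PiLp.sub_apply] at h1
  have h2 := (abs_le.1 (h1.trans h)).1
  change 0 < x 2
  linarith

/-- Both conditions reduce to |x-q|² = 2 q₂ x₂ (cosh r - 1), by cosh r - 1 = 2 sinh²(r/2). Points of
the Euclidean sphere lie in the half-space automatically since sinh r < cosh r. -/
theorem geodesicSphere_eq {q : E3} (hq : q ∈ H3) {r : ℝ} (hr : 0 < r) :
    geodesicSphere q r = Metric.sphere (euclCentre q r) (q 2 * Real.sinh r) := by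
  have hq2 : 0 < q 2 := hq
  have hsinh := Real.sinh_pos_iff.2 hr
  have hc2 : q 2 * Real.sinh r < euclCentre q r 2 := by
    rw [euclCentre_two]; exact mul_lt_mul_of_pos_left (Real.sinh_lt_cosh r) hq2
  have hcosh : Real.cosh r - 1 = 2 * Real.sinh (r / 2) ^ 2 := by
    have h1 := Real.cosh_two_mul (r / 2)
    have h2 := Real.cosh_sq (r / 2)
    rw [mul_div_cancel₀ r two_ne_zero] at h1
    rw [h1]; linarith
  ext x
  rw [mem_sphere_iff_norm, ← sq_eq_sq₀ (norm_nonneg _) (by positivity), norm_sub_euclCentre_sq]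
  have key : ∀ hx : 0 < x 2, hdist q x = r ↔ ‖x - q‖ ^ 2 = 2 * q 2 * x 2 * (Real.cosh r - 1) := by
    intro hx
    have hs : 0 < 2 * √(q 2 * x 2) := by positivity
    have hss : √(q 2 * x 2) ^ 2 = q 2 * x 2 := Real.sq_sqrt (by positivity)
    have hsh : 0 < Real.sinh (r / 2) := Real.sinh_pos_iff.2 (by positivity)
    rw [hdist, dist_comm, dist_eq_norm]
    constructor
    · intro h
      have h1 : Real.arsinh (‖x - q‖ / (2 * √(q 2 * x 2))) = r / 2 := by linarith
      have h2 : ‖x - q‖ / (2 * √(q 2 * x 2)) = Real.sinh (r / 2) := by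
        rw [← h1, Real.sinh_arsinh]
      rw [div_eq_iff hs.ne'] at h2
      rw [h2, hcosh, mul_pow, mul_pow, hss]; ring
    · intro h
      have h2 : ‖x - q‖ = Real.sinh (r / 2) * (2 * √(q 2 * x 2)) := by
        rw [← sq_eq_sq₀ (norm_nonneg _) (by positivity), h, hcosh, mul_pow, mul_pow, hss]; ring
      rw [h2, mul_div_cancel_right₀ _ hs.ne', Real.arsinh_sinh]; ring
  constructor
  · rintro ⟨hx, h⟩
    rw [(key hx).1 h]; ring
  · intro h
    have hx : x ∈ H3 := by
      refine mem_H3_of_norm_sub hc2 (le_of_eq ?_)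
      rw [← sq_eq_sq₀ (norm_nonneg _) (by positivity), norm_sub_euclCentre_sq, h]
    exact ⟨hx, (key hx).2 (by linarith)⟩

/-- The hyperbolic centre lies below the Euclidean one, at the geometric mean h of the heights c₂ -
R and c₂ + R; the radius satisfies sinh ρ = R/h and cosh ρ = c₂/h. -/
theorem sphere_eq_geodesicSphere {c : E3} {R : ℝ} (hR : 0 < R) (hc : R < c 2) :
    ∃ q ∈ H3, ∃ ρ : ℝ, 0 < ρ ∧ Metric.sphere c R = geodesicSphere q ρ := by
  have hpos : 0 < c 2 ^ 2 - R ^ 2 := by nlinarith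
  set h := √(c 2 ^ 2 - R ^ 2) with hh
  have hh0 : 0 < h := Real.sqrt_pos.2 hpos
  have hhs : h ^ 2 = c 2 ^ 2 - R ^ 2 := Real.sq_sqrt hpos.le
  set q : E3 := c + (h - c 2) • EuclideanSpace.single 2 (1 : ℝ) with hq
  have hq2 : q 2 = h := by simp [hq]
  set ρ := Real.arsinh (R / h) with hρ
  have hρ0 : 0 < ρ := Real.arsinh_pos_iff.2 (by positivity)
  have hsinh : h * Real.sinh ρ = R := by rw [hρ, Real.sinh_arsinh]; field_simp
  have hcosh : h * Real.cosh ρ = c 2 := by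
    have h1 := Real.cosh_sq ρ
    have h2 : 0 < Real.cosh ρ := Real.cosh_pos ρ
    rw [← sq_eq_sq₀ (by positivity) (by linarith), mul_pow, h1]
    have : (h * Real.sinh ρ) ^ 2 = R ^ 2 := by rw [hsinh]
    nlinarith
  have hqH : q ∈ H3 := by change 0 < q 2; rw [hq2]; exact hh0
  refine ⟨q, hqH, ρ, hρ0, ?_⟩
  rw [geodesicSphere_eq hqH hρ0, hq2, hsinh]
  congr 1
  rw [euclCentre, hq2, mul_sub, hcosh, hq, add_assoc, ← add_smul]
  simp

/-! ### Rigidity -/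

section

variable {N : Type*} [TopologicalSpace N] [ChartedSpace E2 N] [IsManifold (𝓡 2) ∞ N]

theorem fderiv_dL_eq_zero_of_isLocalExtr {f : N → E3} (hf : IsSurface f) {G : E3 → ℝ} {a : N}
    (hG : DifferentiableAt ℝ G (f a)) (h : IsLocalExtr (fun x => G (f x)) a) (w : E2) :
    fderiv ℝ G (f a) (dL f a w) = 0 := by
  have hfa : inChart f a (ch a a) = f a := inChart_ch f (mem_extChartAt_source a)
  have ht : Tendsto (ch a).symm (𝓝 (ch a a)) (𝓝 a) := by
    have := continuousAt_extChartAt_symm (I := 𝓡 2) a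
    rw [ContinuousAt, extChartAt_to_inv] at this
    exact this
  have h1 : IsLocalExtr (G ∘ inChart f a) (ch a a) := by
    have he : G (inChart f a (ch a a)) = G (f a) := by rw [hfa]
    rcases h with h | h
    · exact Or.inl (by filter_upwards [ht.eventually h] with u hu; exact he.trans_le hu)
    · exact Or.inr (by filter_upwards [ht.eventually h] with u hu; exact hu.trans he.ge)
  have h2 := h1.fderiv_eq_zero
  rw [← hfa] at hG
  rw [fderiv_comp _ hG ((contDiffAt_inChart hf.smooth
    (mem_extChartAt_target a)).differentiableAt (by simp)), hfa] at h2
  exact DFunLike.congr_fun h2 w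

theorem inner_dL_eq_zero_of_isLocalExtr {f : N → E3} (hf : IsSurface f) {m : E3} {a : N}
    (h : IsLocalExtr (fun x => ⟪m, f x⟫) a) (w : E2) : ⟪dL f a w, m⟫ = 0 := by
  have h1 := fderiv_dL_eq_zero_of_isLocalExtr hf (G := innerSL ℝ m)
    (innerSL ℝ m).differentiableAt h w
  rw [ContinuousLinearMap.fderiv] at h1
  rw [real_inner_comm]; exact h1

theorem inner_dL_sub_eq_zero_of_isLocalExtr {f : N → E3} (hf : IsSurface f) {s : E3} {a : N}
    (h : IsLocalExtr (fun x => ‖f x - s‖ ^ 2) a) (w : E2) : ⟪dL f a w, f a - s⟫ = 0 := by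
  have h0 : HasFDerivAt (fun y : E3 => ‖y - s‖ ^ 2) _ (f a) := ((hasFDerivAt_id (f a)).sub_const s).norm_sq
  have h1 := fderiv_dL_eq_zero_of_isLocalExtr hf (G := fun y => ‖y - s‖ ^ 2)
    h0.differentiableAt h w
  rw [h0.fderiv] at h1
  simp at h1
  rw [real_inner_comm, inner_sub_left]; exact h1

omit [IsManifold (𝓡 2) ∞ N] in
theorem eq_smul_normalAt {f : N → E3} (hf : IsSurface f) {m : E3} {a : N}
    (h : ∀ w, ⟪dL f a w, m⟫ = 0) : m = ⟪m, normalAt f a⟫ • normalAt f a :=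
  eq_smul_of_inner_eq_zero (norm_normalAt hf a) (hf.area a) (inner_unitVec _ _) (inner_unitVec _ _)
    (h _) (h _)

variable [CompactSpace N]

/-- Maximize a tangential linear functional over the compact surface. At the maximum both this
direction and the normal of the plane are normal to the surface, yet they are orthogonal and
nonzero. -/
theorem IsSurface.not_subset_plane {f : N → E3} (hf : IsSurface f) (b : N) :
    ¬ ∀ x, ⟪f x - f b, normalAt f b⟫ = 0 := by
  intro h
  set n := normalAt f b with hn
  set m := dL f b (ee 0) with hm
  have hm0 : m ≠ 0 := by
    intro h0
    apply hf.area b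
    rw [areaVec, ← hm, h0, map_zero]; rfl
  have hn0 : n ≠ 0 := by
    intro h0
    have := norm_normalAt hf b
    rw [← hn, h0, norm_zero] at this
    exact zero_ne_one this
  have hmn : ⟪m, n⟫ = 0 := inner_unitVec _ _
  have hcont : Continuous fun x => ⟪m, f x⟫ := continuous_const.inner hf.smooth.continuous
  obtain ⟨a, _, ha⟩ := isCompact_univ.exists_isMaxOn ⟨b, mem_univ b⟩ hcont.continuousOn
  have h1 := eq_smul_normalAt hf (inner_dL_eq_zero_of_isLocalExtr hf
    (Or.inr (Eventually.of_forall fun x => ha (mem_univ x))))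
  have h2 := eq_smul_normalAt hf (inner_dL_eq_zero_of_isLocalExtr hf (m := n) (a := a)
    (Or.inr (Eventually.of_forall fun x => by
      have hx := h x
      have ha' := h a
      rw [inner_sub_left] at hx ha'
      simp only [real_inner_comm n] at hx ha'
      change ⟪n, f x⟫ ≤ ⟪n, f a⟫
      linarith)))
  have h3 : ⟪m, n⟫ = ⟪m, normalAt f a⟫ * ⟪n, normalAt f a⟫ := by
    conv_lhs => rw [h1, h2]
    rw [inner_smul_left, inner_smul_right, real_inner_self_eq_norm_sq, norm_normalAt hf]
    simp
  rw [hmn] at h3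
  rcases mul_eq_zero.1 h3.symm with h4 | h4
  · rw [h4, zero_smul] at h1; exact hm0 h1
  · rw [h4, zero_smul] at h2; exact hn0 h2

/-- Let `f a` be closest to a missed point `s` of the sphere. Both f(a) - s and f(a) - c are normal
at `a`, so f(a) is the antipode of s. As the antipode is the farthest point of the sphere, the whole
image is that single point, which contradicts immersion. -/
theorem IsSurface.range_eq_sphere {f : N → E3} (hf : IsSurface f) {c : E3} {R : ℝ} [Nonempty N]
    (h : ∀ x, ‖f x - c‖ = R) : range f = Metric.sphere c R := by
  refine Subset.antisymm ?_ fun s hs => ?_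
  · rintro _ ⟨x, rfl⟩; rw [mem_sphere_iff_norm]; exact h x
  by_contra hns
  rw [mem_sphere_iff_norm] at hs
  have hcont : Continuous fun x => ‖f x - s‖ ^ 2 :=
    ((hf.smooth.continuous.sub continuous_const).norm).pow 2
  obtain ⟨b⟩ := ‹Nonempty N›
  obtain ⟨a, _, ha⟩ := isCompact_univ.exists_isMinOn ⟨b, mem_univ b⟩ hcont.continuousOn
  set n := normalAt f a with hn
  have hn1 : ‖n‖ = 1 := norm_normalAt hf a
  have h1 := eq_smul_normalAt hf (inner_dL_sub_eq_zero_of_isLocalExtr hf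
    (Or.inl (Eventually.of_forall fun x => ha (mem_univ x))))
  have h2 := eq_smul_normalAt hf (inner_dL_sub_eq_zero_of_isLocalExtr hf (s := c) (a := a)
    (Or.inl (Eventually.of_forall fun x => by simp only [h]; exact le_rfl)))
  rw [← hn] at h1 h2
  set γ := ⟪f a - s, n⟫
  set β := ⟪f a - c, n⟫
  have hβ : β ^ 2 = R ^ 2 := by
    rw [← h a, h2, norm_smul, hn1, mul_one, Real.norm_eq_abs, sq_abs]
  have hγ : γ ≠ 0 := by
    intro h0
    rw [h0, zero_smul] at h1
    exact hns ⟨a, sub_eq_zero.1 h1⟩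
  have hsc : s - c = (β - γ) • n := by
    rw [sub_smul, ← h1, ← h2]; abel
  have hβγ : (β - γ) ^ 2 = R ^ 2 := by
    rw [← hs, hsc, norm_smul, hn1, mul_one, Real.norm_eq_abs, sq_abs]
  have hγβ : γ = 2 * β := by
    have : γ * (γ - 2 * β) = 0 := by nlinarith
    rcases mul_eq_zero.1 this with h3 | h3
    · exact absurd h3 hγ
    · linarith
  have hdist : ‖f a - s‖ ^ 2 = 4 * R ^ 2 := by
    rw [h1, norm_smul, hn1, mul_one, Real.norm_eq_abs, sq_abs, hγβ, mul_pow, hβ]; norm_num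
  have hconst : ∀ x, f x = c + c - s := by
    intro x
    have h3 : 4 * R ^ 2 ≤ ‖f x - s‖ ^ 2 := hdist ▸ ha (mem_univ x)
    have h4 : f x - s = (f x - c) - (s - c) := by abel
    have h5 : ‖(f x - c) + (s - c)‖ ^ 2 ≤ 0 := by
      rw [h4, norm_sub_sq_real, h, hs] at h3
      rw [norm_add_sq_real, h, hs]
      linarith
    have h6 : (f x - c) + (s - c) = 0 := by
      rw [← norm_eq_zero]
      nlinarith [norm_nonneg ((f x - c) + (s - c))]
    have h7 : f x = (f x - c) + (s - c) + (c + c - s) := by abel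
    rw [h6, zero_add] at h7
    exact h7
  apply hf.area a
  have hc : inChart f a = fun _ => c + c - s := funext fun u => hconst _
  rw [dL, hc, fderiv_const_apply]
  simp [areaVec]

/-- Fix the surface point `b` and vary the pole `f a`: vanishing deviation is the equation of a
plane or a sphere through `f b`, with coefficients depending only on `b`. A compact immersed surface
is not contained in a plane. -/
theorem exists_geodesicSphere_of_deviation {f v : N → E3} (hf : IsSurface f) [Nonempty N]
    (h : ∀ a b, b ≠ a → deviation f v (f a) b = 0) (hinj : Function.Injective f) :
    ∃ q ∈ H3, ∃ ρ : ℝ, 0 < ρ ∧ range f = geodesicSphere q ρ := by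
  obtain ⟨b⟩ := id ‹Nonempty N›
  have hn1 := norm_normalAt hf b
  have hplane := hf.not_subset_plane b
  set n := normalAt f b with hn
  set α := kap f v b - n 2 with hα
  have hb2 := hf.pos b
  have hall : ∀ a, α * ‖f a - f b‖ ^ 2 = 2 * f b 2 * ⟪f a - f b, n⟫ := by
    intro a
    by_cases hab : b = a
    · subst hab; simp
    · have h1 := h a b hab
      have hne : ‖f b - f a‖ ≠ 0 := norm_ne_zero_iff.2 (sub_ne_zero.2 fun h => hab (hinj h))
      rw [deviation, ← hn] at h1
      have h2 : ⟪f a - f b, n⟫ = - ⟪f b - f a, n⟫ := by rw [← inner_neg_left, neg_sub]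
      rw [norm_sub_rev, h2]
      field_simp at h1
      rw [hα]
      linarith
  have hα0 : α ≠ 0 := by
    intro h0
    apply hplane
    intro x
    have := hall x
    rw [h0, zero_mul] at this
    rcases mul_eq_zero.1 this.symm with h3 | h3
    · linarith
    · exact h3
  set R := |f b 2 / α| with hR
  have hR0 : 0 < R := abs_pos.2 (div_ne_zero hb2.ne' hα0)
  set c := f b + (f b 2 / α) • n with hc
  have hS : ∀ x, ‖f x - c‖ = R := by
    intro x
    have h1 : f x - c = (f x - f b) - (f b 2 / α) • n := by rw [hc]; abel
    rw [← sq_eq_sq₀ (norm_nonneg _) hR0.le, h1, norm_sub_sq_real, inner_smul_right, norm_smul,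
      hn1, mul_one, Real.norm_eq_abs, hR]
    have := hall x
    field_simp
    linarith
  have hrange := hf.range_eq_sphere hS
  -- The surface fills the sphere, so the lowest point of the sphere is attained and has positive
  -- height.
  have hc2 : R < c 2 := by
    have hmem : c - R • EuclideanSpace.single 2 (1 : ℝ) ∈ range f := by
      rw [hrange, mem_sphere_iff_norm, sub_sub_cancel_left, norm_neg, norm_smul,
        Real.norm_of_nonneg hR0.le]
      simp
    obtain ⟨x, hx⟩ := hmem
    have := hf.pos x
    rw [hx] at this
    simp at this
    exact this
  rw [hrange]
  exact sphere_eq_geodesicSphere hR0 hc2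

end

/-! ### Area and curvature integrals along the flow -/

section

variable {N : Type*} [TopologicalSpace N] [ChartedSpace E2 N]

theorem continuous_of_charts_slab {X : Type*} [TopologicalSpace X] {S : Set ℝ} {g : ℝ → N → X}
    (h : ∀ c : N, ContinuousOn (fun q : ℝ × E2 => g q.1 ((ch c).symm q.2)) (S ×ˢ (ch c).target)) :
    Continuous fun q : S × N => g q.1 q.2 := by
  rw [continuous_iff_continuousAt]
  rintro ⟨t, x⟩
  have h1 : ContinuousWithinAt (fun q : ℝ × E2 => g q.1 ((ch x).symm q.2)) (S ×ˢ (ch x).target)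
      ((t : ℝ), ch x x) := h x _ ⟨t.2, mem_extChartAt_target x⟩
  have h2 : Tendsto (fun q : S × N => ((q.1 : ℝ), ch x q.2)) (𝓝 (t, x))
      (𝓝[S ×ˢ (ch x).target] ((t : ℝ), ch x x)) := by
    refine tendsto_nhdsWithin_iff.2 ⟨?_, ?_⟩
    · have h3 : ContinuousAt (fun q : S × N => ch x q.2) (t, x) :=
        ContinuousAt.comp (f := fun q : S × N => q.2) (continuousAt_extChartAt (I := 𝓡 2) x)
          continuousAt_snd
      exact ((continuous_subtype_val.comp continuous_fst).continuousAt.prodMk h3).tendsto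
    · have : ∀ᶠ q : S × N in 𝓝 (t, x), q.2 ∈ (ch x).source :=
        continuousAt_snd.eventually (extChartAt_source_mem_nhds (I := 𝓡 2) x)
      filter_upwards [this] with q hq
      exact ⟨q.1.2, (ch x).map_source hq⟩
  have h4 := h1.tendsto.comp h2
  rw [ContinuousAt]
  have hxx : (ch x).symm (ch x x) = x := extChartAt_to_inv x
  simp only [hxx] at h4
  refine h4.congr' ?_
  have : ∀ᶠ q : S × N in 𝓝 (t, x), q.2 ∈ (ch x).source :=
    continuousAt_snd.eventually (extChartAt_source_mem_nhds (I := 𝓡 2) x)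
  filter_upwards [this] with q hq
  simp only [Function.comp_apply, (ch x).left_inv hq]

/-- The hyperbolic area of an immersed surface. -/
def hArea [MeasurableSpace N] (f₀ f : N → E3) (cs : ℕ → N) : ℝ :=
  ∫ x, hjac f₀ f x ∂(areaMeas f₀ cs)

/-- The integral of the squared mean curvature. -/
def sqCurv [MeasurableSpace N] (f₀ f v : N → E3) (cs : ℕ → N) : ℝ :=
  ∫ x, ‖v x‖ ^ 2 / f x 2 ^ 2 * hjac f₀ f x ∂(areaMeas f₀ cs)

/-- The integral of the absolute mean curvature. -/
def absCurv [MeasurableSpace N] (f₀ f v : N → E3) (cs : ℕ → N) : ℝ :=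
  ∫ x, ‖v x‖ / f x 2 * hjac f₀ f x ∂(areaMeas f₀ cs)

variable [IsManifold (𝓡 2) ∞ N] {T : ℝ} {F : ℝ → N → E3}

theorem IsMeanCurvatureFlow.hasCurvatureVector (hF : IsMeanCurvatureFlow T F) {t : ℝ}
    (ht : t ∈ Ico 0 T) : HasCurvatureVector (F t) (vel T F t) where
  cont := continuous_of_charts fun c =>
    (contDiffOn_derivWithin_slice (isOpen_extChartAt_target c) (hF.contDiffOn c)).continuousOn.comp
      (f := fun u : E2 => (t, u)) (by fun_prop) fun u hu => ⟨ht, hu⟩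
  chart c u hu := hF.derivWithin_inChart ht hu

theorem IsMeanCurvatureFlow.continuous_uncurry (hF : IsMeanCurvatureFlow T F) :
    Continuous fun q : Ico 0 T × N => F q.1 q.2 :=
  continuous_of_charts_slab fun c => (hF.contDiffOn c).continuousOn

theorem IsMeanCurvatureFlow.continuous_vel (hF : IsMeanCurvatureFlow T F) :
    Continuous fun q : Ico 0 T × N => vel T F q.1 q.2 :=
  continuous_of_charts_slab fun c =>
    (contDiffOn_derivWithin_slice (isOpen_extChartAt_target c) (hF.contDiffOn c)).continuousOn

theorem IsMeanCurvatureFlow.continuous_hjac (hF : IsMeanCurvatureFlow T F) (hT : 0 < T) :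
    Continuous fun q : Ico 0 T × N => hjac (F 0) (F q.1) q.2 := by
  have h0 := hF.isSurface (t := 0) ⟨le_rfl, hT⟩
  refine Continuous.div ?_ (((EuclideanSpace.proj (𝕜 := ℝ) (2 : Fin 3)).continuous.comp
    hF.continuous_uncurry).pow 2) fun q => pow_ne_zero 2 ((hF.isSurface q.1.2).pos _).ne'
  refine continuous_of_charts_slab (g := fun t x => jac (F 0) (F t) x) fun c => ?_
  have h1 := (contDiffOn_fderiv_slice (isOpen_extChartAt_target c) (hF.contDiffOn c)).continuousOn
  have h2 : ContinuousOn (fun q : ℝ × E2 => ‖areaVec (fderiv ℝ (inChart (F 0) c) q.2)‖)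
      (Ico 0 T ×ˢ (ch c).target) :=
    (continuousOn_norm_areaVec h0 c).comp continuousOn_snd fun q hq => hq.2
  refine ((continuous_areaVec.norm.comp_continuousOn h1).div h2
    fun q hq => norm_ne_zero_iff.2 (h0.areaVec_ne hq.2)).congr fun q hq => ?_
  rw [Pi.div_apply, eq_div_iff (norm_ne_zero_iff.2 (h0.areaVec_ne hq.2)),
    jac_chart h0 (hF.isSurface hq.1) hq.2]
  rfl

theorem IsMeanCurvatureFlow.hasDerivAt_hjac (hF : IsMeanCurvatureFlow T F) (x : N) {t : ℝ}
    (ht : t ∈ Ioo 0 T) : HasDerivAt (fun s => hjac (F 0) (F s) x)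
      (-2 * (‖vel T F t x‖ ^ 2 / F t x 2 ^ 2 * hjac (F 0) (F t) x)) t := by
  have ht' : t ∈ Ico 0 T := ⟨ht.1.le, ht.2⟩
  have h0 := hF.isSurface (t := 0) ⟨le_rfl, ht.1.trans ht.2⟩
  have hS := hF.isSurface ht'
  have hxx := mem_extChartAt_source (I := 𝓡 2) x
  have hux := mem_extChartAt_target (I := 𝓡 2) x
  have h1 := hasDerivAt_areaElement (isOpen_extChartAt_target x) (hF.contDiffOn x) ht hux
    (fun w hw => hF.derivWithin_inChart ht' hw) (hS.area x) (inChart_pos hS x _)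
  have hv : ∀ s, inChart (F s) x (ch x x) = F s x := fun s => inChart_ch (F s) hxx
  simp only [hv] at h1
  have h2 := h1.div_const ‖areaVec (dL (F 0) x)‖
  have he : ∀ s, hjac (F 0) (F s) x =
      ‖areaVec (fderiv ℝ (inChart (F s) x) (ch x x))‖ / F s x 2 ^ 2 / ‖areaVec (dL (F 0) x)‖ := by
    intro s
    rw [hjac, jac, div_right_comm]; rfl
  simp only [he]
  refine h2.congr_deriv ?_
  rw [vel]; ring

variable [CompactSpace N] [MeasurableSpace N] [BorelSpace N]

omit [ChartedSpace E2 N] [IsManifold (𝓡 2) ∞ N] in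
theorem continuousOn_integral_slab {S : Set ℝ} (hS : IsLocallyClosed S) {g : ℝ → N → ℝ}
    (hg : Continuous fun q : S × N => g q.1 q.2) (μ : Measure N) [IsFiniteMeasure μ] :
    ContinuousOn (fun t => ∫ x, g t x ∂μ) S := by
  rw [continuousOn_iff_continuous_domRestrict]
  have := hS.locallyCompactSpace
  have h := continuous_parametric_integral_of_continuous (μ := μ) (f := fun (t : S) x => g t x)
    hg (isCompact_univ (X := N))
  simp only [setIntegral_univ] at h
  exact h

omit [CompactSpace N] [MeasurableSpace N] [BorelSpace N] in
theorem IsMeanCurvatureFlow.continuous_sqCurv_integrand (hF : IsMeanCurvatureFlow T F) (hT : 0 < T) :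
    Continuous fun q : Ico 0 T × N =>
      ‖vel T F q.1 q.2‖ ^ 2 / F q.1 q.2 2 ^ 2 * hjac (F 0) (F q.1) q.2 :=
  ((hF.continuous_vel.norm.pow 2).div (((EuclideanSpace.proj (𝕜 := ℝ) (2 : Fin 3)).continuous.comp
    hF.continuous_uncurry).pow 2) fun q => pow_ne_zero 2 ((hF.isSurface q.1.2).pos _).ne').mul
    (hF.continuous_hjac hT)

theorem IsMeanCurvatureFlow.continuousOn_hArea (hF : IsMeanCurvatureFlow T F) (hT : 0 < T)
    {cs : ℕ → N} (hcs : ⋃ k, (ch (cs k)).source = univ) :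
    ContinuousOn (fun t => hArea (F 0) (F t) cs) (Ico 0 T) :=
  have := isFiniteMeasure_areaMeas (hF.isSurface ⟨le_rfl, hT⟩) hcs
  continuousOn_integral_slab isLocallyClosed_Ico (hF.continuous_hjac hT) _

theorem IsMeanCurvatureFlow.continuousOn_sqCurv (hF : IsMeanCurvatureFlow T F) (hT : 0 < T)
    {cs : ℕ → N} (hcs : ⋃ k, (ch (cs k)).source = univ) :
    ContinuousOn (fun t => sqCurv (F 0) (F t) (vel T F t) cs) (Ico 0 T) :=
  have := isFiniteMeasure_areaMeas (hF.isSurface ⟨le_rfl, hT⟩) hcs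
  continuousOn_integral_slab isLocallyClosed_Ico (hF.continuous_sqCurv_integrand hT) _

theorem IsMeanCurvatureFlow.continuousOn_absCurv (hF : IsMeanCurvatureFlow T F) (hT : 0 < T)
    {cs : ℕ → N} (hcs : ⋃ k, (ch (cs k)).source = univ) :
    ContinuousOn (fun t => absCurv (F 0) (F t) (vel T F t) cs) (Ico 0 T) :=
  have := isFiniteMeasure_areaMeas (hF.isSurface ⟨le_rfl, hT⟩) hcs
  continuousOn_integral_slab isLocallyClosed_Ico
    ((hF.continuous_vel.norm.div ((EuclideanSpace.proj (𝕜 := ℝ) (2 : Fin 3)).continuous.comp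
      hF.continuous_uncurry) fun q => ((hF.isSurface q.1.2).pos _).ne').mul
      (hF.continuous_hjac hT)) _

/-- Differentiation under the integral against the fixed measure of the initial surface. The
integrand's time derivative is bounded by a constant on the compact product of a small time interval
and the surface. -/
theorem IsMeanCurvatureFlow.hasDerivAt_hArea (hF : IsMeanCurvatureFlow T F)
    {cs : ℕ → N} (hcs : ⋃ k, (ch (cs k)).source = univ) {t : ℝ} (ht : t ∈ Ioo 0 T) :
    HasDerivAt (fun s => hArea (F 0) (F s) cs)
      (-2 * sqCurv (F 0) (F t) (vel T F t) cs) t := by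
  have hT : 0 < T := ht.1.trans ht.2
  have h0 := hF.isSurface (t := 0) ⟨le_rfl, hT⟩
  have := isFiniteMeasure_areaMeas h0 hcs
  obtain ⟨a, b, hab, hnhds, hsub⟩ := exists_Icc_mem_subset_of_mem_nhds (isOpen_Ioo.mem_nhds ht)
  have hsub' : ∀ s ∈ Icc a b, s ∈ Ico 0 T := fun s hs => ⟨(hsub hs).1.le, (hsub hs).2⟩
  have hc : Continuous fun q : Icc a b × N =>
      -2 * (‖vel T F q.1 q.2‖ ^ 2 / F q.1 q.2 2 ^ 2 * hjac (F 0) (F q.1) q.2) := by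
    have h1 : Continuous fun q : Icc a b × N => ((⟨q.1, hsub' q.1 q.1.2⟩ : Ico 0 T), q.2) := by
      fun_prop
    exact ((hF.continuous_sqCurv_integrand hT).comp h1).const_mul (-2)
  obtain ⟨C, hC⟩ := (isCompact_univ.image hc.norm).bddAbove
  have hcj : ∀ s ∈ Ico 0 T, Continuous fun x => hjac (F 0) (F s) x := fun s hs =>
    Hyp3.continuous_hjac h0 (hF.isSurface hs)
  have hder := hasDerivAt_integral_of_dominated_loc_of_deriv_le (μ := areaMeas (F 0) cs)
    (F := fun s x => hjac (F 0) (F s) x)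
    (F' := fun s x => -2 * (‖vel T F s x‖ ^ 2 / F s x 2 ^ 2 * hjac (F 0) (F s) x))
    (x₀ := t) (bound := fun _ => C) hnhds
    (by filter_upwards [hnhds] with s hs using (hcj s (hsub' s hs)).aestronglyMeasurable)
    ((hcj t ⟨ht.1.le, ht.2⟩).integrable_of_hasCompactSupport (HasCompactSupport.of_compactSpace _))
    (by
      have h1 : Continuous fun x : N => ((⟨t, ⟨ht.1.le, ht.2⟩⟩ : Ico 0 T), x) := by fun_prop
      exact (((hF.continuous_sqCurv_integrand hT).comp h1).const_mul (-2)).aestronglyMeasurable)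
    (ae_of_all _ fun x s hs => hC ⟨(⟨s, hs⟩, x), mem_univ _, rfl⟩)
    (integrable_const C)
    (ae_of_all _ fun x s hs => hF.hasDerivAt_hjac x (hsub hs))
  have h2 := hder.2
  rw [integral_const_mul] at h2
  exact h2

end

/-! ### The second variation of the distance between two points of a surface -/

theorem meanCurvature_neg (f : E2 → E3) (u : E2) (ν : E3) :
    meanCurvature f u (-ν) = -meanCurvature f u ν := by
  have h : secondForm f u (-ν) = -secondForm f u ν := by
    ext i j
    simp only [secondForm, Matrix.of_apply, Matrix.neg_apply, metric, inner_neg_right]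
    ring
  rw [meanCurvature, meanCurvature, h, Matrix.mul_neg, Matrix.trace_neg]
  ring

/-- The curvature vector is independent of the parametrization. -/
theorem lapl_comp_smul {f : E2 → E3} {τ : E2 → E2} {u : E2}
    (hf : ContDiffAt ℝ ∞ f (τ u)) (hτ : ContDiffAt ℝ ∞ τ u) (hdet : (fderiv ℝ τ u).det ≠ 0)
    (hA : areaVec (fderiv ℝ f (τ u)) ≠ 0) (hx : 0 < f (τ u) 2) :
    lapl (f ∘ τ) u • nrm (f ∘ τ) u = lapl f (τ u) • nrm f (τ u) := by
  have hd : fderiv ℝ (f ∘ τ) u = (fderiv ℝ f (τ u)).comp (fderiv ℝ τ u) :=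
    fderiv_comp _ (hf.differentiableAt (by simp)) (hτ.differentiableAt (by simp))
  have hA' : areaVec (fderiv ℝ (f ∘ τ) u) ≠ 0 := by
    rw [hd, areaVec_comp]; exact smul_ne_zero hdet hA
  have h1 := neg_meanCurvature_smul (hf.comp u hτ) hA' hx
  have h2 := neg_meanCurvature_smul hf hA hx
  have hν := isUnitNormal_smul_nrm hA hx
  have hn : nrm (f ∘ τ) u = nrm f (τ u) ∨ nrm (f ∘ τ) u = - nrm f (τ u) := by
    rw [nrm, hd]
    exact unitVec_comp _ hdet
  have hc := meanCurvature_comp hf hτ hdet hν hx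
  have hfx : (f ∘ τ) u = f (τ u) := rfl
  rw [hfx] at h1
  have key : (f (τ u) 2 ^ 2 / 2 * lapl (f ∘ τ) u + f (τ u) 2 * nrm (f ∘ τ) u 2) • nrm (f ∘ τ) u =
      (f (τ u) 2 ^ 2 / 2 * lapl f (τ u) + f (τ u) 2 * nrm f (τ u) 2) • nrm f (τ u) := by
    rw [← h1, ← h2]
    rcases hn with h | h
    · rw [h, hc]
    · rw [h, smul_neg, meanCurvature_neg, hc]; simp
  have h0 : f (τ u) 2 ^ 2 / 2 ≠ 0 := by positivity
  rw [add_smul, add_smul] at key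
  have h3 : (f (τ u) 2 * nrm (f ∘ τ) u 2) • nrm (f ∘ τ) u =
      (f (τ u) 2 * nrm f (τ u) 2) • nrm f (τ u) := by
    rcases hn with h | h
    · rw [h]
    · rw [h]; simp
  rw [h3, add_left_inj, mul_smul, mul_smul] at key
  exact smul_right_injective _ h0 key

/-- Along a line through u the second derivative of |D|² is 2⟪D, D''⟫, since D' vanishes at u. -/
theorem inner_fderiv_fderiv_nonneg {D : E2 → E3} {u : E2} (hD : ContDiffAt ℝ ∞ D u)
    (hD0 : fderiv ℝ D u = 0) (hmin : IsLocalMin (fun z => ‖D z‖ ^ 2) u) (ξ : E2) :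
    0 ≤ ⟪D u, fderiv ℝ (fderiv ℝ D) u ξ ξ⟫ := by
  by_contra hneg
  rw [not_le] at hneg
  set l : ℝ → E2 := fun s => u + s • ξ with hl
  have hl0 : l 0 = u := by simp [hl]
  have hlc : Continuous l := by fun_prop
  have hld : ∀ s, HasDerivAt l ξ s := fun s =>
    (((hasDerivAt_id s).smul_const ξ).const_add u).congr_deriv (one_smul ℝ ξ)
  have hlt : Tendsto l (𝓝 0) (𝓝 u) := by simpa [hl0] using hlc.tendsto 0
  obtain ⟨U, hU, hUo, hUu⟩ := eventually_nhds_iff.1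
    ((hD.of_le two_le_infty).eventually (by simp))
  have hev : ∀ᶠ s in 𝓝 (0 : ℝ), l s ∈ U := hlt.eventually (hUo.mem_nhds hUu)
  have hq1 : ∀ s, l s ∈ U → HasDerivAt (fun s => ‖D (l s)‖ ^ 2)
      (2 * ⟪D (l s), fderiv ℝ D (l s) ξ⟫) s := by
    intro s hs
    have h1 : HasDerivAt (fun s => D (l s)) (fderiv ℝ D (l s) ξ) s :=
      (((hU _ hs).differentiableAt (by simp)).hasFDerivAt).comp_hasDerivAt s (hld s)
    exact h1.norm_sq
  have hdq : deriv (fun s => ‖D (l s)‖ ^ 2) =ᶠ[𝓝 0]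
      fun s => 2 * ⟪D (l s), fderiv ℝ D (l s) ξ⟫ := by
    filter_upwards [hev] with s hs using (hq1 s hs).deriv
  have hd2 : HasDerivAt (fun s => fderiv ℝ D (l s) ξ) (fderiv ℝ (fderiv ℝ D) u ξ ξ) 0 := by
    have h1 : HasFDerivAt (fderiv ℝ D) (fderiv ℝ (fderiv ℝ D) u) (l 0) := by
      rw [hl0]
      exact ((hD.fderiv_right (m := ∞) (by simp)).differentiableAt (by simp)).hasFDerivAt
    have h2 : HasDerivAt (fun s => fderiv ℝ D (l s)) (fderiv ℝ (fderiv ℝ D) u ξ) 0 :=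
      h1.comp_hasDerivAt (0 : ℝ) (hld 0)
    exact (h2.clm_apply (hasDerivAt_const (0 : ℝ) ξ)).congr_deriv (by simp)
  have hd1 : HasDerivAt (fun s => D (l s)) 0 0 := by
    have h1 : DifferentiableAt ℝ D (l 0) := by rw [hl0]; exact hD.differentiableAt (by simp)
    have h2 := (h1.hasFDerivAt).comp_hasDerivAt (0 : ℝ) (hld 0)
    rw [hl0, hD0] at h2
    exact h2
  have hdd : deriv (deriv fun s => ‖D (l s)‖ ^ 2) 0 = 2 * ⟪D u, fderiv ℝ (fderiv ℝ D) u ξ ξ⟫ := by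
    rw [hdq.deriv_eq]
    have h3 := (hd1.inner ℝ hd2).const_mul 2
    rw [h3.deriv, hl0, inner_zero_left, add_zero]
  -- A negative second derivative would make the local minimum also a local maximum, so the function
  -- would be locally constant.
  have hmax := isLocalMax_of_deriv_deriv_neg (f := fun s => ‖D (l s)‖ ^ 2) (x₀ := 0)
    (by rw [hdd]; linarith) (by rw [hdq.eq_of_nhds, hl0, hD0]; simp)
    ((hq1 0 (by rw [hl0]; exact hUu)).continuousAt)
  have hmin' : ∀ᶠ s in 𝓝 (0 : ℝ), ‖D u‖ ^ 2 ≤ ‖D (l s)‖ ^ 2 := hlt.eventually hmin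
  have hconst : (fun s => ‖D (l s)‖ ^ 2) =ᶠ[𝓝 0] fun _ => ‖D u‖ ^ 2 := by
    filter_upwards [hmax, hmin'] with s h1 h2
    rw [hl0] at h1
    exact le_antisymm h1 h2
  have h4 : deriv (deriv fun s => ‖D (l s)‖ ^ 2) 0 = 0 := by
    rw [hconst.deriv.deriv_eq]
    simp
  rw [hdd] at h4
  linarith

/-- E times the trace equals the quadratic form at (F, -E) plus (EG - F²)k₀, and k₀ is its value at
(1, 0). -/
theorem trace_nonneg_of_nonneg {E F G k₀ k₁ k₂ : ℝ} (hE : 0 ≤ E) (hdet : 0 < E * G - F ^ 2)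
    (hk : ∀ a b : ℝ, 0 ≤ a ^ 2 * k₀ + 2 * a * b * k₁ + b ^ 2 * k₂) :
    0 ≤ G * k₀ - 2 * F * k₁ + E * k₂ := by
  have hE' : 0 < E := by
    rcases hE.eq_or_lt with h | h
    · rw [← h] at hdet; nlinarith [sq_nonneg F]
    · exact h
  have h1 := hk F (-E)
  have h2 := hk 1 0
  have h3 : 0 ≤ (E * G - F ^ 2) * k₀ := mul_nonneg hdet.le (by linarith)
  have h4 : 0 ≤ E * (G * k₀ - 2 * F * k₁ + E * k₂) := by nlinarith
  exact nonneg_of_mul_nonneg_right h4 hE'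

/-- Comparison of the Laplacians of two surfaces with the same tangent map that are closest to
each other at corresponding points. -/
theorem inner_lapl_le {φ ψ : E2 → E3} {u : E2} (hφ : ContDiffAt ℝ ∞ φ u) (hψ : ContDiffAt ℝ ∞ ψ u)
    (hA : areaVec (fderiv ℝ φ u) ≠ 0) (heq : fderiv ℝ ψ u = fderiv ℝ φ u)
    (hw : φ u - ψ u = ⟪φ u - ψ u, nrm φ u⟫ • nrm φ u)
    (hmin : IsLocalMin (fun z => ‖φ z - ψ z‖ ^ 2) u) :
    ⟪φ u - ψ u, lapl ψ u • nrm ψ u⟫ ≤ ⟪φ u - ψ u, lapl φ u • nrm φ u⟫ := by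
  have hn : nrm ψ u = nrm φ u := by rw [nrm, nrm, heq]
  have ht : ∀ i, tangent ψ u i = tangent φ u i := fun i => by rw [tangent, tangent, heq]
  set w := φ u - ψ u with hwdef
  set n := nrm φ u with hndef
  have hD : ContDiffAt ℝ ∞ (fun z => φ z - ψ z) u := hφ.sub hψ
  have hφd := hφ.differentiableAt (n := ∞) (by simp)
  have hψd := hψ.differentiableAt (n := ∞) (by simp)
  have hD0 : fderiv ℝ (fun z => φ z - ψ z) u = 0 := by
    rw [fderiv_fun_sub hφd hψd, heq, sub_self]
  have hkk := inner_fderiv_fderiv_nonneg hD hD0 hmin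
  have hev : fderiv ℝ (fun z => φ z - ψ z) =ᶠ[𝓝 u] fun z => fderiv ℝ φ z - fderiv ℝ ψ z := by
    filter_upwards [(hφ.of_le two_le_infty).eventually (by simp),
      (hψ.of_le two_le_infty).eventually (by simp)] with z h1 h2
    exact fderiv_fun_sub (h1.differentiableAt (by simp)) (h2.differentiableAt (by simp))
  have hφ2 : DifferentiableAt ℝ (fderiv ℝ φ) u :=
    (hφ.fderiv_right (m := ∞) (by simp)).differentiableAt (by simp)
  have hψ2 : DifferentiableAt ℝ (fderiv ℝ ψ) u :=
    (hψ.fderiv_right (m := ∞) (by simp)).differentiableAt (by simp)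
  have hDD : fderiv ℝ (fderiv ℝ fun z => φ z - ψ z) u =
      fderiv ℝ (fderiv ℝ φ) u - fderiv ℝ (fderiv ℝ ψ) u := by
    rw [hev.fderiv_eq, fderiv_fun_sub hφ2 hψ2]
  set k : Fin 2 → Fin 2 → ℝ := fun i j => ⟪w, hess φ u i j - hess ψ u i j⟫ with hk
  have hk10 : k 1 0 = k 0 1 := by
    simp only [hk]; rw [hess_symm hφ, hess_symm hψ]
  have hquad : ∀ a b : ℝ, 0 ≤ a ^ 2 * k 0 0 + 2 * a * b * k 0 1 + b ^ 2 * k 1 1 := by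
    intro a b
    have h1 := hkk (a • ee 0 + b • ee 1)
    rw [hDD] at h1
    have e : ∀ i j, k i j = ⟪w, (fderiv ℝ (fderiv ℝ φ) u - fderiv ℝ (fderiv ℝ ψ) u) (ee i) (ee j)⟫ := by
      intro i j
      simp only [hk, hess_eq hφ, hess_eq hψ, sub_apply]
    simp only [map_add, map_smul, add_apply, smul_apply, inner_add_right, inner_smul_right,
      ← hwdef, ← e, hk10] at h1
    linarith
  have hE : 0 ≤ ⟪tangent φ u 0, tangent φ u 0⟫ := real_inner_self_nonneg
  have hdet : 0 < ⟪tangent φ u 0, tangent φ u 0⟫ * ⟪tangent φ u 1, tangent φ u 1⟫ -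
      ⟪tangent φ u 0, tangent φ u 1⟫ ^ 2 := by
    have h1 := norm_cross_sq (tangent φ u 0) (tangent φ u 1)
    rw [← h1]
    have : 0 < ‖areaVec (fderiv ℝ φ u)‖ := norm_pos_iff.2 hA
    change 0 < ‖areaVec (fderiv ℝ φ u)‖ ^ 2
    positivity
  have htr := trace_nonneg_of_nonneg hE hdet hquad
  have hkn : ∀ i j, k i j = ⟪w, n⟫ * (⟪hess φ u i j, n⟫ - ⟪hess ψ u i j, n⟫) := by
    intro i j
    simp only [hk]
    conv_lhs => rw [hw]
    rw [inner_smul_left, ← inner_sub_left, real_inner_comm n]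
    simp only [conj_trivial, real_inner_comm]
  have hfin : ⟪w, lapl φ u • n⟫ - ⟪w, lapl ψ u • n⟫ =
      (⟪tangent φ u 1, tangent φ u 1⟫ * k 0 0 - 2 * ⟪tangent φ u 0, tangent φ u 1⟫ * k 0 1 +
        ⟪tangent φ u 0, tangent φ u 0⟫ * k 1 1) / ‖areaVec (fderiv ℝ φ u)‖ ^ 2 := by
    rw [inner_smul_right, inner_smul_right, lapl, lapl, heq, hn]
    simp only [ht, hkn]
    ring
  have : 0 ≤ ⟪w, lapl φ u • n⟫ - ⟪w, lapl ψ u • n⟫ := by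
    rw [hfin]; exact div_nonneg htr (by positivity)
  rw [hn]
  linarith

/-- Two injective maps with the same image plane differ by a reparametrization. -/
theorem exists_eq_comp {L L' : E2 →L[ℝ] E3} {n : E3} (hn : n ≠ 0) (hL' : Function.Injective L')
    (h : ∀ w, ⟪L w, n⟫ = 0) (h' : ∀ w, ⟪L' w, n⟫ = 0) :
    ∃ B : E2 →L[ℝ] E2, L = L'.comp B := by
  have hfact : Fact (Module.finrank ℝ E3 = 2 + 1) := ⟨by simp⟩
  have hr : LinearMap.range (L' : E2 →ₗ[ℝ] E3) = (Submodule.span ℝ {n})ᗮ := by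
    apply Submodule.eq_of_le_of_finrank_eq
    · rintro _ ⟨w, rfl⟩
      rw [Submodule.mem_orthogonal_singleton_iff_inner_left]
      exact h' w
    · rw [Submodule.finrank_orthogonal_span_singleton (n := 2) hn,
        LinearMap.finrank_range_of_inj hL', finrank_euclideanSpace_fin]
  have hex : ∀ w, ∃ z, L' z = L w := by
    intro w
    have : L w ∈ LinearMap.range (L' : E2 →ₗ[ℝ] E3) := by
      rw [hr, Submodule.mem_orthogonal_singleton_iff_inner_left]; exact h w
    exact this
  choose z hz using hex
  let B : E2 →ₗ[ℝ] E2 :=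
    { toFun := z
      map_add' := fun a b => hL' (by rw [map_add, hz, hz, hz, map_add])
      map_smul' := fun c a => hL' (by rw [RingHom.id_apply, map_smul, hz, hz, map_smul]) }
  refine ⟨LinearMap.toContinuousLinearMap B, ?_⟩
  ext1 w
  exact (hz w).symm

theorem injective_of_areaVec_ne_zero {L : E2 →L[ℝ] E3} (hL : areaVec L ≠ 0) :
    Function.Injective L := by
  obtain ⟨M, hM, hdet⟩ := exists_comp_isometry L hL
  have hd : M.det ≠ 0 := by rw [← abs_pos, hdet]; exact norm_pos_iff.2 hL
  have hu := (LinearMap.isUnit_iff_isUnit_det (M : E2 →ₗ[ℝ] E2)).2 (isUnit_iff_ne_zero.2 hd)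
  have hinj : Function.Injective M := ((Module.End.isUnit_iff _).1 hu).1
  rw [injective_iff_map_eq_zero]
  intro w hw
  apply hinj
  rw [map_zero, ← norm_eq_zero, hM, hw, norm_zero]

/-! ### Closest pairs of points on a surface -/

section

variable {N : Type*} [TopologicalSpace N] [ChartedSpace E2 N] [IsManifold (𝓡 2) ∞ N]

/-- At a locally closest pair both tangent planes are orthogonal to the connecting segment, hence
parallel. A linear reparametrization at `b` makes the two tangent maps equal; moving both points in
parallel then gives a second-order condition involving only the Laplacians. -/
theorem inner_posLapl_le {f v : N → E3} (hf : IsSurface f) (hv : HasCurvatureVector f v) {a b : N}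
    (hab : f a ≠ f b) (hmin : IsLocalMin (fun q : N × N => ‖f q.1 - f q.2‖ ^ 2) (a, b)) :
    ⟪f a - f b, posLapl f v b⟫ ≤ ⟪f a - f b, posLapl f v a⟫ ∧
    f a - f b = ⟪f a - f b, normalAt f a⟫ • normalAt f a ∧
    f a - f b = ⟪f a - f b, normalAt f b⟫ • normalAt f b := by
  have hmina : IsLocalMin (fun x => ‖f x - f b‖ ^ 2) a := by
    have : Tendsto (fun x : N => (x, b)) (𝓝 a) (𝓝 (a, b)) :=
      (Continuous.prodMk_left b).tendsto a
    exact this.eventually hmin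
  have hminb : IsLocalMin (fun x => ‖f x - f a‖ ^ 2) b := by
    have : Tendsto (fun x : N => (a, x)) (𝓝 b) (𝓝 (a, b)) :=
      (Continuous.prodMk_right a).tendsto b
    filter_upwards [this.eventually hmin] with x hx
    rw [norm_sub_rev (f x), norm_sub_rev (f b)]
    exact hx
  have ha := inner_dL_sub_eq_zero_of_isLocalExtr hf (Or.inl hmina)
  have hb : ∀ w, ⟪dL f b w, f a - f b⟫ = 0 := fun w => by
    rw [← neg_sub, inner_neg_right, inner_dL_sub_eq_zero_of_isLocalExtr hf (Or.inl hminb),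
      neg_zero]
  have hna := eq_smul_normalAt hf ha
  have hnb := eq_smul_normalAt hf hb
  refine ⟨?_, hna, hnb⟩
  set w := f a - f b with hw
  have hw0 : w ≠ 0 := sub_ne_zero.2 hab
  obtain ⟨B, hB⟩ := exists_eq_comp hw0 (injective_of_areaVec_ne_zero (hf.area b)) ha hb
  have hdet : B.det ≠ 0 := by
    intro h0
    apply hf.area a
    rw [hB, areaVec_comp, h0, zero_smul]
  set τ : E2 → E2 := fun z => ch b b + B (z - ch a a) with hτ
  have hτu : τ (ch a a) = ch b b := by simp [hτ]
  have hτd : HasFDerivAt τ B (ch a a) := by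
    have h1 : HasFDerivAt (fun z : E2 => z - ch a a) (ContinuousLinearMap.id ℝ E2) (ch a a) :=
      (hasFDerivAt_id _).sub_const _
    have h2 := (B.hasFDerivAt.comp (ch a a) h1).const_add (ch b b)
    rw [ContinuousLinearMap.comp_id] at h2
    exact h2
  have hτc : ContDiffAt ℝ ∞ τ (ch a a) :=
    (contDiff_const.add (B.contDiff.comp (contDiff_id.sub contDiff_const))).contDiffAt
  set φ := inChart f a with hφ
  set ψ := inChart f b ∘ τ with hψ
  have hφc : ContDiffAt ℝ ∞ φ (ch a a) := contDiffAt_inChart hf.smooth (mem_extChartAt_target a)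
  have hbc : ContDiffAt ℝ ∞ (inChart f b) (τ (ch a a)) := by
    rw [hτu]; exact contDiffAt_inChart hf.smooth (mem_extChartAt_target b)
  have hψc : ContDiffAt ℝ ∞ ψ (ch a a) := hbc.comp _ hτc
  have hψd : fderiv ℝ ψ (ch a a) = fderiv ℝ φ (ch a a) := by
    rw [hψ, fderiv_comp _ (hbc.differentiableAt (by simp)) hτd.differentiableAt, hτd.fderiv, hτu]
    exact hB.symm
  have hφa : φ (ch a a) = f a := inChart_ch f (mem_extChartAt_source a)
  have hψb : ψ (ch a a) = f b := by
    rw [hψ, Function.comp_apply, hτu]; exact inChart_ch f (mem_extChartAt_source b)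
  have hloc : IsLocalMin (fun z => ‖φ z - ψ z‖ ^ 2) (ch a a) := by
    have h1 : Tendsto (fun z => ((ch a).symm z, (ch b).symm (τ z))) (𝓝 (ch a a)) (𝓝 (a, b)) := by
      have s1 := (continuousAt_extChartAt_symm (I := 𝓡 2) a).tendsto
      have s2 := (continuousAt_extChartAt_symm (I := 𝓡 2) b).tendsto
      rw [extChartAt_to_inv] at s1 s2
      have s3 : Tendsto τ (𝓝 (ch a a)) (𝓝 (ch b b)) := by
        have := hτc.continuousAt.tendsto; rwa [hτu] at this
      exact s1.prodMk_nhds (s2.comp s3)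
    filter_upwards [h1.eventually hmin] with z hz
    rw [hφa, hψb]
    exact hz
  have key := inner_lapl_le hφc hψc (hf.area a) hψd (by rw [hφa, hψb]; exact hna) hloc
  rw [hφa, hψb, lapl_comp_smul hbc hτc (by rw [hτd.fderiv]; exact hdet)
    (by rw [hτu]; exact hf.area b) (by rw [hτu]; exact inChart_pos hf b _), hτu,
    ← posLapl_chart hf hv (mem_extChartAt_target b), ← posLapl_chart hf hv
    (mem_extChartAt_target a), extChartAt_to_inv, extChartAt_to_inv] at key
  exact key

/-- At a pair of closest points, the distance does not decrease too fast. -/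
theorem neg_le_inner_sub {f v : N → E3} (hf : IsSurface f) (hv : HasCurvatureVector f v) {a b : N}
    (hab : f a ≠ f b) (hmin : IsLocalMin (fun q : N × N => ‖f q.1 - f q.2‖ ^ 2) (a, b)) {C M : ℝ}
    (hC : ‖posLapl f v b‖ ≤ C) (hMa : f a 2 ≤ M) (hMb : f b 2 ≤ M) :
    -(M * C) * ‖f a - f b‖ ^ 2 ≤ ⟪f a - f b, v a - v b⟫ := by
  obtain ⟨hle, hna, hnb⟩ := inner_posLapl_le hf hv hab hmin
  set w := f a - f b with hw
  have hva : ∀ x, w = ⟪w, normalAt f x⟫ • normalAt f x →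
      ⟪w, v x⟫ = f x 2 ^ 2 / 2 * ⟪w, posLapl f v x⟫ + f x 2 * w 2 := by
    intro x hx
    have h2 : w 2 = ⟪w, normalAt f x⟫ * normalAt f x 2 := by
      conv_lhs => rw [hx]
      simp
    have hx2 := (hf.pos x).ne'
    rw [posLapl, inner_smul_right, inner_sub_right, inner_smul_right, h2]
    field_simp
    ring
  have hw2 : w 2 = f a 2 - f b 2 := by simp [hw]
  have hw2' : |w 2| ≤ ‖w‖ := by
    have := PiLp.norm_apply_le w (2 : Fin 3)
    simpa using this
  have hP : |⟪w, posLapl f v b⟫| ≤ ‖w‖ * C :=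
    (abs_real_inner_le_norm _ _).trans (mul_le_mul_of_nonneg_left hC (norm_nonneg _))
  have hpa := hf.pos a
  have hpb := hf.pos b
  rw [inner_sub_right, hva a hna, hva b hnb]
  -- The difference of the two flow equations, using w₂ = f(a)₂ - f(b)₂. The first two summands are
  -- nonnegative; the last is quadratic in |w| because w₂ is a factor.
  have e : f a 2 ^ 2 / 2 * ⟪w, posLapl f v a⟫ + f a 2 * w 2 -
      (f b 2 ^ 2 / 2 * ⟪w, posLapl f v b⟫ + f b 2 * w 2) =
      f a 2 ^ 2 / 2 * (⟪w, posLapl f v a⟫ - ⟪w, posLapl f v b⟫) + w 2 ^ 2 +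
      (f a 2 + f b 2) / 2 * (w 2 * ⟪w, posLapl f v b⟫) := by rw [hw2]; ring
  have h1 : |w 2 * ⟪w, posLapl f v b⟫| ≤ ‖w‖ * (‖w‖ * C) := by
    rw [abs_mul]; exact mul_le_mul hw2' hP (abs_nonneg _) (norm_nonneg _)
  have h2 : 0 ≤ f a 2 ^ 2 / 2 * (⟪w, posLapl f v a⟫ - ⟪w, posLapl f v b⟫) :=
    mul_nonneg (by positivity) (by linarith)
  have hC0 : 0 ≤ C := (norm_nonneg _).trans hC
  have h3 : -(M * (‖w‖ * (‖w‖ * C))) ≤ (f a 2 + f b 2) / 2 * (w 2 * ⟪w, posLapl f v b⟫) := by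
    have h4 : |(f a 2 + f b 2) / 2 * (w 2 * ⟪w, posLapl f v b⟫)| ≤ M * (‖w‖ * (‖w‖ * C)) := by
      rw [abs_mul, abs_of_pos (by positivity : 0 < (f a 2 + f b 2) / 2)]
      exact mul_le_mul (by linarith) h1 (abs_nonneg _) (by linarith)
    exact (abs_le.1 h4).1
  rw [e]
  nlinarith [sq_nonneg (w 2)]

end

/-! ### Embeddedness is preserved -/

theorem exists_le_norm_apply {L : E2 →L[ℝ] E3} (hL : areaVec L ≠ 0) :
    ∃ c > 0, ∀ w, c * ‖w‖ ≤ ‖L w‖ := by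
  have hker : (L : E2 →ₗ[ℝ] E3).ker = ⊥ := LinearMap.ker_eq_bot.2 (injective_of_areaVec_ne_zero hL)
  obtain ⟨K, hK, hanti⟩ := LinearMap.exists_antilipschitzWith (L : E2 →ₗ[ℝ] E3) hker
  have hK' : (0 : ℝ) < K := hK
  refine ⟨(K : ℝ)⁻¹, inv_pos.2 hK', fun w => ?_⟩
  have := hanti.le_mul_dist w 0
  simp only [map_zero, dist_zero_right] at this
  rw [inv_mul_le_iff₀ hK']
  exact this

section

variable {N : Type*} [TopologicalSpace N] [ChartedSpace E2 N] [IsManifold (𝓡 2) ∞ N]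
  {T : ℝ} {F : ℝ → N → E3}

/-- Mean value inequality on a chart ball where, for all times near `t₀`, the derivative is within
`ε` of the one at `x₀`. Being uniform in time and on the diagonal, it controls pairs of nearby
points, for which compactness alone gives nothing. -/
theorem IsMeanCurvatureFlow.eventually_norm_sub_le (hF : IsMeanCurvatureFlow T F) (t₀ : Ico 0 T)
    (x₀ : N) {ε : ℝ} (hε : 0 < ε) :
    ∀ᶠ q : Ico 0 T × (N × N) in 𝓝 (t₀, (x₀, x₀)),
      (q.2.1 ∈ (ch x₀).source ∧ q.2.2 ∈ (ch x₀).source) ∧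
      ‖F q.1 q.2.1 - F q.1 q.2.2 - dL (F t₀) x₀ (ch x₀ q.2.1 - ch x₀ q.2.2)‖ ≤
        ε * ‖ch x₀ q.2.1 - ch x₀ q.2.2‖ := by
  have hU := isOpen_extChartAt_target (I := 𝓡 2) x₀
  have h1 := (contDiffOn_fderiv_slice hU (hF.contDiffOn x₀)).continuousOn
  have h2 : ContinuousWithinAt (fun q : ℝ × E2 => fderiv ℝ (inChart (F q.1) x₀) q.2)
      (Ico 0 T ×ˢ (ch x₀).target) ((t₀ : ℝ), ch x₀ x₀) := h1 _ ⟨t₀.2, mem_extChartAt_target x₀⟩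
  have h3 := h2.eventually (Metric.ball_mem_nhds _ hε)
  rw [nhdsWithin_prod_eq, hU.nhdsWithin_eq (mem_extChartAt_target x₀)] at h3
  obtain ⟨I, hI, O, hO, hsub⟩ := mem_prod_iff.1 h3
  obtain ⟨δ, hδ, hδO⟩ := Metric.nhds_basis_ball.mem_iff.1
    (inter_mem hO (extChartAt_target_mem_nhds (I := 𝓡 2) x₀))
  have e1 : ∀ᶠ q : Ico 0 T × (N × N) in 𝓝 (t₀, (x₀, x₀)), (q.1 : ℝ) ∈ I := by
    have : Tendsto (fun q : Ico 0 T × (N × N) => (q.1 : ℝ)) (𝓝 (t₀, (x₀, x₀)))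
        (𝓝[Ico 0 T] (t₀ : ℝ)) := by
      refine tendsto_nhdsWithin_iff.2 ⟨?_, Eventually.of_forall fun q => q.1.2⟩
      exact (continuous_subtype_val.comp continuous_fst).tendsto _
    exact this.eventually hI
  have e2 : ∀ᶠ x in 𝓝 x₀, x ∈ (ch x₀).source ∧ ch x₀ x ∈ Metric.ball (ch x₀ x₀) δ :=
    (show ∀ᶠ x in 𝓝 x₀, x ∈ (ch x₀).source from extChartAt_source_mem_nhds (I := 𝓡 2) x₀).and
      ((continuousAt_extChartAt (I := 𝓡 2) x₀).eventually (Metric.ball_mem_nhds _ hδ))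
  have c1 : Tendsto (fun q : Ico 0 T × (N × N) => q.2.1) (𝓝 (t₀, (x₀, x₀))) (𝓝 x₀) :=
    (continuous_fst.comp continuous_snd).tendsto _
  have c2 : Tendsto (fun q : Ico 0 T × (N × N) => q.2.2) (𝓝 (t₀, (x₀, x₀))) (𝓝 x₀) :=
    (continuous_snd.comp continuous_snd).tendsto _
  filter_upwards [e1, c1.eventually e2, c2.eventually e2] with q hq ha hb
  refine ⟨⟨ha.1, hb.1⟩, ?_⟩
  have hS := hF.isSurface q.1.2
  have hmv := Convex.norm_image_sub_le_of_norm_fderiv_le' (𝕜 := ℝ) (f := inChart (F q.1) x₀)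
    (φ := dL (F t₀) x₀) (C := ε) (s := Metric.ball (ch x₀ x₀) δ) (x := ch x₀ q.2.2)
    (y := ch x₀ q.2.1)
    (fun u hu => (contDiffAt_inChart hS.smooth (hδO hu).2).differentiableAt (by simp))
    (fun u hu => by
      have h4 := hsub (mk_mem_prod hq (hδO hu).1)
      have h5 : dist (fderiv ℝ (inChart (F q.1) x₀) u) (dL (F t₀) x₀) < ε := h4
      rw [dist_eq_norm] at h5
      exact h5.le)
    (convex_ball _ _) hb.2 ha.2
  rw [inChart_ch _ ha.1, inChart_ch _ hb.1] at hmv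
  exact hmv

theorem IsMeanCurvatureFlow.eventually_eq_of_eq (hF : IsMeanCurvatureFlow T F) (t₀ : Ico 0 T)
    (x₀ : N) : ∀ᶠ q : Ico 0 T × (N × N) in 𝓝 (t₀, (x₀, x₀)),
      F q.1 q.2.1 = F q.1 q.2.2 → q.2.1 = q.2.2 := by
  obtain ⟨c, hc, hcL⟩ := exists_le_norm_apply ((hF.isSurface t₀.2).area x₀)
  filter_upwards [hF.eventually_norm_sub_le t₀ x₀ (half_pos hc)] with q ⟨⟨ha, hb⟩, hq⟩ heq
  rw [heq, sub_self, zero_sub, norm_neg] at hq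
  have h1 := hcL (ch x₀ q.2.1 - ch x₀ q.2.2)
  have h2 : ‖ch x₀ q.2.1 - ch x₀ q.2.2‖ = 0 := by
    nlinarith [norm_nonneg (ch x₀ q.2.1 - ch x₀ q.2.2)]
  exact (ch x₀).injOn ha hb (sub_eq_zero.1 (norm_eq_zero.1 h2))

theorem IsMeanCurvatureFlow.eventually_displacement_le (hF : IsMeanCurvatureFlow T F)
    (t₀ : Ico 0 T) (x₀ : N) {ε : ℝ} (hε : 0 < ε) :
    ∀ᶠ q : Ico 0 T × (N × N) in 𝓝 (t₀, (x₀, x₀)),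
      ‖(F q.1 q.2.1 - F q.1 q.2.2) - (F t₀ q.2.1 - F t₀ q.2.2)‖ ≤
        ε * ‖F t₀ q.2.1 - F t₀ q.2.2‖ := by
  obtain ⟨c, hc, hcL⟩ := exists_le_norm_apply ((hF.isSurface t₀.2).area x₀)
  -- The first bound is used twice and leaves an error of ε·c/2; the second keeps half of the lower
  -- bound c on the linear part. Together they give the factor ε.
  have hε' : 0 < min (ε * c / 4) (c / 2) := lt_min (by positivity) (by positivity)
  have h1 := hF.eventually_norm_sub_le t₀ x₀ hε'
  have hm : Tendsto (fun q : Ico 0 T × (N × N) => (t₀, q.2)) (𝓝 (t₀, (x₀, x₀)))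
      (𝓝 (t₀, (x₀, x₀))) := ((continuous_const.prodMk continuous_snd).tendsto _)
  filter_upwards [h1, hm.eventually h1] with q ⟨_, hq⟩ ⟨_, hq0⟩
  set ξ := ch x₀ q.2.1 - ch x₀ q.2.2
  set L := dL (F t₀) x₀
  have hL := hcL ξ
  have hn := norm_nonneg ξ
  have m1 : min (ε * c / 4) (c / 2) * ‖ξ‖ ≤ ε * c / 4 * ‖ξ‖ :=
    mul_le_mul_of_nonneg_right (min_le_left _ _) hn
  have m2 : min (ε * c / 4) (c / 2) * ‖ξ‖ ≤ c / 2 * ‖ξ‖ :=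
    mul_le_mul_of_nonneg_right (min_le_right _ _) hn
  have h3 : ‖(F q.1 q.2.1 - F q.1 q.2.2) - (F t₀ q.2.1 - F t₀ q.2.2)‖ ≤ ε * c / 2 * ‖ξ‖ := by
    have e : (F q.1 q.2.1 - F q.1 q.2.2) - (F t₀ q.2.1 - F t₀ q.2.2) =
        (F q.1 q.2.1 - F q.1 q.2.2 - L ξ) - (F t₀ q.2.1 - F t₀ q.2.2 - L ξ) := by abel
    rw [e]
    refine (norm_sub_le _ _).trans ?_
    linarith
  have h4 : c / 2 * ‖ξ‖ ≤ ‖F t₀ q.2.1 - F t₀ q.2.2‖ := by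
    have e : L ξ = (F t₀ q.2.1 - F t₀ q.2.2) - (F t₀ q.2.1 - F t₀ q.2.2 - L ξ) := by abel
    have h5 : ‖L ξ‖ ≤ ‖F t₀ q.2.1 - F t₀ q.2.2‖ + ‖F t₀ q.2.1 - F t₀ q.2.2 - L ξ‖ := by
      conv_lhs => rw [e]
      exact norm_sub_le _ _
    linarith
  calc _ ≤ ε * c / 2 * ‖ξ‖ := h3
    _ = ε * (c / 2 * ‖ξ‖) := by ring
    _ ≤ _ := by gcongr

theorem IsMeanCurvatureFlow.hasDerivWithinAt_vel (hF : IsMeanCurvatureFlow T F) {t : ℝ}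
    (ht : t ∈ Ico 0 T) (x : N) :
    HasDerivWithinAt (fun s => F s x) (vel T F t x) (Ico 0 T) t := by
  have h := hF.vel_inChart ht (mem_extChartAt_target (I := 𝓡 2) x)
  have hv : ∀ s, inChart (F s) x (ch x x) = F s x := fun s =>
    inChart_ch (F s) (mem_extChartAt_source x)
  simp only [hv] at h
  exact h.differentiableWithinAt.hasDerivWithinAt

variable [CompactSpace N]

/-- The displacement between nearby times has small Lipschitz constant on an embedded surface. -/
theorem IsMeanCurvatureFlow.eventually_forall_displacement_le (hF : IsMeanCurvatureFlow T F)
    (t₀ : Ico 0 T) (hinj : Function.Injective (F t₀)) {ε : ℝ} (hε : 0 < ε) :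
    ∀ᶠ t : Ico 0 T in 𝓝 t₀, ∀ a b, ‖(F t a - F t b) - (F t₀ a - F t₀ b)‖ ≤
        ε * ‖F t₀ a - F t₀ b‖ := by
  have key := IsCompact.eventually_forall_of_forall_eventually (x₀ := t₀)
    (isCompact_univ (X := N × N)) (P := fun (t : Ico 0 T) (k : N × N) =>
      ‖(F t k.1 - F t k.2) - (F t₀ k.1 - F t₀ k.2)‖ ≤ ε * ‖F t₀ k.1 - F t₀ k.2‖) ?_
  · filter_upwards [key] with t ht a b using ht (a, b) (mem_univ _)
  rintro ⟨a, b⟩ -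
  -- Off the diagonal the right-hand side is positive at `t₀` by injectivity and continuity
  -- suffices; on the diagonal both sides vanish and the derivative estimate is needed.
  by_cases hab : a = b
  · subst hab; exact hF.eventually_displacement_le t₀ a hε
  · have hc := hF.continuous_uncurry
    have c1 : Continuous fun q : Ico 0 T × (N × N) => F q.1 q.2.1 :=
      hc.comp (continuous_fst.prodMk (continuous_fst.comp continuous_snd))
    have c2 : Continuous fun q : Ico 0 T × (N × N) => F q.1 q.2.2 :=
      hc.comp (continuous_fst.prodMk (continuous_snd.comp continuous_snd))
    have hm : Continuous fun q : Ico 0 T × (N × N) => (t₀, q.2) :=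
      continuous_const.prodMk continuous_snd
    have c3 := c1.comp hm
    have c4 := c2.comp hm
    have cl : Continuous fun q : Ico 0 T × (N × N) =>
      ‖(F q.1 q.2.1 - F q.1 q.2.2) - (F t₀ q.2.1 - F t₀ q.2.2)‖ :=
      ((c1.sub c2).sub (c3.sub c4)).norm
    have cr : Continuous fun q : Ico 0 T × (N × N) => ε * ‖F t₀ q.2.1 - F t₀ q.2.2‖ :=
      (c3.sub c4).norm.const_mul ε
    have hlt : (fun q : Ico 0 T × (N × N) =>
        ‖(F q.1 q.2.1 - F q.1 q.2.2) - (F t₀ q.2.1 - F t₀ q.2.2)‖) (t₀, (a, b)) <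
        (fun q : Ico 0 T × (N × N) => ε * ‖F t₀ q.2.1 - F t₀ q.2.2‖) (t₀, (a, b)) := by
      simp only [sub_self, norm_zero]
      exact mul_pos hε (norm_pos_iff.2 (sub_ne_zero.2 fun h => hab (hinj h)))
    filter_upwards [cl.continuousAt.eventually_lt cr.continuousAt hlt] with q hq using hq.le

omit [IsManifold (𝓡 2) ∞ N] [CompactSpace N] in
theorem norm_posLapl_le {f v : N → E3} (hf : IsSurface f) (x : N) :
    ‖posLapl f v x‖ ≤ 2 / f x 2 ^ 2 * (‖v x‖ + f x 2) := by
  have hx := hf.pos x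
  rw [posLapl, norm_smul, Real.norm_of_nonneg (by positivity)]
  gcongr
  refine (norm_sub_le _ _).trans ?_
  gcongr
  have h1 : |normalAt f x 2| ≤ 1 := by
    have := PiLp.norm_apply_le (normalAt f x) (2 : Fin 3)
    rw [norm_normalAt hf x] at this
    simpa using this
  rw [norm_smul, norm_normalAt hf x, mul_one, Real.norm_eq_abs, abs_mul, abs_of_pos hx]
  exact mul_le_of_le_one_right hx.le h1

variable [T2Space N]

/-- Two-point maximum principle for the squared distance weighted by exp(Λt). Pairs near the
diagonal never collide, by local injectivity uniform in time. A first time at which the weighted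
distance reaches a low level away from the diagonal would give a closest pair where it is
increasing, which is impossible. -/
theorem IsMeanCurvatureFlow.injective (hF : IsMeanCurvatureFlow T F)
    (h0 : Function.Injective (F 0)) {t₁ : ℝ} (ht₁ : t₁ ∈ Ico 0 T) : Function.Injective (F t₁) := by
  intro a₁ b₁ hab₁
  by_contra hne₁
  have hJ : ∀ s ∈ Icc 0 t₁, s ∈ Ico 0 T := fun s hs => ⟨hs.1, hs.2.trans_lt ht₁.2⟩
  have hι : Continuous fun s : Icc 0 t₁ => (⟨s, hJ s s.2⟩ : Ico 0 T) := by fun_prop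
  have hc : Continuous fun q : Icc 0 t₁ × N => F q.1 q.2 :=
    hF.continuous_uncurry.comp ((hι.comp continuous_fst).prodMk continuous_snd)
  have hcv : Continuous fun q : Icc 0 t₁ × N => vel T F q.1 q.2 :=
    hF.continuous_vel.comp ((hι.comp continuous_fst).prodMk continuous_snd)
  have hc2 : Continuous fun q : Icc 0 t₁ × N => F q.1 q.2 2 :=
    (EuclideanSpace.proj (𝕜 := ℝ) (2 : Fin 3)).continuous.comp hc
  have hpos : ∀ q : Icc 0 t₁ × N, 0 < F q.1 q.2 2 := fun q => (hF.isSurface (hJ _ q.1.2)).pos _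
  -- a neighbourhood of the diagonal without self-intersections
  have hdiag : ∀ x : N, ∀ᶠ k : N × N in 𝓝 (x, x), ∀ s ∈ (univ : Set (Icc 0 t₁)),
      F s k.1 = F s k.2 → k.1 = k.2 := by
    intro x
    refine IsCompact.eventually_forall_of_forall_eventually isCompact_univ fun s _ => ?_
    have ht : Tendsto (fun z : (N × N) × Icc 0 t₁ => ((⟨z.2, hJ _ z.2.2⟩ : Ico 0 T), z.1))
        (𝓝 ((x, x), s)) (𝓝 (⟨s, hJ s s.2⟩, (x, x))) :=
      ((hι.comp continuous_snd).prodMk continuous_fst).tendsto _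
    exact ht.eventually (hF.eventually_eq_of_eq ⟨s, hJ s s.2⟩ x)
  set U : Set (N × N) := interior {k | ∀ s ∈ (univ : Set (Icc 0 t₁)), F s k.1 = F s k.2 →
    k.1 = k.2} with hU
  have hDU : diagonal N ⊆ U := by
    rintro ⟨x, y⟩ hxy
    obtain rfl : x = y := hxy
    exact mem_interior_iff_mem_nhds.2 (hdiag x)
  obtain ⟨O, hO, hDO, hOU⟩ := normal_exists_closure_subset isClosed_diagonal isOpen_interior hDU
  set G : Icc 0 t₁ × (N × N) → ℝ := fun q => ‖F q.1 q.2.1 - F q.1 q.2.2‖ ^ 2 with hG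
  have hGc : Continuous G := by
    have c1 : Continuous fun q : Icc 0 t₁ × (N × N) => F q.1 q.2.1 :=
      hc.comp (continuous_fst.prodMk (continuous_fst.comp continuous_snd))
    have c2 : Continuous fun q : Icc 0 t₁ × (N × N) => F q.1 q.2.2 :=
      hc.comp (continuous_fst.prodMk (continuous_snd.comp continuous_snd))
    exact (c1.sub c2).norm.pow 2
  have hz : (0 : ℝ) ∈ Icc 0 t₁ := ⟨le_rfl, ht₁.1⟩
  obtain ⟨c, hc0, hcB⟩ := IsCompact.exists_forall_le' (a := (0 : ℝ))
    (s := (univ : Set (Icc 0 t₁)) ×ˢ (closure O \ O))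
    (isCompact_univ.prod (isClosed_closure.sdiff hO).isCompact) hGc.continuousOn (by
      rintro ⟨s, k⟩ ⟨_, hk⟩
      have hk' : k.1 ≠ k.2 := fun h => hk.2 (hDO h)
      have h2 := interior_subset (hOU hk.1) s (mem_univ s)
      exact pow_pos (norm_pos_iff.2 (sub_ne_zero.2 fun h => hk' (h2 h))) 2)
  obtain ⟨d, hd0, hdK⟩ := IsCompact.exists_forall_le' (a := (0 : ℝ))
    (s := ({⟨0, hz⟩} : Set (Icc 0 t₁)) ×ˢ Oᶜ)
    (isCompact_singleton.prod hO.isClosed_compl.isCompact) hGc.continuousOn (by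
      rintro ⟨s, k⟩ ⟨hs, hk⟩
      have hk' : k.1 ≠ k.2 := fun h => hk (hDO h)
      obtain rfl : s = ⟨0, hz⟩ := hs
      exact pow_pos (norm_pos_iff.2 (sub_ne_zero.2 fun h => hk' (h0 h))) 2)
  -- bounds for the coefficients
  have hbc : Continuous fun q : Icc 0 t₁ × N => 2 / F q.1 q.2 2 ^ 2 * (‖vel T F q.1 q.2‖ + F q.1 q.2 2) :=
    (continuous_const.div (hc2.pow 2) fun q => pow_ne_zero 2 (hpos q).ne').mul (hcv.norm.add hc2)
  obtain ⟨C, hC⟩ := (isCompact_univ.image hbc).bddAbove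
  obtain ⟨M, hM⟩ := (isCompact_univ.image hc2).bddAbove
  have hC' : ∀ q : Icc 0 t₁ × N, ‖posLapl (F q.1) (vel T F q.1) q.2‖ ≤ C := fun q =>
    (norm_posLapl_le (hF.isSurface (hJ _ q.1.2)) _).trans (hC ⟨q, mem_univ _, rfl⟩)
  have hM' : ∀ q : Icc 0 t₁ × N, F q.1 q.2 2 ≤ M := fun q => hM ⟨q, mem_univ _, rfl⟩
  have hC0 : 0 ≤ C := (norm_nonneg _).trans (hC' (⟨0, hz⟩, a₁))
  have hM0 : 0 ≤ M := (hpos (⟨0, hz⟩, a₁)).le.trans (hM' _)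
  -- Strictly larger than the rate 2MC at which the squared distance of a closest pair can decay.
  set Λ := 2 * (M * C) + 1 with hΛ
  have hΛ0 : 0 < Λ := by positivity
  -- Strictly below both the minimum over the collar of the diagonal and the initial minimum off its
  -- neighbourhood. The level is therefore reached only at a positive time and only at an interior
  -- pair.
  set m := min c d / 2 with hm
  have hm0 : 0 < m := half_pos (lt_min hc0 hd0)
  have hmc : m < c := (half_lt_self (lt_min hc0 hd0)).trans_le (min_le_left _ _)
  have hmd : m < d := (half_lt_self (lt_min hc0 hd0)).trans_le (min_le_right _ _)
  set g : Icc 0 t₁ × (N × N) → ℝ := fun q => Real.exp (Λ * q.1) * G q with hg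
  have hgc : Continuous g := by
    have : Continuous fun q : Icc 0 t₁ × (N × N) => Real.exp (Λ * q.1) := by fun_prop
    exact this.mul hGc
  set S : Set (Icc 0 t₁ × (N × N)) := {q | q.2 ∈ Oᶜ ∧ g q ≤ m} with hS
  have hScl : IsClosed S :=
    (hO.isClosed_compl.preimage continuous_snd).inter (isClosed_le hgc continuous_const)
  have hSne : S.Nonempty := by
    refine ⟨(⟨t₁, ht₁.1, le_rfl⟩, (a₁, b₁)), fun h => ?_, ?_⟩
    · exact hne₁ (interior_subset (hOU (subset_closure h)) ⟨t₁, ht₁.1, le_rfl⟩ (mem_univ _) hab₁)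
    · simp only [hg, hG, hab₁, sub_self, norm_zero]
      simp [hm0.le]
  obtain ⟨⟨⟨τ, hτ⟩, a, b⟩, hqS, hmin⟩ := hScl.isCompact.exists_isMinOn hSne
    (f := fun q => (q.1 : ℝ)) (by fun_prop)
  have hmin' : ∀ (s : ℝ) (hs : s ∈ Icc 0 t₁), s < τ → ∀ k ∈ Oᶜ, m < g (⟨s, hs⟩, k) := by
    intro s hs hsτ k hk
    by_contra hcon
    have : τ ≤ s := hmin (show ((⟨s, hs⟩, k) : Icc 0 t₁ × (N × N)) ∈ S from ⟨hk, not_lt.1 hcon⟩)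
    linarith
  have hτ0 : 0 < τ := by
    rcases hτ.1.eq_or_lt with h | h
    · exfalso
      have h1 := hqS.2
      have h2 := hdK (⟨0, hz⟩, (a, b)) ⟨rfl, hqS.1⟩
      have h3 : g (⟨τ, hτ⟩, (a, b)) = G (⟨0, hz⟩, (a, b)) := by
        subst h; simp [hg]
      rw [h3] at h1
      linarith
    · exact h
  have hτT : τ ∈ Ioo 0 T := ⟨hτ0, hτ.2.trans_lt ht₁.2⟩
  -- Before the first time τ all pairs off `O` lie strictly above the level; by continuity they are
  -- not below it at τ.
  have hge : ∀ k ∈ Oᶜ, m ≤ g (⟨τ, hτ⟩, k) := by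
    intro k hk
    have hcont : ContinuousOn (fun s => Real.exp (Λ * s) * ‖F s k.1 - F s k.2‖ ^ 2) (Icc 0 t₁) := by
      rw [continuousOn_iff_continuous_domRestrict]
      exact hgc.comp (continuous_id.prodMk continuous_const)
    have ht : Tendsto (fun s => Real.exp (Λ * s) * ‖F s k.1 - F s k.2‖ ^ 2) (𝓝[Ico 0 τ] τ)
        (𝓝 (g (⟨τ, hτ⟩, k))) :=
      (hcont τ hτ).mono_left (nhdsWithin_mono _ fun s hs => ⟨hs.1, hs.2.le.trans hτ.2⟩)
    have hne : (𝓝[Ico 0 τ] τ).NeBot := by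
      rw [nhdsWithin_Ico_eq_nhdsLT hτ0]; infer_instance
    refine ge_of_tendsto ht ?_
    filter_upwards [self_mem_nhdsWithin] with s hs
    exact (hmin' s ⟨hs.1, hs.2.le.trans hτ.2⟩ hs.2 k hk).le
  have hgm : g (⟨τ, hτ⟩, (a, b)) = m := le_antisymm hqS.2 (hge _ hqS.1)
  have hab : F τ a ≠ F τ b := by
    intro h
    have : g (⟨τ, hτ⟩, (a, b)) = 0 := by simp [hg, hG, h]
    linarith
  have hexp : 1 ≤ Real.exp (Λ * τ) := Real.one_le_exp (by positivity)
  -- On the collar `closure O \ O` the distance function is at least c > m, whereas here it is at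
  -- most the weighted value m. Hence the minimum is unconstrained.
  have hnotin : (a, b) ∉ closure O := by
    intro h
    have h1 := hcB (⟨τ, hτ⟩, (a, b)) ⟨mem_univ _, h, hqS.1⟩
    have h2 : G (⟨τ, hτ⟩, (a, b)) ≤ g (⟨τ, hτ⟩, (a, b)) := le_mul_of_one_le_left (by positivity) hexp
    linarith
  have hloc : IsLocalMin (fun q : N × N => ‖F τ q.1 - F τ q.2‖ ^ 2) (a, b) := by
    filter_upwards [isClosed_closure.isOpen_compl.mem_nhds hnotin] with k hk
    have h1 := hge k fun h => hk (subset_closure h)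
    rw [← hgm] at h1
    exact le_of_mul_le_mul_left h1 (by positivity)
  have hτ' : τ ∈ Ico 0 T := ⟨hτ.1, hτT.2⟩
  have key := neg_le_inner_sub (hF.isSurface hτ') (hF.hasCurvatureVector hτ') hab hloc
    (hC' (⟨τ, hτ⟩, b)) (hM' (⟨τ, hτ⟩, a)) (hM' (⟨τ, hτ⟩, b))
  have hIco : Ico 0 T ∈ 𝓝 τ := mem_of_superset (isOpen_Ioo.mem_nhds hτT) Ioo_subset_Ico_self
  have hda := (hF.hasDerivWithinAt_vel hτ' a).hasDerivAt hIco
  have hdb := (hF.hasDerivWithinAt_vel hτ' b).hasDerivAt hIco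
  have hdw := (hda.sub hdb).norm_sq
  have hde : HasDerivAt (fun s => Real.exp (Λ * s)) (Real.exp (Λ * τ) * (Λ * 1)) τ :=
    ((hasDerivAt_id τ).const_mul Λ).exp
  have hdg := hde.mul hdw
  set w := F τ a - F τ b with hw
  have hwpos : 0 < ‖w‖ ^ 2 := pow_pos (norm_pos_iff.2 (sub_ne_zero.2 hab)) 2
  have hD : 0 < Real.exp (Λ * τ) * (Λ * 1) * ‖w‖ ^ 2 +
      Real.exp (Λ * τ) * (2 * ⟪w, vel T F τ a - vel T F τ b⟫) := by
    have : 0 < Λ * ‖w‖ ^ 2 + 2 * ⟪w, vel T F τ a - vel T F τ b⟫ := by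
      rw [hΛ]; nlinarith
    have := mul_pos (Real.exp_pos (Λ * τ)) this
    linarith
  -- A positive derivative at τ forces smaller values just before τ, against the choice of τ as the
  -- first time.
  have hslope := (hasDerivAt_iff_tendsto_slope.1 hdg).eventually (lt_mem_nhds hD)
  have hslope' := hslope.filter_mono (nhdsLT_le_nhdsNE τ)
  have hIoo : ∀ᶠ s in 𝓝[<] τ, s ∈ Ioo 0 τ := Ioo_mem_nhdsLT hτ0
  obtain ⟨s, hs1, hs2⟩ := (hslope'.and hIoo).exists
  have h1 := hmin' s ⟨hs2.1.le, hs2.2.le.trans hτ.2⟩ hs2.2 _ hqS.1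
  rw [← hgm] at h1
  rw [slope_def_field] at hs1
  have h2 : 0 < Real.exp (Λ * s) * ‖F s a - F s b‖ ^ 2 -
    Real.exp (Λ * τ) * ‖F τ a - F τ b‖ ^ 2 := sub_pos.2 h1
  have h3 := div_neg_of_pos_of_neg h2 (sub_neg.2 hs2.2)
  exact absurd hs1 (not_lt.2 h3.le)

end

/-! ### The enclosed domain -/

/-- Adding limit points inside `A` keeps a component connected: components are relatively closed. -/
theorem closure_connectedComponentIn_inter_subset {X : Type*} [TopologicalSpace X] {A : Set X}
    {x : X} (hx : x ∈ A) : closure (connectedComponentIn A x) ∩ A ⊆ connectedComponentIn A x := by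
  refine IsPreconnected.subset_connectedComponentIn (?_ : IsPreconnected _)
    ⟨subset_closure (mem_connectedComponentIn hx), hx⟩ inter_subset_right
  exact isPreconnected_connectedComponentIn.subset_closure
    (fun y hy => ⟨subset_closure hy, connectedComponentIn_subset _ _ hy⟩) inter_subset_left

theorem isOpen_H3 : IsOpen H3 :=
  isOpen_lt continuous_const (EuclideanSpace.proj (𝕜 := ℝ) (2 : Fin 3)).continuous

theorem hdist_nonneg (x y : E3) : 0 ≤ hdist x y := by
  rw [hdist]
  have : 0 ≤ Real.arsinh (dist x y / (2 * √(x 2 * y 2))) :=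
    Real.arsinh_nonneg_iff.2 (by positivity)
  positivity

/-- A geodesic sphere is a Euclidean sphere with known centre and radius. The second estimate keeps
bounded hyperbolic sets away from the boundary plane. -/
theorem hdist_ball_bounds {x y : E3} (hx : x ∈ H3) (hy : y ∈ H3) {R : ℝ} (h : hdist x y ≤ R) :
    ‖y - x‖ ≤ x 2 * Real.sinh R + x 2 * (Real.cosh R - 1) ∧ x 2 * Real.exp (-R) ≤ y 2 := by
  have hx2 : 0 < x 2 := hx
  have hy2 : 0 < y 2 := hy
  set ρ := hdist x y with hρ
  have hR : 0 ≤ R := (hdist_nonneg x y).trans h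
  rcases (hdist_nonneg x y).eq_or_lt with h0 | h0
  · have h1 : dist x y = 0 := by
      rw [hdist] at h0
      have h2 : Real.arsinh (dist x y / (2 * √(x 2 * y 2))) = 0 := by linarith
      rw [Real.arsinh_eq_zero_iff] at h2
      have h3 : 0 < 2 * √(x 2 * y 2) := by positivity
      exact (div_eq_zero_iff.1 h2).resolve_right h3.ne'
    obtain rfl := dist_eq_zero.1 h1
    refine ⟨?_, ?_⟩
    · have := Real.one_le_cosh R
      have := Real.sinh_nonneg_iff.2 hR
      rw [sub_self, norm_zero]
      have : 0 ≤ Real.cosh R - 1 := by linarith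
      positivity
    · exact mul_le_of_le_one_right hx2.le (Real.exp_le_one_iff.2 (by linarith))
  · have hmem : y ∈ geodesicSphere x ρ := ⟨hy, rfl⟩
    rw [geodesicSphere_eq hx h0, mem_sphere_iff_norm] at hmem
    have hsR : Real.sinh ρ ≤ Real.sinh R := Real.sinh_le_sinh.2 h
    have hcR : Real.cosh ρ ≤ Real.cosh R :=
      Real.cosh_le_cosh.2 (by rw [abs_of_pos h0, abs_of_nonneg hR]; exact h)
    have hc1 := Real.one_le_cosh ρ
    constructor
    · have h1 : y - x = (y - euclCentre x ρ) + (x 2 * (Real.cosh ρ - 1)) •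
          EuclideanSpace.single 2 (1 : ℝ) := by rw [euclCentre]; abel
      have h2 : 0 ≤ x 2 * (Real.cosh ρ - 1) := mul_nonneg hx2.le (by linarith)
      rw [h1]
      refine (norm_add_le _ _).trans ?_
      rw [hmem, norm_smul, Real.norm_of_nonneg h2]
      simp only [PiLp.norm_single, norm_one, mul_one]
      gcongr
    · have h1 : |(y - euclCentre x ρ) 2| ≤ x 2 * Real.sinh ρ := by
        rw [← hmem]
        have := PiLp.norm_apply_le (y - euclCentre x ρ) (2 : Fin 3)
        simpa using this
      rw [PiLp.sub_apply, euclCentre_two] at h1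
      have h2 := (abs_le.1 h1).1
      have h3 : Real.exp (-R) ≤ Real.exp (-ρ) := Real.exp_le_exp.2 (by linarith)
      have h4 := Real.cosh_sub_sinh ρ
      nlinarith

/-- The lowest point of the closure cannot be in the open component, where one could move further
down, so it belongs to `S`. -/
theorem le_coord_of_isBounded {S : Set E3} {s : ℝ} (hSc : IsClosed S) (hS : ∀ y ∈ S, s ≤ y 2)
    {x : E3} (hx : x ∉ S) (hb : Bornology.IsBounded (connectedComponentIn Sᶜ x)) :
    ∀ y ∈ closure (connectedComponentIn Sᶜ x), s ≤ y 2 := by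
  set D := connectedComponentIn Sᶜ x with hD
  have hDo : IsOpen D := hSc.isOpen_compl.connectedComponentIn
  have hxD : x ∈ D := mem_connectedComponentIn hx
  have hcont : Continuous fun y : E3 => y 2 := (EuclideanSpace.proj (𝕜 := ℝ) (2 : Fin 3)).continuous
  obtain ⟨y₀, hy₀, hmin⟩ := hb.isCompact_closure.exists_isMinOn ⟨x, subset_closure hxD⟩
    hcont.continuousOn
  have hnot : y₀ ∉ D := by
    intro h
    have h1 : Tendsto (fun ε : ℝ => y₀ - ε • EuclideanSpace.single (2 : Fin 3) (1 : ℝ))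
        (𝓝[>] 0) (𝓝 y₀) := by
      have : Continuous fun ε : ℝ => y₀ - ε • EuclideanSpace.single (2 : Fin 3) (1 : ℝ) := by
        fun_prop
      simpa using (this.tendsto 0).mono_left nhdsWithin_le_nhds
    obtain ⟨ε, hε, hε0⟩ := ((h1.eventually (hDo.mem_nhds h)).and self_mem_nhdsWithin).exists
    have h2 : y₀ 2 ≤ (y₀ - ε • EuclideanSpace.single (2 : Fin 3) (1 : ℝ)) 2 :=
      hmin (subset_closure hε)
    simp at h2
    have h3 : (0 : ℝ) < ε := hε0
    linarith
  have hyS : y₀ ∈ S := by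
    by_contra h
    exact hnot (closure_connectedComponentIn_inter_subset hx ⟨hy₀, h⟩)
  exact fun y hy => (hS _ hyS).trans (hmin hy)

theorem exists_pos_le_coord {S : Set E3} (hS : IsCompact S) (hSH : S ⊆ H3) :
    ∃ s > 0, ∀ y ∈ S, s ≤ y 2 := by
  obtain ⟨s, hs, h⟩ := hS.exists_forall_le' (a := (0 : ℝ)) (f := fun y : E3 => y 2)
    (EuclideanSpace.proj (𝕜 := ℝ) (2 : Fin 3)).continuous.continuousOn hSH
  exact ⟨s, hs, h⟩

/-- A point is enclosed by a compact set if and only if its component in the complement is bounded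
in the Euclidean sense. -/
theorem mem_enclosed_iff {S : Set E3} (hS : IsCompact S) (hSH : S ⊆ H3) {x : E3} (hx : x ∈ H3)
    (hxS : x ∉ S) : x ∈ enclosed S ↔ Bornology.IsBounded (connectedComponentIn Sᶜ x) := by
  have hx2 : 0 < x 2 := hx
  have hsub : H3 \ S ⊆ Sᶜ := fun y hy => hy.2
  set C := connectedComponentIn (H3 \ S) x with hC
  set D := connectedComponentIn Sᶜ x with hD
  have hCD : C ⊆ D := connectedComponentIn_mono x hsub
  have hxC : x ∈ C := mem_connectedComponentIn ⟨hx, hxS⟩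
  constructor
  · rintro ⟨_, R, hR⟩
    have hCH : C ⊆ H3 := fun y hy => (connectedComponentIn_subset _ _ hy).1
    have hlow : closure C ⊆ {y : E3 | x 2 * Real.exp (-R) ≤ y 2} :=
      closure_minimal (fun y hy => (hdist_ball_bounds hx (hCH hy) (hR y hy)).2)
        (isClosed_le continuous_const (EuclideanSpace.proj (𝕜 := ℝ) (2 : Fin 3)).continuous)
    -- The component taken in the half-space stays above a positive height, so it is relatively
    -- clopen in the full complement as well and the two components coincide.
    have hDC : D ⊆ C := by
      refine isPreconnected_connectedComponentIn.subset_of_closure_inter_subset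
        ((isOpen_H3.sdiff hS.isClosed).connectedComponentIn)
        ⟨x, mem_connectedComponentIn hxS, hxC⟩ ?_
      rintro y ⟨hy, hyD⟩
      refine closure_connectedComponentIn_inter_subset (A := H3 \ S) ⟨hx, hxS⟩ ⟨hy, ?_, ?_⟩
      · have h1 : x 2 * Real.exp (-R) ≤ y 2 := hlow hy
        exact lt_of_lt_of_le (by positivity) h1
      · exact connectedComponentIn_subset _ _ hyD
    refine (Metric.isBounded_iff_subset_closedBall x).2
      ⟨x 2 * Real.sinh R + x 2 * (Real.cosh R - 1), fun y hy => ?_⟩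
    rw [mem_closedBall_iff_norm]
    exact (hdist_ball_bounds hx (hCH (hDC hy)) (hR y (hDC hy))).1
  · intro hb
    obtain ⟨s, hs, hsS⟩ := exists_pos_le_coord hS hSH
    have hlow := le_coord_of_isBounded hS.isClosed hsS hxS hb
    refine ⟨⟨hx, hxS⟩, ?_⟩
    have hcont : ContinuousOn (hdist x) (closure D) := by
      have h2 : Continuous fun y : E3 => y 2 :=
        (EuclideanSpace.proj (𝕜 := ℝ) (2 : Fin 3)).continuous
      have h3 : ContinuousOn (fun y => dist x y / (2 * √(x 2 * y 2))) (closure D) := by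
        refine ContinuousOn.div (by fun_prop) (by fun_prop) fun y hy => ?_
        have : 0 < y 2 := hs.trans_le (hlow y hy)
        positivity
      unfold hdist
      exact (Real.continuous_arsinh.comp_continuousOn h3).const_mul 2
    obtain ⟨R, hR⟩ := (hb.isCompact_closure.image_of_continuousOn hcont).bddAbove
    exact ⟨R, fun y hy => hR ⟨y, subset_closure (hCD hy), rfl⟩⟩

/-- Boundedness of the component of a point is stable under maps that are close to the identity. -/
theorem isBounded_component_iff {S S' : Set E3} {x : E3} {r : ℝ} {g : E3 → E3}
    (hg : LipschitzWith (1 / 2) g) (himg : (fun z => z + g z) '' S = S')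
    (hxS : Disjoint (Metric.ball x r) S) (hxS' : Disjoint (Metric.ball x r) S') (hgx : ‖g x‖ < r) :
    Bornology.IsBounded (connectedComponentIn Sᶜ x) ↔
      Bornology.IsBounded (connectedComponentIn S'ᶜ x) := by
  have hr : 0 < r := (norm_nonneg _).trans_lt hgx
  set Ψ : E3 → E3 := fun z => z + g z with hΨ
  -- A perturbation of the identity by a map with Lipschitz constant 1/2 is a homeomorphism of the
  -- whole space, Lipschitz in both directions.
  have happ : ApproximatesLinearOn Ψ ((ContinuousLinearEquiv.refl ℝ E3 : E3 ≃L[ℝ] E3) : E3 →L[ℝ] E3)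
      univ (1 / 2) := by
    intro a _ b _
    have h1 : Ψ a - Ψ b - ((ContinuousLinearEquiv.refl ℝ E3 : E3 ≃L[ℝ] E3) : E3 →L[ℝ] E3) (a - b) =
        g a - g b := by
      simp [hΨ]
      abel
    rw [h1, ← dist_eq_norm, ← dist_eq_norm]
    exact hg.dist_le_mul a b
  have hc : Subsingleton E3 ∨ (1 / 2 : NNReal) <
      ‖((ContinuousLinearEquiv.refl ℝ E3).symm : E3 →L[ℝ] E3)‖₊⁻¹ := by
    right
    have : ‖((ContinuousLinearEquiv.refl ℝ E3).symm : E3 →L[ℝ] E3)‖₊ = 1 := by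
      rw [← NNReal.coe_inj]
      exact ContinuousLinearMap.norm_id
    rw [this, inv_one]
    exact NNReal.half_lt_self one_ne_zero
  set h : E3 ≃ₜ E3 := happ.toHomeomorph Ψ hc with hh
  have hhΨ : ⇑h = Ψ := rfl
  have hx : x ∈ Sᶜ := disjoint_left.1 hxS (Metric.mem_ball_self hr)
  have himgc : h '' Sᶜ = S'ᶜ := by rw [image_compl_eq h.bijective, hhΨ, himg]
  have hcomp := h.image_connectedComponentIn hx
  rw [himgc] at hcomp
  have hΨx : Ψ x ∈ Metric.ball x r := by
    rw [mem_ball_iff_norm]; simpa [hΨ] using hgx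
  -- The homeomorphism moves x, but only within a ball disjoint from `S'`, so the image component is
  -- still the one containing x.
  have hball : Metric.ball x r ⊆ connectedComponentIn S'ᶜ x :=
    (convex_ball x r).isPreconnected.subset_connectedComponentIn (Metric.mem_ball_self hr)
      (subset_compl_iff_disjoint_right.2 hxS')
  rw [connectedComponentIn_eq (hball hΨx), ← hhΨ, ← hcomp]
  have hlip : LipschitzWith (1 + 1 / 2) Ψ := LipschitzWith.id.add hg
  constructor
  · exact fun hb => hlip.isBounded_image hb
  · intro hb
    have hanti : AntilipschitzWith 2 Ψ := by
      refine AntilipschitzWith.of_le_mul_dist fun a b => ?_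
      have h1 := hg.dist_le_mul a b
      rw [dist_eq_norm, dist_eq_norm] at h1
      rw [dist_eq_norm, dist_eq_norm]
      have h2 : a - b = (Ψ a - Ψ b) - (g a - g b) := by simp only [hΨ]; abel
      have h3 : ‖a - b‖ ≤ ‖Ψ a - Ψ b‖ + ‖g a - g b‖ := by
        conv_lhs => rw [h2]
        exact norm_sub_le _ _
      simp at h1
      push_cast
      linarith
    exact (hanti.isBounded_preimage hb).subset (subset_preimage_image _ _)

theorem hvolume_mono {A B : Set E3} (h : A ⊆ B) : hvolume A ≤ hvolume B :=
  lintegral_mono_set h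

section

variable {N : Type*} [TopologicalSpace N] [ChartedSpace E2 N] [IsManifold (𝓡 2) ∞ N]
  {T : ℝ} {F : ℝ → N → E3} [CompactSpace N] [T2Space N] [Nonempty N]

omit [T2Space N] in
-- The displacement from time `t₀` to `t` is, as a function on the embedded surface, Lipschitz with
-- a small constant. Extended to all of space it yields an ambient homeomorphism close to the
-- identity, to which `isBounded_component_iff` applies.
theorem IsMeanCurvatureFlow.eventually_isBounded_iff (hF : IsMeanCurvatureFlow T F)
    (t₀ : Ico 0 T) (hinj : Function.Injective (F t₀)) {x : E3} (hx : x ∉ range (F t₀)) :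
    ∀ᶠ t : Ico 0 T in 𝓝 t₀, (Bornology.IsBounded (connectedComponentIn (range (F t))ᶜ x) ↔
      Bornology.IsBounded (connectedComponentIn (range (F t₀))ᶜ x)) := by
  have hcl : IsClosed (range (F t₀)) :=
    (isCompact_range (hF.isSurface t₀.2).smooth.continuous).isClosed
  obtain ⟨r, hr, hball⟩ := Metric.isOpen_iff.1 hcl.isOpen_compl x hx
  obtain ⟨a₀⟩ := ‹Nonempty N›
  set K : ℝ := ((lipschitzExtensionConstant E3 : NNReal) : ℝ) with hK
  have hK0 : 0 < K := lipschitzExtensionConstant_pos E3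
  set d := ‖x - F t₀ a₀‖ with hd
  have hd0 : 0 ≤ d := norm_nonneg _
  -- Extension multiplies Lipschitz constants by K. The first bound makes the extension
  -- 1/2-Lipschitz; the second keeps its value at x below r/2, with d + 1 in place of d to avoid a
  -- zero denominator.
  set ε : ℝ := min (1 / (2 * K)) (r / (4 * K * (d + 1))) with hε
  have hε0 : 0 < ε := lt_min (by positivity) (by positivity)
  have hdisp := hF.eventually_forall_displacement_le t₀ hinj hε0
  have hη : 0 < r / 4 := by positivity
  have hclose : ∀ᶠ t : Ico 0 T in 𝓝 t₀, ∀ a ∈ (univ : Set N), ‖F t a - F t₀ a‖ < r / 4 := by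
    refine isCompact_univ.eventually_forall_of_forall_eventually fun a _ => ?_
    have c1 : Continuous fun q : Ico 0 T × N => F q.1 q.2 := hF.continuous_uncurry
    have c2 : Continuous fun q : Ico 0 T × N => F t₀ q.2 :=
      (hF.isSurface t₀.2).smooth.continuous.comp continuous_snd
    have c3 : ContinuousAt (fun q : Ico 0 T × N => ‖F q.1 q.2 - F t₀ q.2‖) (t₀, a) :=
      (c1.sub c2).norm.continuousAt
    exact c3.eventually (gt_mem_nhds (by simpa using hη))
  filter_upwards [hdisp, hclose] with t ht htc
  set k : E3 → N := Function.invFun (F t₀) with hk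
  have hkF : ∀ a, k (F t₀ a) = a := Function.leftInverse_invFun hinj
  set f : E3 → E3 := fun z => F t (k z) - z with hf
  have hfF : ∀ a, f (F t₀ a) = F t a - F t₀ a := fun a => by simp only [hf, hkF]
  have hlip : LipschitzOnWith ⟨ε, hε0.le⟩ f (range (F t₀)) := by
    refine LipschitzOnWith.of_dist_le_mul ?_
    rintro _ ⟨a, rfl⟩ _ ⟨b, rfl⟩
    rw [hfF, hfF, dist_eq_norm, dist_eq_norm]
    have := ht a b
    have e : F t a - F t₀ a - (F t b - F t₀ b) = F t a - F t b - (F t₀ a - F t₀ b) := by abel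
    rw [e]
    exact this
  obtain ⟨g, hg, hgf⟩ := hlip.extend_finite_dimension
  have hKε : K * ε ≤ 1 / 2 := by
    calc K * ε ≤ K * (1 / (2 * K)) := by gcongr; exact min_le_left _ _
      _ = 1 / 2 := by field_simp
  have hg2 : LipschitzWith (1 / 2) g := by
    refine hg.weaken ?_
    rw [← NNReal.coe_le_coe]
    push_cast
    exact hKε
  have hgF : ∀ a, g (F t₀ a) = F t a - F t₀ a := fun a => by rw [← hgf ⟨a, rfl⟩, hfF]
  have himg : (fun z => z + g z) '' range (F t₀) = range (F t) := by
    rw [← range_comp]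
    congr 1
    funext a
    simp [hgF]
  have hgx : ‖g x‖ < r / 2 := by
    have h1 := hg.dist_le_mul x (F t₀ a₀)
    rw [dist_eq_norm, dist_eq_norm, hgF] at h1
    have h2 : K * ε * d ≤ r / 4 := by
      calc K * ε * d ≤ K * (r / (4 * K * (d + 1))) * d := by gcongr; exact min_le_right _ _
        _ = r / 4 * (d / (d + 1)) := by field_simp
        _ ≤ r / 4 * 1 := by
          gcongr
          exact (div_le_one (by positivity)).2 (by linarith)
        _ = r / 4 := mul_one _
    have h3 : ‖g x - (F t a₀ - F t₀ a₀)‖ ≤ K * ε * d := by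
      refine h1.trans (le_of_eq ?_)
      rfl
    have h4 := htc a₀ (mem_univ _)
    have h5 : g x = (g x - (F t a₀ - F t₀ a₀)) + (F t a₀ - F t₀ a₀) := by abel
    calc ‖g x‖ ≤ ‖g x - (F t a₀ - F t₀ a₀)‖ + ‖F t a₀ - F t₀ a₀‖ := by
          conv_lhs => rw [h5]
          exact norm_add_le _ _
      _ < r / 2 := by linarith
  refine (isBounded_component_iff (r := r / 2) hg2 himg ?_ ?_ hgx).symm
  · rw [disjoint_left]
    intro y hy
    exact hball (Metric.ball_subset_ball (by linarith) hy)
  · rw [disjoint_left]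
    rintro y hy ⟨a, rfl⟩
    rw [mem_ball_iff_norm] at hy
    have h1 := htc a (mem_univ _)
    have h2 : F t₀ a ∈ Metric.ball x r := by
      rw [mem_ball_iff_norm]
      have h3 : F t₀ a - x = (F t a - x) - (F t a - F t₀ a) := by abel
      rw [h3]
      exact (norm_sub_le _ _).trans_lt (by linarith)
    exact hball h2 ⟨a, rfl⟩

/-- For a point never hit during [0, t], boundedness of its complementary component is locally
constant in time, hence constant on the interval. -/
theorem IsMeanCurvatureFlow.enclosed_subset (hF : IsMeanCurvatureFlow T F)
    (h0 : Function.Injective (F 0)) {t : ℝ} (ht : t ∈ Ico 0 T) :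
    enclosed (range (F 0)) ⊆ enclosed (range (F t)) ∪ ⋃ s ∈ Icc 0 t, range (F s) := by
  intro x hx
  by_contra hcon
  rw [mem_union, not_or] at hcon
  obtain ⟨hxt, hxs⟩ := hcon
  have hJ : ∀ s ∈ Icc 0 t, s ∈ Ico 0 T := fun s hs => ⟨hs.1, hs.2.trans_lt ht.2⟩
  have hxs' : ∀ s ∈ Icc 0 t, x ∉ range (F s) := fun s hs h => hxs (mem_iUnion₂.2 ⟨s, hs, h⟩)
  have hz : (0 : ℝ) ∈ Icc 0 t := ⟨le_rfl, ht.1⟩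
  have ht' : t ∈ Icc 0 t := ⟨ht.1, le_rfl⟩
  have hxH : x ∈ H3 := hx.1.1
  have hcpt : ∀ s ∈ Icc 0 t, IsCompact (range (F s)) := fun s hs =>
    isCompact_range (hF.isSurface (hJ s hs)).smooth.continuous
  have hsub : ∀ s ∈ Icc 0 t, range (F s) ⊆ H3 := by
    rintro s hs _ ⟨a, rfl⟩
    exact hF.mem s (hJ s hs) a
  set B : Icc 0 t → Prop := fun s =>
    Bornology.IsBounded (connectedComponentIn (range (F s))ᶜ x) with hB
  have hloc : IsLocallyConstant B := by
    rw [IsLocallyConstant.iff_eventually_eq]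
    intro s
    have hι : Continuous fun s : Icc 0 t => (⟨s, hJ s s.2⟩ : Ico 0 T) := by fun_prop
    have h1 := hF.eventually_isBounded_iff ⟨s, hJ s s.2⟩ (hF.injective h0 (hJ s s.2)) (hxs' s s.2)
    filter_upwards [(hι.tendsto s).eventually h1] with τ hτ
    exact propext hτ
  have : PreconnectedSpace (Icc 0 t) := Subtype.preconnectedSpace isPreconnected_Icc
  have heq := hloc.apply_eq_of_preconnectedSpace ⟨0, hz⟩ ⟨t, ht'⟩
  have hb0 := (mem_enclosed_iff (hcpt 0 hz) (hsub 0 hz) hxH (hxs' 0 hz)).1 hx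
  have hbt : Bornology.IsBounded (connectedComponentIn (range (F t))ᶜ x) := heq.mp hb0
  exact hxt ((mem_enclosed_iff (hcpt t ht') (hsub t ht') hxH (hxs' t ht')).2 hbt)

theorem IsMeanCurvatureFlow.enclosedVolume_le (hF : IsMeanCurvatureFlow T F)
    (h0 : Function.Injective (F 0)) {t : ℝ} (ht : t ∈ Ico 0 T) :
    enclosedVolume (range (F 0)) ≤ enclosedVolume (range (F t)) +
      hvolume (⋃ s ∈ Icc 0 t, range (F s)) :=
  (hvolume_mono (hF.enclosed_subset h0 ht)).trans (lintegral_union_le _ _ _)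

end

/-! ### Volume swept out by a moving surface -/

theorem det_eq_inner_cross (L : E3 →L[ℝ] E3) :
    L.det = ⟪cross (L (EuclideanSpace.single 0 1)) (L (EuclideanSpace.single 1 1)),
      L (EuclideanSpace.single 2 1)⟫ := by
  rw [ContinuousLinearMap.det, ← LinearMap.det_toMatrix (EuclideanSpace.basisFun (Fin 3) ℝ).toBasis,
    Matrix.det_fin_three, inner_coord, cross_zero, cross_one, cross_two]
  simp only [LinearMap.toMatrix_apply, OrthonormalBasis.coe_toBasis_repr_apply,
    OrthonormalBasis.coe_toBasis, EuclideanSpace.basisFun_repr, EuclideanSpace.basisFun_apply,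
    ContinuousLinearMap.coe_coe]
  ring

/-- Splitting off the last coordinate. -/
def splitEquiv : E3 ≃ᵐ ℝ × E2 :=
  (MeasurableEquiv.toLp 2 (Fin 3 → ℝ)).symm.trans
    ((MeasurableEquiv.piFinSuccAbove (fun _ => ℝ) 2).trans
      (MeasurableEquiv.prodCongr (MeasurableEquiv.refl ℝ) (MeasurableEquiv.toLp 2 (Fin 2 → ℝ))))

theorem volume_preserving_splitEquiv : MeasurePreserving splitEquiv volume volume := by
  have h1 := PiLp.volume_preserving_ofLp (Fin 3)
  have h2 := volume_preserving_piFinSuccAbove (fun _ : Fin 3 => ℝ) 2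
  have h3 : MeasurePreserving (Prod.map (id : ℝ → ℝ) (WithLp.toLp 2 : (Fin 2 → ℝ) → E2))
      volume volume := (MeasurePreserving.id volume).prod (PiLp.volume_preserving_toLp (Fin 2))
  exact (h3.comp h2).comp h1

/-- The linear version of `splitEquiv`. -/
def splitL : E3 →L[ℝ] ℝ × E2 :=
  (EuclideanSpace.proj (2 : Fin 3)).prod
    ((EuclideanSpace.proj (0 : Fin 3)).smulRight (ee 0) +
      (EuclideanSpace.proj (1 : Fin 3)).smulRight (ee 1))

theorem splitL_apply (z : E3) : splitL z = (z 2, z 0 • ee 0 + z 1 • ee 1) := rfl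

theorem splitEquiv_apply (z : E3) : splitEquiv z = splitL z := by
  rw [splitL_apply]
  refine Prod.ext rfl ?_
  ext i
  fin_cases i
  · change z (Fin.succAbove 2 0) = _
    simp [ee]
  · change z (Fin.succAbove 2 1) = _
    simp [ee]
    rfl

/-- A coordinate change that turns the hyperbolic volume into the Euclidean volume. -/
def flatten (y : E3) : E3 :=
  y + (-(1 / 2) * (y 2 ^ 2)⁻¹ - y 2) • EuclideanSpace.single (2 : Fin 3) (1 : ℝ)

theorem flatten_two (y : E3) : flatten y 2 = -(1 / 2) * (y 2 ^ 2)⁻¹ := by simp [flatten]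

theorem flatten_of_ne (y : E3) {i : Fin 3} (hi : i ≠ 2) : flatten y i = y i := by
  simp [flatten, hi]

theorem injOn_flatten : InjOn flatten H3 := by
  intro a ha b hb hab
  have ha' : 0 < a 2 := ha
  have hb' : 0 < b 2 := hb
  have h2 : flatten a 2 = flatten b 2 := by rw [hab]
  rw [flatten_two, flatten_two] at h2
  have h3 : a 2 ^ 2 = b 2 ^ 2 := by
    have : (a 2 ^ 2)⁻¹ = (b 2 ^ 2)⁻¹ := by linarith
    exact inv_injective this
  have h4 : a 2 = b 2 := (sq_eq_sq₀ ha'.le hb'.le).1 h3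
  ext i
  by_cases hi : i = 2
  · rw [hi]; exact h4
  · rw [← flatten_of_ne a hi, ← flatten_of_ne b hi, hab]

/-- The derivative of `flatten`. -/
def flattenD (y : E3) : E3 →L[ℝ] E3 :=
  ContinuousLinearMap.id ℝ E3 + ((1 / y 2 ^ 3 - 1) •
    (EuclideanSpace.proj (𝕜 := ℝ) (2 : Fin 3) : E3 →L[ℝ] ℝ)).smulRight
      (EuclideanSpace.single (2 : Fin 3) (1 : ℝ))

theorem hasFDerivAt_flatten {y : E3} (hy : 0 < y 2) : HasFDerivAt flatten (flattenD y) y := by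
  have h2 : HasFDerivAt (fun y : E3 => y 2) (EuclideanSpace.proj (𝕜 := ℝ) (2 : Fin 3)) y :=
    (EuclideanSpace.proj (𝕜 := ℝ) (2 : Fin 3)).hasFDerivAt
  have h1 : HasDerivAt (fun s : ℝ => -(1 / 2) * (s ^ 2)⁻¹ - s) (1 / y 2 ^ 3 - 1) (y 2) := by
    have h3 := (((hasDerivAt_pow 2 (y 2)).inv (pow_ne_zero 2 hy.ne')).const_mul (-(1 / 2))).sub
      (hasDerivAt_id (y 2))
    refine h3.congr_deriv ?_
    push_cast
    field_simp
  have h3 : HasFDerivAt (fun y : E3 => -(1 / 2) * (y 2 ^ 2)⁻¹ - y 2)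
      ((1 / y 2 ^ 3 - 1) • (EuclideanSpace.proj (𝕜 := ℝ) (2 : Fin 3) : E3 →L[ℝ] ℝ)) y :=
    HasDerivAt.comp_hasFDerivAt y (f := fun y : E3 => y 2) (show HasDerivAt (fun s : ℝ => -(1 / 2) * (s ^ 2)⁻¹ - s) _
      ((fun y : E3 => y 2) y) from h1) h2
  exact (hasFDerivAt_id y).add (h3.smul_const (EuclideanSpace.single (2 : Fin 3) (1 : ℝ)))

theorem det_flattenD (y : E3) : (flattenD y).det = 1 / y 2 ^ 3 := by
  rw [det_eq_inner_cross, inner_coord, cross_zero, cross_one, cross_two]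
  simp [flattenD]

/-- Replacing the height by -1/(2y₂²) has Jacobian y₂⁻³. As plain Lebesgue volume, the swept volume
can be bounded by the area formula inequality, which needs no injectivity. -/
theorem hvolume_eq_volume_flatten {A : Set E3} (hA : MeasurableSet A) (hAH : A ⊆ H3) :
    hvolume A = volume (flatten '' A) := by
  rw [← lintegral_abs_det_fderiv_eq_addHaar_image volume hA
    (fun y hy => (hasFDerivAt_flatten (hAH hy)).hasFDerivWithinAt) (injOn_flatten.mono hAH), hvolume]
  refine setLIntegral_congr_fun hA fun y hy => ?_
  have : 0 < y 2 := hAH hy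
  simp only [det_flattenD]
  rw [abs_of_pos (by positivity)]

/-- The volume swept out by a family of parametrized surfaces. -/
theorem volume_flatten_image_le {K : ℝ × E2 → E3} {Q : Set (ℝ × E2)} {K' : ℝ × E2 → ℝ × E2 →L[ℝ] E3}
    (hQ : MeasurableSet Q) (hK : ∀ q ∈ Q, HasFDerivWithinAt K (K' q) Q q) (hpos : ∀ q ∈ Q, 0 < K q 2) :
    volume (flatten '' (K '' Q)) ≤ ∫⁻ q in Q,
      ENNReal.ofReal (|⟪cross (K' q (0, ee 0)) (K' q (0, ee 1)), K' q (1, 0)⟫| / K q 2 ^ 3) := by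
  have hpre : splitL '' (splitEquiv ⁻¹' Q) = Q := by
    have : (splitL : E3 → ℝ × E2) = splitEquiv := funext fun z => (splitEquiv_apply z).symm
    rw [this, image_preimage_eq Q splitEquiv.surjective]
  have himg : (fun z => flatten (K (splitL z))) '' (splitEquiv ⁻¹' Q) = flatten '' (K '' Q) := by
    conv_rhs => rw [← hpre]
    rw [image_image, image_image]
  have hmem : ∀ z ∈ splitEquiv ⁻¹' Q, splitL z ∈ Q := fun z hz => by
    rw [← splitEquiv_apply]; exact hz
  have hder : ∀ z ∈ splitEquiv ⁻¹' Q, HasFDerivWithinAt (fun z => flatten (K (splitL z)))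
      ((flattenD (K (splitL z))).comp ((K' (splitL z)).comp splitL)) (splitEquiv ⁻¹' Q) z := by
    intro z hz
    have h1 := (hK _ (hmem z hz)).comp z splitL.hasFDerivAt.hasFDerivWithinAt hmem
    exact (hasFDerivAt_flatten (hpos _ (hmem z hz))).comp_hasFDerivWithinAt z h1
  have key := addHaar_image_le_lintegral_abs_det_fderiv volume
    (splitEquiv.measurable hQ) hder
  rw [himg] at key
  refine key.trans (le_of_eq ?_)
  rw [← volume_preserving_splitEquiv.setLIntegral_comp_preimage_emb
    splitEquiv.measurableEmbedding _ Q]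
  refine setLIntegral_congr_fun (splitEquiv.measurable hQ) fun z hz => ?_
  have hp := hpos _ (hmem z hz)
  have e0 : splitL (EuclideanSpace.single 0 1) = (0, ee 0) := by
    rw [splitL_apply]; simp
  have e1 : splitL (EuclideanSpace.single 1 1) = (0, ee 1) := by
    rw [splitL_apply]; simp
  have e2 : splitL (EuclideanSpace.single 2 1) = (1, 0) := by
    rw [splitL_apply]; simp
  have hdet : ((flattenD (K (splitL z))).comp ((K' (splitL z)).comp splitL)).det =
      ⟪cross (K' (splitL z) (0, ee 0)) (K' (splitL z) (0, ee 1)), K' (splitL z) (1, 0)⟫ /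
        K (splitL z) 2 ^ 3 := by
    have h1 := det_eq_inner_cross ((K' (splitL z)).comp splitL)
    simp only [ContinuousLinearMap.comp_apply, e0, e1, e2] at h1
    have h2 : ((flattenD (K (splitL z))).comp ((K' (splitL z)).comp splitL)).det =
        (flattenD (K (splitL z))).det * ((K' (splitL z)).comp splitL).det :=
      LinearMap.det_comp (flattenD (K (splitL z)) : E3 →ₗ[ℝ] E3)
        ((K' (splitL z)).comp splitL : E3 →ₗ[ℝ] E3)
    rw [h2, h1, det_flattenD]
    ring
  simp only [hdet, splitEquiv_apply]
  rw [abs_div, abs_of_pos (pow_pos hp 3)]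

/-! ### The volume swept out by the flow -/

section

variable {N : Type*} [TopologicalSpace N] [ChartedSpace E2 N] [IsManifold (𝓡 2) ∞ N]
  {T : ℝ} {F : ℝ → N → E3}

/-- The velocity is parallel to the area vector, so the triple product is speed times area element.
-/
theorem IsMeanCurvatureFlow.abs_det_eq (hF : IsMeanCurvatureFlow T F) {c : N} {q : ℝ × E2}
    (hq : q ∈ Ico 0 T ×ˢ (ch c).target) :
    |⟪cross (fderivWithin ℝ (fun q : ℝ × E2 => inChart (F q.1) c q.2) (Ico 0 T ×ˢ (ch c).target) q
        (0, ee 0)) (fderivWithin ℝ (fun q : ℝ × E2 => inChart (F q.1) c q.2)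
        (Ico 0 T ×ˢ (ch c).target) q (0, ee 1)),
      fderivWithin ℝ (fun q : ℝ × E2 => inChart (F q.1) c q.2) (Ico 0 T ×ˢ (ch c).target) q (1, 0)⟫| =
    ‖vel T F q.1 ((ch c).symm q.2)‖ * ‖areaVec (fderiv ℝ (inChart (F q.1) c) q.2)‖ := by
  have hU := isOpen_extChartAt_target (I := 𝓡 2) c
  have h1 := (fderiv_slice_eq hU (hF.contDiffOn c) hq).fderiv
  have h2 := derivWithin_slice_eq (hF.contDiffOn c) hq
  have h3 : ∀ w, fderivWithin ℝ (fun q : ℝ × E2 => inChart (F q.1) c q.2)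
      (Ico 0 T ×ˢ (ch c).target) q (0, w) = fderiv ℝ (inChart (F q.1) c) q.2 w := fun w => by
    have := DFunLike.congr_fun h1 w
    exact this.symm
  rw [h3, h3, ← h2]
  have hS := hF.isSurface hq.1
  have hv := (hF.hasCurvatureVector hq.1).eq_smul hS ((ch c).symm q.2)
  have hvel : derivWithin (fun s => inChart (F s) c q.2) (Ico 0 T) q.1 =
      vel T F q.1 ((ch c).symm q.2) := rfl
  simp only
  rw [hvel]
  change |⟪areaVec (fderiv ℝ (inChart (F q.1) c) q.2), _⟫| = _
  rw [areaVec_eq (hS.areaVec_ne hq.2)]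
  have hn : ⟪unitVec (fderiv ℝ (inChart (F q.1) c) q.2), vel T F q.1 ((ch c).symm q.2)⟫ ^ 2 =
      ‖vel T F q.1 ((ch c).symm q.2)‖ ^ 2 := by
    have hsq : ⟪normalAt (F q.1) ((ch c).symm q.2), vel T F q.1 ((ch c).symm q.2)⟫ ^ 2 =
        ‖vel T F q.1 ((ch c).symm q.2)‖ ^ 2 := by
      conv_rhs => rw [hv, norm_smul, norm_normalAt hS, mul_one, Real.norm_eq_abs, sq_abs]
      rw [real_inner_comm]
    rcases nrm_inChart hS hq.2 with h | h
    · rw [nrm] at h; rw [h, hsq]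
    · rw [nrm] at h; rw [h, inner_neg_left, neg_sq, hsq]
  have hn' : |⟪unitVec (fderiv ℝ (inChart (F q.1) c) q.2), vel T F q.1 ((ch c).symm q.2)⟫| =
      ‖vel T F q.1 ((ch c).symm q.2)‖ := by
    rw [← sq_eq_sq₀ (abs_nonneg _) (norm_nonneg _), sq_abs, hn]
  rw [inner_smul_left, abs_mul, hn', ← areaVec_eq (hS.areaVec_ne hq.2)]
  simp [mul_comm]

variable [CompactSpace N] [MeasurableSpace N] [BorelSpace N]

/-- The space-time surface is cut into disjoint chart pieces times [0, t]. Each image is bounded by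
the integral of its Jacobian, and Tonelli reassembles the pieces. Overlaps of images only help,
since an upper bound is wanted. -/
theorem IsMeanCurvatureFlow.hvolume_swept_le (hF : IsMeanCurvatureFlow T F)
    {cs : ℕ → N} (hcs : ⋃ k, (ch (cs k)).source = univ) {t : ℝ} (ht : t ∈ Ico 0 T) :
    hvolume (⋃ s ∈ Icc 0 t, range (F s)) ≤
      ENNReal.ofReal (∫ s in (0 : ℝ)..t, absCurv (F 0) (F s) (vel T F s) cs) := by
  have hT : 0 < T := ht.1.trans_lt ht.2
  have hJ : ∀ s ∈ Icc 0 t, s ∈ Ico 0 T := fun s hs => ⟨hs.1, hs.2.trans_lt ht.2⟩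
  have h0 := hF.isSurface (t := 0) ⟨le_rfl, hT⟩
  have hfin := isFiniteMeasure_areaMeas h0 hcs
  have hι : Continuous fun s : Icc 0 t => (⟨s, hJ s s.2⟩ : Ico 0 T) := by fun_prop
  have hc : Continuous fun q : Icc 0 t × N => F q.1 q.2 :=
    hF.continuous_uncurry.comp ((hι.comp continuous_fst).prodMk continuous_snd)
  have hA : (⋃ s ∈ Icc 0 t, range (F s)) = range fun q : Icc 0 t × N => F q.1 q.2 := by
    ext y
    simp only [mem_iUnion, mem_range]
    constructor
    · rintro ⟨s, hs, x, rfl⟩; exact ⟨(⟨s, hs⟩, x), rfl⟩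
    · rintro ⟨⟨s, x⟩, rfl⟩; exact ⟨s, s.2, x, rfl⟩
  have hAm : MeasurableSet (⋃ s ∈ Icc 0 t, range (F s)) := by
    rw [hA]; exact (isCompact_range hc).isClosed.measurableSet
  have hAH : (⋃ s ∈ Icc 0 t, range (F s)) ⊆ H3 := by
    rw [hA]; rintro _ ⟨⟨s, x⟩, rfl⟩; exact hF.mem s (hJ s s.2) x
  set B : ℕ → Set N := disjointed fun k => (ch (cs k)).source with hB
  have hBm : ∀ k, MeasurableSet (B k) := MeasurableSet.disjointed fun k => measurableSet_source _
  have hBs : ∀ k, B k ⊆ (ch (cs k)).source := fun k => disjointed_subset _ k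
  have hBU : ⋃ k, B k = univ := by rw [hB, iUnion_disjointed, hcs]
  set V : ℕ → Set E2 := fun k => (ch (cs k)).target ∩ (ch (cs k)).symm ⁻¹' B k with hV
  have hVm : ∀ k, MeasurableSet (V k) := fun k => measurableSet_preimage_symm _ (hBm k)
  set K : ℕ → ℝ × E2 → E3 := fun k q => inChart (F q.1) (cs k) q.2 with hK
  have hQsub : ∀ k, Icc 0 t ×ˢ V k ⊆ Ico 0 T ×ˢ (ch (cs k)).target := fun k q hq =>
    ⟨hJ _ hq.1, hq.2.1⟩
  have hcover : flatten '' (⋃ s ∈ Icc 0 t, range (F s)) ⊆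
      ⋃ k, flatten '' (K k '' (Icc 0 t ×ˢ V k)) := by
    rintro _ ⟨y, hy, rfl⟩
    obtain ⟨s, hs, x, rfl⟩ : ∃ s ∈ Icc 0 t, ∃ x, F s x = y := by
      simpa using hy
    obtain ⟨k, hk⟩ := mem_iUnion.1 (hBU.symm ▸ mem_univ x : x ∈ ⋃ k, B k)
    refine mem_iUnion.2 ⟨k, mem_image_of_mem _ ⟨(s, ch (cs k) x), ⟨hs, ?_⟩, ?_⟩⟩
    · refine ⟨(ch (cs k)).map_source (hBs k hk), ?_⟩
      rw [mem_preimage, (ch (cs k)).left_inv (hBs k hk)]; exact hk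
    · exact inChart_ch (F s) (hBs k hk)
  set Φ : ℕ → ℝ × E2 → ℝ≥0∞ := fun k q => ENNReal.ofReal
    (‖vel T F q.1 ((ch (cs k)).symm q.2)‖ / F q.1 ((ch (cs k)).symm q.2) 2 ^ 3) *
      ENNReal.ofReal ‖areaVec (fderiv ℝ (inChart (F q.1) (cs k)) q.2)‖ with hΦ
  have hpiece : ∀ k, volume (flatten '' (K k '' (Icc 0 t ×ˢ V k))) ≤
      ∫⁻ q in Icc 0 t ×ˢ V k, Φ k q := by
    intro k
    have hQm : MeasurableSet (Icc 0 t ×ˢ V k) := measurableSet_Icc.prod (hVm k)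
    refine (volume_flatten_image_le (K := K k) hQm (fun q hq =>
      (((hF.contDiffOn (cs k)).differentiableOn (by simp) q (hQsub k hq)).hasFDerivWithinAt.mono
        (hQsub k))) fun q hq => hF.mem q.1 (hJ _ hq.1) _).trans (le_of_eq ?_)
    refine setLIntegral_congr_fun hQm fun q hq => ?_
    simp only [hΦ, hK]
    have hp : 0 < F q.1 ((ch (cs k)).symm q.2) 2 := hF.mem q.1 (hJ _ hq.1) _
    rw [hF.abs_det_eq (hQsub k hq), ← ENNReal.ofReal_mul (by positivity)]
    congr 1
    rw [div_mul_eq_mul_div]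
    rfl
  have hΦm : ∀ k, AEMeasurable (Φ k) ((volume.restrict (Icc 0 t)).prod (volume.restrict (V k))) := by
    intro k
    rw [Measure.prod_restrict]
    have hU := isOpen_extChartAt_target (I := 𝓡 2) (cs k)
    have c1 := (contDiffOn_fderiv_slice hU (hF.contDiffOn (cs k))).continuousOn
    have c2 := (contDiffOn_derivWithin_slice hU (hF.contDiffOn (cs k))).continuousOn
    have c3 := (hF.contDiffOn (cs k)).continuousOn
    have c4 : ContinuousOn (fun q : ℝ × E2 => inChart (F q.1) (cs k) q.2 2)
        (Ico 0 T ×ˢ (ch (cs k)).target) :=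
      (EuclideanSpace.proj (𝕜 := ℝ) (2 : Fin 3)).continuous.comp_continuousOn c3
    have c5 := (c2.norm.div (c4.pow 3) fun q hq => pow_ne_zero 3 (hF.mem q.1 hq.1 _ : (0:ℝ) < _).ne')
    have hQm : MeasurableSet (Icc 0 t ×ˢ V k) := measurableSet_Icc.prod (hVm k)
    exact ((c5.mono (hQsub k)).aemeasurable hQm).ennreal_ofReal.mul
      (((continuous_areaVec.norm.comp_continuousOn c1).mono (hQsub k)).aemeasurable
        hQm).ennreal_ofReal
  have hslice : ∀ s ∈ Icc 0 t, ∀ k, ∫⁻ u in V k, Φ k (s, u) =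
      ∫⁻ x in B k, ENNReal.ofReal (‖vel T F s x‖ / F s x 2 * hjac (F 0) (F s) x)
        ∂(areaMeas (F 0) cs) := by
    intro s hs k
    have hS := hF.isSurface (hJ s hs)
    have hvc := (hF.hasCurvatureVector (hJ s hs)).cont
    have hm : Continuous fun x => ‖vel T F s x‖ / F s x 2 ^ 3 :=
      hvc.norm.div ((continuous_coord hS.smooth.continuous 2).pow 3)
        fun x => pow_ne_zero 3 (hS.pos x).ne'
    have h1 := lintegral_areaMeas h0 hS hcs (hBm k) (hBs k) hm.measurable.ennreal_ofReal
    rw [← h1]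
    refine lintegral_congr fun x => ?_
    have hp := hS.pos x
    rw [← ENNReal.ofReal_mul (by positivity), hjac]
    congr 1
    field_simp
  have hcontL := (hF.continuousOn_absCurv hT hcs).mono (fun s hs => hJ s hs : Icc 0 t ⊆ Ico 0 T)
  have hLnn : ∀ s ∈ Icc 0 t, 0 ≤ absCurv (F 0) (F s) (vel T F s) cs := fun s hs =>
    integral_nonneg fun x => mul_nonneg (div_nonneg (norm_nonneg _)
      ((hF.isSurface (hJ s hs)).pos x).le) (hjac_pos h0 (hF.isSurface (hJ s hs)) x).le
  rw [hvolume_eq_volume_flatten hAm hAH]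
  calc volume (flatten '' (⋃ s ∈ Icc 0 t, range (F s)))
      ≤ ∑' k, volume (flatten '' (K k '' (Icc 0 t ×ˢ V k))) :=
        (measure_mono hcover).trans (measure_iUnion_le _)
    _ ≤ ∑' k, ∫⁻ q in Icc 0 t ×ˢ V k, Φ k q := ENNReal.tsum_le_tsum hpiece
    _ = ∑' k, ∫⁻ s in Icc 0 t, ∫⁻ u in V k, Φ k (s, u) := by
        refine tsum_congr fun k => ?_
        rw [Measure.volume_eq_prod, ← Measure.prod_restrict, lintegral_prod _ (hΦm k)]
    _ = ∫⁻ s in Icc 0 t, ∑' k, ∫⁻ u in V k, Φ k (s, u) :=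
        (lintegral_tsum fun k => (hΦm k).lintegral_prod_right').symm
    _ = ∫⁻ s in Icc 0 t, ENNReal.ofReal (absCurv (F 0) (F s) (vel T F s) cs) := by
        refine setLIntegral_congr_fun measurableSet_Icc fun s hs => ?_
        have hS := hF.isSurface (hJ s hs)
        simp_rw [hslice s hs]
        rw [← lintegral_iUnion hBm (disjoint_disjointed _), hBU, setLIntegral_univ, absCurv,
          ofReal_integral_eq_lintegral_ofReal]
        · have hcx : Continuous fun x => ‖vel T F s x‖ / F s x 2 * hjac (F 0) (F s) x :=
            ((hF.hasCurvatureVector (hJ s hs)).cont.norm.div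
              (continuous_coord hS.smooth.continuous 2) fun x => (hS.pos x).ne').mul
              (Hyp3.continuous_hjac h0 hS)
          exact hcx.integrable_of_hasCompactSupport (HasCompactSupport.of_compactSpace _)
        · exact ae_of_all _ fun x => mul_nonneg (div_nonneg (norm_nonneg _) (hS.pos x).le)
            (hjac_pos h0 hS x).le
    _ = ENNReal.ofReal (∫ s in (0 : ℝ)..t, absCurv (F 0) (F s) (vel T F s) cs) := by
        rw [intervalIntegral.integral_of_le ht.1, ← integral_Icc_eq_integral_Ioc,
          ofReal_integral_eq_lintegral_ofReal hcontL.integrableOn_Icc]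
        filter_upwards [ae_restrict_mem measurableSet_Icc] with s hs using hLnn s hs

end

/-! ### Volume and area of geodesic spheres -/

theorem splitL_norm_sq (z : E3) : ‖z‖ ^ 2 = (splitL z).1 ^ 2 + ‖(splitL z).2‖ ^ 2 := by
  rw [splitL_apply, norm_sq_coord, EuclideanSpace.norm_sq_eq]
  simp [ee]
  ring

/-- Horizontal slices of the ball are discs of area π(R² - (z-c₂)²). Outside the ball
`ENNReal.ofReal` truncates the negative value to zero, so no range of integration is needed. -/
theorem lintegral_ball_coord (c : E3) (R : ℝ) (hR : 0 < R) {G : ℝ → ℝ≥0∞} (hG : Measurable G) :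
    ∫⁻ y in Metric.ball c R, G (y 2) =
      ∫⁻ z, G z * (ENNReal.ofReal (R ^ 2 - (z - c 2) ^ 2) * ENNReal.ofReal Real.pi) := by
  set S : Set (ℝ × E2) := {q | ‖q.2 - (splitL c).2‖ ^ 2 < R ^ 2 - (q.1 - c 2) ^ 2} with hS
  have hSm : MeasurableSet S := by
    refine (isOpen_lt (f := fun q : ℝ × E2 => ‖q.2 - (splitL c).2‖ ^ 2)
      (g := fun q : ℝ × E2 => R ^ 2 - (q.1 - c 2) ^ 2) ?_ ?_).measurableSet <;> fun_prop
  have hball : splitEquiv ⁻¹' S = Metric.ball c R := by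
    ext y
    rw [mem_preimage, splitEquiv_apply, mem_ball_iff_norm, ← sq_lt_sq₀ (norm_nonneg _) hR.le,
      splitL_norm_sq, map_sub]
    change ‖(splitL y).2 - (splitL c).2‖ ^ 2 < R ^ 2 - ((splitL y).1 - (splitL c).1) ^ 2 ↔
      ((splitL y).1 - (splitL c).1) ^ 2 + ‖(splitL y).2 - (splitL c).2‖ ^ 2 < R ^ 2
    constructor <;> intro h <;> linarith
  have h1 := volume_preserving_splitEquiv.setLIntegral_comp_preimage_emb
    splitEquiv.measurableEmbedding (fun q => G q.1) S
  rw [hball] at h1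
  have h2 : ∀ y : E3, (splitEquiv y).1 = y 2 := fun y => by rw [splitEquiv_apply]; rfl
  simp only [h2] at h1
  rw [h1, ← lintegral_indicator hSm, Measure.volume_eq_prod, lintegral_prod]
  · refine lintegral_congr fun z => ?_
    have hsl : {w : E2 | (z, w) ∈ S} = Metric.ball (splitL c).2 (√(R ^ 2 - (z - c 2) ^ 2)) := by
      ext w
      rw [mem_ball_iff_norm]
      change ‖w - (splitL c).2‖ ^ 2 < R ^ 2 - (z - c 2) ^ 2 ↔ _
      rw [Real.lt_sqrt (norm_nonneg _)]
    have h3 : (fun w : E2 => S.indicator (fun q : ℝ × E2 => G q.1) (z, w)) =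
        (Metric.ball (splitL c).2 (√(R ^ 2 - (z - c 2) ^ 2))).indicator fun _ => G z := by
      rw [← hsl]; rfl
    rw [h3, lintegral_indicator measurableSet_ball, setLIntegral_const,
      EuclideanSpace.volume_ball_fin_two, ← ENNReal.ofReal_pow (Real.sqrt_nonneg _)]
    congr 2
    rcases le_total 0 (R ^ 2 - (z - c 2) ^ 2) with h | h
    · rw [Real.sq_sqrt h]
    · rw [Real.sqrt_eq_zero_of_nonpos h, ENNReal.ofReal_of_nonpos h]; simp
  · exact ((hG.comp measurable_fst).indicator hSm).aemeasurable

theorem lintegral_Ioo_ofReal_deriv {f f' : ℝ → ℝ} {a b : ℝ} (hab : a ≤ b)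
    (hd : ∀ x ∈ Icc a b, HasDerivAt f (f' x) x) (hc : ContinuousOn f' (Icc a b))
    (hnn : ∀ x ∈ Icc a b, 0 ≤ f' x) :
    ∫⁻ x in Ioo a b, ENNReal.ofReal (f' x) = ENNReal.ofReal (f b - f a) := by
  have hi : IntervalIntegrable f' volume a b := by
    rw [← uIcc_of_le hab] at hc; exact hc.intervalIntegrable
  have h1 := intervalIntegral.integral_eq_sub_of_hasDerivAt (fun x hx => hd x (by rwa [uIcc_of_le hab] at hx)) hi
  rw [← h1, intervalIntegral.integral_of_le hab, integral_Ioc_eq_integral_Ioo,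
    ofReal_integral_eq_lintegral_ofReal ((hc.integrableOn_Icc).mono_set Ioo_subset_Icc_self)]
  filter_upwards [ae_restrict_mem measurableSet_Ioo] with x hx using hnn x (Ioo_subset_Icc_self hx)

theorem ball_subset_H3 {c : E3} {R : ℝ} (hc : R < c 2) : Metric.ball c R ⊆ H3 := fun _ hy =>
  mem_H3_of_norm_sub hc (mem_ball_iff_norm.1 hy).le

/-- The open ball is relatively closed in the complement of the sphere, hence contains the component
of each of its points. The converse inclusion plays no role. -/
theorem ball_subset_enclosed {c : E3} {R : ℝ} (hR : 0 < R) (hc : R < c 2) :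
    Metric.ball c R ⊆ enclosed (Metric.sphere c R) := by
  intro x hx
  have hxS : x ∉ Metric.sphere c R := fun h => (Metric.mem_ball.1 hx).ne (Metric.mem_sphere.1 h)
  have hSH : Metric.sphere c R ⊆ H3 := fun _ hy =>
    mem_H3_of_norm_sub hc (mem_sphere_iff_norm.1 hy).le
  rw [mem_enclosed_iff (isCompact_sphere c R) hSH (ball_subset_H3 hc hx) hxS]
  refine Metric.isBounded_ball.subset (?_ : _ ⊆ Metric.ball c R)
  refine isPreconnected_connectedComponentIn.subset_of_closure_inter_subset Metric.isOpen_ball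
    ⟨x, mem_connectedComponentIn hxS, hx⟩ ?_
  rintro y ⟨hy, hyD⟩
  have h1 := connectedComponentIn_subset _ _ hyD
  rw [closure_ball c hR.ne', Metric.mem_closedBall] at hy
  exact lt_of_le_of_ne hy h1

theorem ofReal_le_enclosedVolume_geodesicSphere {p : E3} (hp : p ∈ H3) {r : ℝ} (hr : 0 < r) :
    ENNReal.ofReal (2 * Real.pi * (Real.sinh r * Real.cosh r - r)) ≤
      enclosedVolume (geodesicSphere p r) := by
  have hp2 : 0 < p 2 := hp
  have hsinh := Real.sinh_pos_iff.2 hr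
  rw [geodesicSphere_eq hp hr]
  set c := euclCentre p r with hcdef
  set R := p 2 * Real.sinh r with hRdef
  have hc2 : c 2 = p 2 * Real.cosh r := euclCentre_two p r
  have hR : 0 < R := by positivity
  have hRc : R < c 2 := by rw [hc2]; exact mul_lt_mul_of_pos_left (Real.sinh_lt_cosh r) hp2
  refine le_trans (le_of_eq ?_) (hvolume_mono (ball_subset_enclosed hR hRc))
  have hG : Measurable fun z : ℝ => ENNReal.ofReal (1 / z ^ 3) := by fun_prop
  rw [hvolume, lintegral_ball_coord c R hR hG]
  have hlo : c 2 - R = p 2 * Real.exp (-r) := by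
    rw [hc2, hRdef, ← Real.cosh_sub_sinh]; ring
  have hhi : c 2 + R = p 2 * Real.exp r := by
    rw [hc2, hRdef, ← Real.cosh_add_sinh]; ring
  have hlo0 : 0 < c 2 - R := by linarith
  have hq : R ^ 2 - c 2 ^ 2 = - p 2 ^ 2 := by
    rw [hc2, hRdef]; linear_combination (- p 2 ^ 2) * Real.cosh_sq r
  have hsupp : (fun z : ℝ => ENNReal.ofReal (1 / z ^ 3) *
      (ENNReal.ofReal (R ^ 2 - (z - c 2) ^ 2) * ENNReal.ofReal Real.pi)) =
      (Ioo (c 2 - R) (c 2 + R)).indicator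
        fun z => ENNReal.ofReal (Real.pi * (R ^ 2 - (z - c 2) ^ 2) / z ^ 3) := by
    funext z
    by_cases hz : z ∈ Ioo (c 2 - R) (c 2 + R)
    · have hz0 : 0 < z := hlo0.trans hz.1
      have hpos : 0 ≤ R ^ 2 - (z - c 2) ^ 2 := by nlinarith [hz.1, hz.2]
      rw [indicator_of_mem hz, ← ENNReal.ofReal_mul hpos, ← ENNReal.ofReal_mul (by positivity)]
      congr 1; ring
    · have hneg : R ^ 2 - (z - c 2) ^ 2 ≤ 0 := by
        rw [mem_Ioo, not_and_or, not_lt, not_lt] at hz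
        rcases hz with h | h <;> nlinarith
      rw [indicator_of_notMem hz, ENNReal.ofReal_of_nonpos hneg, zero_mul, mul_zero]
  -- Since R² - c₂² = -p₂², the integrand is π(2c₂/z² - 1/z - p₂²/z³), which gives the primitive.
  rw [hsupp, lintegral_indicator measurableSet_Ioo,
    lintegral_Ioo_ofReal_deriv (f := fun z => Real.pi * (p 2 ^ 2 / (2 * z ^ 2) - 2 * c 2 / z -
      Real.log z)) (by linarith)]
  · congr 1
    rw [hlo, hhi, hc2, Real.log_mul hp2.ne' (Real.exp_pos _).ne', Real.log_mul hp2.ne'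
      (Real.exp_pos _).ne', Real.log_exp, Real.log_exp, Real.exp_neg, Real.sinh_eq, Real.cosh_eq,
      Real.exp_neg]
    have he := Real.exp_pos r
    field_simp
    ring
  · intro z hz
    have hz0 : z ≠ 0 := (hlo0.trans_le hz.1).ne'
    have d1 : HasDerivAt (fun z : ℝ => p 2 ^ 2 / (2 * z ^ 2)) (-(p 2 ^ 2 / z ^ 3)) z := by
      have := (hasDerivAt_const z (p 2 ^ 2)).div ((hasDerivAt_pow 2 z).const_mul 2)
        (by positivity)
      refine this.congr_deriv ?_
      push_cast
      field_simp
      ring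
    have d2 : HasDerivAt (fun z : ℝ => 2 * c 2 / z) (-(2 * c 2 / z ^ 2)) z := by
      have := (hasDerivAt_const z (2 * c 2)).div (hasDerivAt_id z) hz0
      refine this.congr_deriv ?_
      simp only [id]
      field_simp
      ring
    have d3 := (((d1.sub d2).sub (Real.hasDerivAt_log hz0)).const_mul Real.pi)
    refine d3.congr_deriv ?_
    have hq' : p 2 ^ 2 = c 2 ^ 2 - R ^ 2 := by linarith
    rw [hq']
    field_simp
    ring
  · refine ContinuousOn.div (by fun_prop) (by fun_prop) fun z hz => ?_
    exact pow_ne_zero 3 (hlo0.trans_le hz.1).ne'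
  · intro z hz
    have hz0 : 0 < z := hlo0.trans_le hz.1
    have hpos : 0 ≤ R ^ 2 - (z - c 2) ^ 2 := by nlinarith [hz.1, hz.2]
    have := Real.pi_pos
    positivity

/-- Change of variables with the last coordinate split off. -/
theorem lintegral_image_split {K : ℝ × E2 → E3} {Q : Set (ℝ × E2)} {K' : ℝ × E2 → ℝ × E2 →L[ℝ] E3}
    (hQ : MeasurableSet Q) (hK : ∀ q ∈ Q, HasFDerivWithinAt K (K' q) Q q) (hinj : InjOn K Q)
    (g : E3 → ℝ≥0∞) :
    ∫⁻ y in K '' Q, g y = ∫⁻ q in Q,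
      ENNReal.ofReal |⟪cross (K' q (0, ee 0)) (K' q (0, ee 1)), K' q (1, 0)⟫| * g (K q) := by
  have hpre : splitL '' (splitEquiv ⁻¹' Q) = Q := by
    have : (splitL : E3 → ℝ × E2) = splitEquiv := funext fun z => (splitEquiv_apply z).symm
    rw [this, image_preimage_eq Q splitEquiv.surjective]
  have himg : (fun z => K (splitL z)) '' (splitEquiv ⁻¹' Q) = K '' Q := by
    conv_rhs => rw [← hpre]
    rw [image_image]
  have hmem : ∀ z ∈ splitEquiv ⁻¹' Q, splitL z ∈ Q := fun z hz => by
    rw [← splitEquiv_apply]; exact hz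
  have hder : ∀ z ∈ splitEquiv ⁻¹' Q, HasFDerivWithinAt (fun z => K (splitL z))
      ((K' (splitL z)).comp splitL) (splitEquiv ⁻¹' Q) z := fun z hz =>
    (hK _ (hmem z hz)).comp z splitL.hasFDerivAt.hasFDerivWithinAt hmem
  have hinj' : InjOn (fun z => K (splitL z)) (splitEquiv ⁻¹' Q) := by
    intro a ha b hb hab
    have h1 := hinj (hmem a ha) (hmem b hb) hab
    rw [← splitEquiv_apply, ← splitEquiv_apply] at h1
    exact splitEquiv.injective h1
  rw [← himg, lintegral_image_eq_lintegral_abs_det_fderiv_mul volume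
    (splitEquiv.measurable hQ) hder hinj',
    ← volume_preserving_splitEquiv.setLIntegral_comp_preimage_emb
    splitEquiv.measurableEmbedding _ Q]
  refine setLIntegral_congr_fun (splitEquiv.measurable hQ) fun z hz => ?_
  have e0 : splitL (EuclideanSpace.single 0 1) = (0, ee 0) := by
    rw [splitL_apply]; simp
  have e1 : splitL (EuclideanSpace.single 1 1) = (0, ee 1) := by
    rw [splitL_apply]; simp
  have e2 : splitL (EuclideanSpace.single 2 1) = (1, 0) := by
    rw [splitL_apply]; simp
  have h1 := det_eq_inner_cross ((K' (splitL z)).comp splitL)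
  simp only [ContinuousLinearMap.comp_apply, e0, e1, e2] at h1
  simp only [h1, splitEquiv_apply]

/-! ### The area of a geodesic sphere -/

/-- The projection to the horizontal directions. -/
def hor : E3 →L[ℝ] E3 :=
  ContinuousLinearMap.id ℝ E3 -
    (EuclideanSpace.proj (2 : Fin 3)).smulRight (EuclideanSpace.single (2 : Fin 3) (1 : ℝ))

theorem hor_zero (m : E3) : hor m 0 = m 0 := by simp [hor]
theorem hor_one (m : E3) : hor m 1 = m 1 := by simp [hor]
theorem hor_two (m : E3) : hor m 2 = 0 := by simp [hor]

theorem norm_hor_sq (m : E3) : ‖hor m‖ ^ 2 = ‖m‖ ^ 2 - m 2 ^ 2 := by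
  rw [norm_sq_coord, norm_sq_coord, hor_zero, hor_one, hor_two]; ring

theorem E3_ext {a b : E3} (h0 : a 0 = b 0) (h1 : a 1 = b 1) (h2 : a 2 = b 2) : a = b := by
  ext i; fin_cases i <;> assumption

/-- The horizontal projection of the ball of centre `c` and radius `R` to its boundary. -/
def horProj (c : E3) (R : ℝ) (y : E3) : E3 :=
  y + (√(R ^ 2 - (y 2 - c 2) ^ 2) / ‖hor (y - c)‖ - 1) • hor (y - c)

theorem measurable_horProj (c : E3) (R : ℝ) : Measurable (horProj c R) := by
  have h2 : Measurable fun y : E3 => y 2 := (EuclideanSpace.proj (𝕜 := ℝ) (2 : Fin 3)).continuous.measurable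
  have h3 : Measurable fun y : E3 => hor (y - c) :=
    (hor.continuous.comp (continuous_id.sub continuous_const)).measurable
  unfold horProj
  exact measurable_id.add (((((((h2.sub_const _).pow_const 2).const_sub _).sqrt).div
    h3.norm).sub_const 1).smul h3)

theorem horProj_add {c m : E3} {R τ : ℝ} (hτ : 0 < τ) (hm : ‖m‖ = R) (hh : hor m ≠ 0) :
    horProj c R (c + m + (τ - 1) • hor m) = c + m := by
  have h0 : 0 < ‖hor m‖ := norm_pos_iff.2 hh
  have e1 : hor (c + m + (τ - 1) • hor m - c) = τ • hor m := by
    apply E3_ext <;> simp [hor_zero, hor_one, hor_two] <;> ring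
  have e2 : (c + m + (τ - 1) • hor m) 2 - c 2 = m 2 := by simp [hor_two]
  have e3 : R ^ 2 - m 2 ^ 2 = ‖hor m‖ ^ 2 := by rw [norm_hor_sq, hm]
  rw [horProj, e1, e2, e3, Real.sqrt_sq h0.le, norm_smul, Real.norm_of_nonneg hτ.le, smul_smul]
  have : (‖hor m‖ / (τ * ‖hor m‖) - 1) * τ = 1 - τ := by field_simp
  rw [this]; module

/-- The cross product of two tangent vectors is parallel to m. Scaling horizontally by τ multiplies
its horizontal components by τ, and only these pair with `hor m`. -/
theorem inner_cross_hor {a b m : E3} {R τ : ℝ} (hR : 0 < R) (hm : ‖m‖ = R) (ha : ⟪a, m⟫ = 0)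
    (hb : ⟪b, m⟫ = 0) (hab : cross a b ≠ 0) (hτ : 0 < τ) :
    |⟪cross (a + (τ - 1) • hor a) (b + (τ - 1) • hor b), hor m⟫| =
      τ * ‖cross a b‖ * (R ^ 2 - m 2 ^ 2) / R := by
  set n : E3 := R⁻¹ • m with hn
  have hn1 : ‖n‖ = 1 := by
    rw [hn, norm_smul, hm, norm_inv, Real.norm_of_nonneg hR.le, inv_mul_cancel₀ hR.ne']
  have h1 := eq_smul_of_inner_eq_zero (x := cross a b) hn1 hab (by rw [hn, inner_smul_right, ha, mul_zero])
    (by rw [hn, inner_smul_right, hb, mul_zero])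
    (by rw [real_inner_comm]; exact inner_cross_left a b)
    (by rw [real_inner_comm]; exact inner_cross_right a b)
  have h2 : ⟪cross (a + (τ - 1) • hor a) (b + (τ - 1) • hor b), hor m⟫ = τ * ⟪cross a b, hor m⟫ := by
    simp only [inner_coord, cross_zero, cross_one, cross_two, hor_zero, hor_one, hor_two,
      PiLp.add_apply, PiLp.smul_apply, smul_eq_mul]
    ring
  have h3 : ⟪n, hor m⟫ = (R ^ 2 - m 2 ^ 2) / R := by
    rw [hn, inner_smul_left, ← hm, norm_sq_coord, inner_coord, hor_zero, hor_one, hor_two]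
    simp; ring
  have h4 : 0 ≤ R ^ 2 - m 2 ^ 2 := by rw [← hm, ← norm_hor_sq]; positivity
  have h5 : ‖cross a b‖ = |⟪cross a b, n⟫| := by
    conv_lhs => rw [h1, norm_smul, hn1, mul_one, Real.norm_eq_abs]
  have h6 : ⟪cross a b, hor m⟫ = ⟪cross a b, n⟫ * ((R ^ 2 - m 2 ^ 2) / R) := by
    conv_lhs => rw [h1]
    rw [inner_smul_left, h3]; simp
  rw [h2, h6, abs_mul, abs_mul, ← h5, abs_of_pos hτ, abs_of_nonneg (by positivity)]
  ring

/-- The density on the ball whose horizontal projection is the area of the sphere. -/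
def ballDensity (c : E3) (R z : ℝ) : ℝ := 2 * R / ((R ^ 2 - (z - c 2) ^ 2) * z ^ 2)

theorem measurableSet_inter_preimage_of_continuousOn {U : Set E2} (hU : IsOpen U) {φ : E2 → E3}
    (hφ : ContinuousOn φ U) {E : Set E3} (hE : MeasurableSet E) : MeasurableSet (U ∩ φ ⁻¹' E) := by
  have h := (continuousOn_iff_continuous_domRestrict.1 hφ).measurable hE
  have : U ∩ φ ⁻¹' E = Subtype.val '' (U.domRestrict φ ⁻¹' E) := by
    ext u; constructor
    · rintro ⟨h1, h2⟩; exact ⟨⟨u, h1⟩, h2, rfl⟩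
    · rintro ⟨⟨v, hv⟩, h1, rfl⟩; exact ⟨hv, h1⟩
  rw [this]
  exact (MeasurableEmbedding.subtype_coe hU.measurableSet).measurableSet_image.2 h

/-- Sweep the ball by moving each sphere point horizontally to the fraction τ of its distance from
the vertical axis. The Jacobian τ‖∂₀φ×∂₁φ‖(R² - m₂²)/R times `ballDensity` is 2τ times the
hyperbolic area density, and 2τ has mass 1 on (0, 1). One measure on the ball thus dominates every
local parametrization. -/
theorem IsLocalParam.setLIntegral_le {c : E3} {R : ℝ} (hR : 0 < R) {U : Set E2}
    {φ : E2 → E3} (h : IsLocalParam (Metric.sphere c R) U φ) {E : Set E3} (hE : MeasurableSet E) :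
    ∫⁻ u in U ∩ φ ⁻¹' E, ENNReal.ofReal √(firstForm φ u).det ≤
      ∫⁻ y in Metric.ball c R ∩ horProj c R ⁻¹' E, ENNReal.ofReal (ballDensity c R (y 2)) := by
  -- Parameters of the two poles, where the horizontal direction degenerates; they form a null set.
  set P : Set E2 := {u ∈ U | hor (φ u - c) = 0} with hP
  have hnorm : ∀ u ∈ U, ‖φ u - c‖ = R := fun u hu => mem_sphere_iff_norm.1 (h.mapsTo hu).1
  have hPf : P.Finite := by
    refine Set.Finite.of_finite_image (f := φ) ?_ (h.injOn.mono fun u hu => hu.1)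
    refine (Set.toFinite {c + EuclideanSpace.single 2 R, c - EuclideanSpace.single 2 R}).subset ?_
    rintro _ ⟨u, ⟨hu, hu0⟩, rfl⟩
    have h1 := norm_hor_sq (φ u - c)
    rw [hu0, hnorm u hu, norm_zero] at h1
    have e0 : (φ u - c) 0 = 0 := by rw [← hor_zero, hu0]; rfl
    have e1 : (φ u - c) 1 = 0 := by rw [← hor_one, hu0]; rfl
    have e2 : (φ u - c) 2 ^ 2 = R ^ 2 := by linarith
    simp only [PiLp.sub_apply] at e0 e1 e2
    rcases sq_eq_sq_iff_eq_or_eq_neg.1 e2 with h2 | h2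
    · left; apply E3_ext <;> simp <;> linarith
    · right
      rw [mem_singleton_iff]; apply E3_ext <;> simp <;> linarith
  set V : Set E2 := (U ∩ φ ⁻¹' E) \ P with hV
  have hVm : MeasurableSet V :=
    (measurableSet_inter_preimage_of_continuousOn h.isOpen h.smooth.continuousOn hE).diff hPf.measurableSet
  have hVae : (U ∩ φ ⁻¹' E : Set E2) =ᵐ[volume] V := by
    refine (sdiff_null_ae_eq_self (hPf.measure_zero volume)).symm
  rw [setLIntegral_congr hVae]
  have hd : ∀ u ∈ U, HasFDerivAt φ (fderiv ℝ φ u) u := fun u hu =>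
    ((h.smooth.contDiffAt (h.isOpen.mem_nhds hu)).differentiableAt (by simp)).hasFDerivAt
  set Q : Set (ℝ × E2) := Ioo 0 1 ×ˢ V with hQ
  have hQm : MeasurableSet Q := measurableSet_Ioo.prod hVm
  set K : ℝ × E2 → E3 := fun q => φ q.2 + (q.1 - 1) • hor (φ q.2 - c) with hK
  set K' : ℝ × E2 → ℝ × E2 →L[ℝ] E3 := fun q =>
    (fderiv ℝ φ q.2).comp (ContinuousLinearMap.snd ℝ ℝ E2) +
      ((q.1 - 1) • (hor.comp ((fderiv ℝ φ q.2).comp (ContinuousLinearMap.snd ℝ ℝ E2))) +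
        (ContinuousLinearMap.fst ℝ ℝ E2).smulRight (hor (φ q.2 - c))) with hK'
  have hKd : ∀ q ∈ Q, HasFDerivWithinAt K (K' q) Q q := by
    intro q hq
    have d1 : HasFDerivAt (fun q : ℝ × E2 => φ q.2)
        ((fderiv ℝ φ q.2).comp (ContinuousLinearMap.snd ℝ ℝ E2)) q :=
      (hd q.2 hq.2.1.1).comp q hasFDerivAt_snd
    have d2 := (hor.hasFDerivAt.comp q (d1.sub_const c))
    have d3 := (hasFDerivAt_fst (𝕜 := ℝ) (p := q)).sub_const (1 : ℝ)
    exact (d1.add (d3.smul d2)).hasFDerivWithinAt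
  have hhor : ∀ u ∈ V, hor (φ u - c) ≠ 0 := fun u hu h0 => hu.2 ⟨hu.1.1, h0⟩
  have hK2 : ∀ q, K q 2 = φ q.2 2 := fun q => by simp [hK, hor_two]
  have hKhor : ∀ q, hor (K q - c) = q.1 • hor (φ q.2 - c) := fun q => by
    simp only [hK]
    apply E3_ext <;> simp [hor_zero, hor_one, hor_two] <;> ring
  have hKnorm : ∀ q ∈ Q, ‖K q - c‖ ^ 2 = q.1 ^ 2 * ‖hor (φ q.2 - c)‖ ^ 2 + (φ q.2 - c) 2 ^ 2 := by
    intro q hq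
    have h1 := norm_hor_sq (K q - c)
    rw [hKhor, norm_smul, mul_pow, Real.norm_eq_abs, sq_abs, PiLp.sub_apply, hK2] at h1
    rw [PiLp.sub_apply]; linarith
  have hproj : ∀ q ∈ Q, horProj c R (K q) = φ q.2 := by
    intro q hq
    have h1 := horProj_add (c := c) hq.1.1 (hnorm q.2 hq.2.1.1) (hhor q.2 hq.2)
    rwa [add_sub_cancel] at h1
  have hinj : InjOn K Q := by
    intro q hq q' hq' hqq
    have h1 : φ q.2 = φ q'.2 := by rw [← hproj q hq, ← hproj q' hq', hqq]
    have h2 := h.injOn hq.2.1.1 hq'.2.1.1 h1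
    have h3 := hKhor q
    rw [hqq, hKhor, ← h2] at h3
    exact Prod.ext (smul_left_injective ℝ (hhor q.2 hq.2) h3).symm h2
  have himg : K '' Q ⊆ Metric.ball c R ∩ horProj c R ⁻¹' E := by
    rintro _ ⟨q, hq, rfl⟩
    refine ⟨?_, ?_⟩
    · rw [mem_ball_iff_norm, ← sq_lt_sq₀ (norm_nonneg _) hR.le, hKnorm q hq]
      have h1 := norm_hor_sq (φ q.2 - c)
      rw [hnorm q.2 hq.2.1.1] at h1
      have h2 : 0 < ‖hor (φ q.2 - c)‖ ^ 2 := by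
        have := norm_pos_iff.2 (hhor q.2 hq.2); positivity
      have h3 : q.1 ^ 2 < 1 := by nlinarith [hq.1.1, hq.1.2]
      nlinarith
    · rw [mem_preimage, hproj q hq]; exact hq.2.1.2
  refine le_trans (le_of_eq ?_) (lintegral_mono_set himg)
  rw [lintegral_image_split hQm hKd hinj]
  have hint : ∀ q ∈ Q, ENNReal.ofReal |⟪cross (K' q (0, ee 0)) (K' q (0, ee 1)), K' q (1, 0)⟫| *
      ENNReal.ofReal (ballDensity c R (K q 2)) =
      ENNReal.ofReal (2 * q.1) * ENNReal.ofReal √(firstForm φ q.2).det := by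
    intro q hq
    obtain ⟨⟨hτ, -⟩, hqV⟩ := hq
    have hu := hqV.1.1
    have hab : cross (fderiv ℝ φ q.2 (ee 0)) (fderiv ℝ φ q.2 (ee 1)) ≠ 0 :=
      areaVec_ne_zero (h.immersion _ hu)
    have horth : ∀ ξ, ⟪fderiv ℝ φ q.2 ξ, φ q.2 - c⟫ = 0 := by
      intro ξ
      have d := ((hd q.2 hu).sub_const c).norm_sq
      have d' : HasFDerivAt (fun u => ‖φ u - c‖ ^ 2) (0 : E2 →L[ℝ] ℝ) q.2 := by
        refine (hasFDerivAt_const (R ^ 2) q.2).congr_of_eventuallyEq ?_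
        filter_upwards [h.isOpen.mem_nhds hu] with u hu'
        rw [hnorm u hu']
      have := DFunLike.congr_fun (d.unique d') ξ
      simp at this
      rw [real_inner_comm, inner_sub_left]
      exact this
    have k0 : ∀ ξ, K' q (0, ξ) = fderiv ℝ φ q.2 ξ + (q.1 - 1) • hor (fderiv ℝ φ q.2 ξ) := by
      intro ξ; simp [hK']
    have k1 : K' q (1, 0) = hor (φ q.2 - c) := by simp [hK']
    have hpos : 0 < R ^ 2 - (φ q.2 - c) 2 ^ 2 := by
      rw [← hnorm q.2 hu, ← norm_hor_sq]
      have := norm_pos_iff.2 (hhor q.2 hqV); positivity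
    have hφ2 : 0 < φ q.2 2 := (h.mapsTo hu).2
    rw [k0, k0, k1, inner_cross_hor hR (hnorm _ hu) (horth _) (horth _) hab hτ, hK2,
      sqrt_firstForm_det, ← ENNReal.ofReal_mul (by positivity),
      ← ENNReal.ofReal_mul (by positivity)]
    congr 1
    rw [ballDensity, areaVec]
    rw [PiLp.sub_apply] at hpos ⊢
    field_simp
  rw [setLIntegral_congr_fun hQm hint, hQ, Measure.volume_eq_prod, ← Measure.prod_restrict]
  have hm2 : AEMeasurable (fun u => ENNReal.ofReal √(firstForm φ u).det) (volume.restrict V) := by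
    simp only [sqrt_firstForm_det]
    have hc1 : ContinuousOn φ V := h.smooth.continuousOn.mono fun u hu => hu.1.1
    have hc2 : AEMeasurable φ (volume.restrict V) := hc1.aemeasurable hVm
    have hc3 : AEMeasurable (fun u => φ u 2) (volume.restrict V) :=
      (EuclideanSpace.proj (𝕜 := ℝ) (2 : Fin 3)).continuous.measurable.comp_aemeasurable hc2
    exact ((measurable_norm_areaVec φ).aemeasurable.div (hc3.pow_const 2)).ennreal_ofReal
  rw [lintegral_prod_mul (f := fun τ : ℝ => ENNReal.ofReal (2 * τ)) (by fun_prop) hm2]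
  have : ∫⁻ τ in Ioo (0 : ℝ) 1, ENNReal.ofReal (2 * τ) = 1 := by
    rw [lintegral_Ioo_ofReal_deriv (f := fun τ => τ ^ 2) zero_le_one]
    · simp
    · intro x _; simpa using hasDerivAt_pow 2 x
    · fun_prop
    · intro x hx; have := hx.1; positivity
  rw [this, one_mul]

/-- The area measure is a least upper bound, so a single dominating measure suffices: the ball
density pushed to the sphere by `horProj`. Its slices have mass 2πR/z² dz, independent of the disc
radius as in Archimedes' hat-box theorem. -/
theorem area_geodesicSphere_le {p : E3} (hp : p ∈ H3) {r : ℝ} (hr : 0 < r) :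
    area (geodesicSphere p r) ≤ ENNReal.ofReal (4 * Real.pi * Real.sinh r ^ 2) := by
  have hp2 : 0 < p 2 := hp
  have hsinh := Real.sinh_pos_iff.2 hr
  rw [geodesicSphere_eq hp hr]
  set c := euclCentre p r with hcdef
  set R := p 2 * Real.sinh r with hRdef
  have hc2 : c 2 = p 2 * Real.cosh r := euclCentre_two p r
  have hR : 0 < R := by positivity
  have hRc : R < c 2 := by rw [hc2]; exact mul_lt_mul_of_pos_left (Real.sinh_lt_cosh r) hp2
  set μ : Measure E3 := Measure.map (horProj c R) ((volume.restrict (Metric.ball c R)).withDensity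
    fun y => ENNReal.ofReal (ballDensity c R (y 2))) with hμ
  have hle : areaMeasure (Metric.sphere c R) ≤ μ := by
    refine iSup_le fun U => iSup_le fun φ => iSup_le fun h => Measure.le_iff.2 fun E hE => ?_
    have hφ : AEMeasurable φ ((volume.restrict U).withDensity
        fun u => ENNReal.ofReal √(firstForm φ u).det) :=
      (h.smooth.continuousOn.aemeasurable h.isOpen.measurableSet).mono_ac
        (withDensity_absolutelyContinuous _ _)
    rw [Measure.map_apply_of_aemeasurable hφ hE, hμ, Measure.map_apply (measurable_horProj c R) hE,
      withDensity_apply _ (measurable_horProj c R hE), Measure.restrict_restrict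
      (measurable_horProj c R hE), inter_comm]
    refine le_trans (le_of_eq ?_) (h.setLIntegral_le hR hE)
    rw [withDensity_apply' _ _, Measure.restrict_restrict' h.isOpen.measurableSet, inter_comm]
  refine (hle univ).trans ?_
  rw [hμ, Measure.map_apply (measurable_horProj c R) MeasurableSet.univ, preimage_univ,
    withDensity_apply _ MeasurableSet.univ, Measure.restrict_univ,
    lintegral_ball_coord c R hR (G := fun z => ENNReal.ofReal (ballDensity c R z))
      (by unfold ballDensity; fun_prop)]
  have hlo0 : 0 < c 2 - R := by linarith
  have hsupp : (fun z : ℝ => ENNReal.ofReal (ballDensity c R z) *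
      (ENNReal.ofReal (R ^ 2 - (z - c 2) ^ 2) * ENNReal.ofReal Real.pi)) =
      (Ioo (c 2 - R) (c 2 + R)).indicator
        fun z => ENNReal.ofReal (2 * Real.pi * R / z ^ 2) := by
    funext z
    by_cases hz : z ∈ Ioo (c 2 - R) (c 2 + R)
    · have hz0 : 0 < z := hlo0.trans hz.1
      have hpos : 0 < R ^ 2 - (z - c 2) ^ 2 := by nlinarith [hz.1, hz.2]
      rw [indicator_of_mem hz, ← ENNReal.ofReal_mul hpos.le,
        ← ENNReal.ofReal_mul (by unfold ballDensity; positivity), ballDensity]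
      congr 1; field_simp
    · have hneg : R ^ 2 - (z - c 2) ^ 2 ≤ 0 := by
        rw [mem_Ioo, not_and_or, not_lt, not_lt] at hz
        rcases hz with h | h <;> nlinarith
      rw [indicator_of_notMem hz, ENNReal.ofReal_of_nonpos hneg, zero_mul, mul_zero]
  rw [hsupp, lintegral_indicator measurableSet_Ioo,
    lintegral_Ioo_ofReal_deriv (f := fun z => -(2 * Real.pi * R / z)) (by linarith)]
  · refine le_of_eq (congrArg _ ?_)
    have h1 : c 2 + R ≠ 0 := by linarith
    have hq : (c 2 - R) * (c 2 + R) = p 2 ^ 2 := by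
      rw [hc2, hRdef]; linear_combination (p 2 ^ 2) * Real.cosh_sq r
    have h3 : -(2 * Real.pi * R / (c 2 + R)) - -(2 * Real.pi * R / (c 2 - R)) =
        4 * Real.pi * R ^ 2 / ((c 2 - R) * (c 2 + R)) := by
      field_simp; ring
    rw [h3, hq, hRdef]
    field_simp
  · intro z hz
    have hz0 : z ≠ 0 := (hlo0.trans_le hz.1).ne'
    have := ((hasDerivAt_const z (2 * Real.pi * R)).div (hasDerivAt_id z) hz0).neg
    refine this.congr_deriv ?_
    simp only [id]
    field_simp
    ring
  · refine ContinuousOn.div (by fun_prop) (by fun_prop) fun z hz => ?_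
    exact pow_ne_zero 2 (hlo0.trans_le hz.1).ne'
  · intro z hz
    have := Real.pi_pos
    positivity

/-! ### The area of an embedded surface -/

section

variable {N : Type*} [TopologicalSpace N] [ChartedSpace E2 N]

theorem IsLocalParam.setLIntegral_le_areaMeasure {S : Set E3} {U : Set E2} {φ : E2 → E3}
    (h : IsLocalParam S U φ) {E : Set E3} (hE : MeasurableSet E) :
    ∫⁻ u in U ∩ φ ⁻¹' E, ENNReal.ofReal √(firstForm φ u).det ≤ areaMeasure S E := by
  have hφ : AEMeasurable φ ((volume.restrict U).withDensity
      fun u => ENNReal.ofReal √(firstForm φ u).det) :=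
    (h.smooth.continuousOn.aemeasurable h.isOpen.measurableSet).mono_ac
      (withDensity_absolutelyContinuous _ _)
  refine le_trans (le_of_eq ?_) (Measure.le_iff.1 (le_iSup_of_le (f := fun U => ⨆ (φ : E2 → E3)
    (_ : IsLocalParam S U φ), Measure.map φ ((volume.restrict U).withDensity
      fun u => ENNReal.ofReal √(firstForm φ u).det)) U
    (le_iSup_of_le φ (le_iSup_of_le h le_rfl))) E hE)
  rw [Measure.map_apply_of_aemeasurable hφ hE, withDensity_apply' _ _,
    Measure.restrict_restrict' h.isOpen.measurableSet, inter_comm]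

variable [IsManifold (𝓡 2) ∞ N]

theorem IsSurface.isLocalParam {f : N → E3} (hf : IsSurface f) (hinj : Function.Injective f) (c : N) :
    IsLocalParam (range f) (ch c).target (inChart f c) where
  isOpen := isOpen_extChartAt_target c
  smooth := contDiffOn_inChart hf.smooth c
  injOn _ hu _ hv huv := (ch c).symm.injOn hu hv (hinj huv)
  immersion _ hu := injective_of_areaVec_ne_zero (hf.areaVec_ne hu)
  mapsTo u _ := ⟨mem_range_self _, inChart_pos hf c u⟩

variable [MeasurableSpace N] [BorelSpace N] [CompactSpace N]

/-- Charts composed with `f` are local parametrizations of its range. The images of disjoint chart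
pieces are disjoint by injectivity, so the individual lower bounds add up. -/
theorem ofReal_hArea_le_area {f : N → E3} (hf : IsSurface f) (hinj : Function.Injective f)
    {cs : ℕ → N} (hcs : ⋃ k, (ch (cs k)).source = univ) :
    ENNReal.ofReal (hArea f f cs) ≤ area (range f) := by
  have := isFiniteMeasure_areaMeas hf hcs
  have hc := continuous_hjac hf hf
  have hemb : MeasurableEmbedding f :=
    (hf.smooth.continuous.isClosedEmbedding hinj).measurableEmbedding
  set B : ℕ → Set N := disjointed fun k => (ch (cs k)).source with hB
  have hBm : ∀ k, MeasurableSet (B k) :=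
    MeasurableSet.disjointed fun k => measurableSet_source (cs k)
  rw [hArea, ofReal_integral_eq_lintegral_ofReal
    (hc.integrable_of_hasCompactSupport (HasCompactSupport.of_compactSpace _))
    (Eventually.of_forall fun x => (hjac_pos hf hf x).le), ← setLIntegral_univ, ← hcs,
    ← iUnion_disjointed, lintegral_iUnion hBm (disjoint_disjointed _)]
  have hdis : Pairwise (Function.onFun Disjoint fun k => f '' B k) := fun i j hij =>
    (disjoint_image_iff hinj).2 (disjoint_disjointed _ hij)
  refine le_trans ?_ (measure_mono (subset_univ (⋃ k, f '' B k)))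
  rw [measure_iUnion hdis fun k => hemb.measurableSet_image.2 (hBm k)]
  refine ENNReal.tsum_le_tsum fun k => ?_
  refine le_trans (le_of_eq ?_) ((hf.isLocalParam hinj (cs k)).setLIntegral_le_areaMeasure
    (hemb.measurableSet_image.2 (hBm k)))
  have hsub : B k ⊆ (ch (cs k)).source := disjointed_subset _ _
  have h1 := lintegral_areaMeas hf hf hcs (hBm k) hsub
    (h := fun x => ENNReal.ofReal (1 / f x 2 ^ 2))
    ((continuous_const.div ((continuous_coord hf.smooth.continuous 2).pow 2)
      fun x => pow_ne_zero 2 (hf.pos x).ne').measurable.ennreal_ofReal)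
  have h2 : inChart f (cs k) ⁻¹' (f '' B k) = (ch (cs k)).symm ⁻¹' B k := by
    rw [inChart, preimage_comp, preimage_image_eq _ hinj]
  rw [h2]
  refine Eq.trans ?_ (h1.trans ?_)
  · refine lintegral_congr fun x => ?_
    rw [← ENNReal.ofReal_mul (by positivity), hjac]
    congr 1; ring
  · refine lintegral_congr fun u => ?_
    rw [← ENNReal.ofReal_mul (by positivity), sqrt_firstForm_det]
    congr 1
    rw [inChart, Function.comp_apply]; ring

end

/-! ### The isoperimetric profile and the comparison along the flow -/

/-- The hyperbolic volume of the ball whose boundary has area `A`. -/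
def isoVol (A : ℝ) : ℝ :=
  2 * Real.pi * (√(A / (4 * Real.pi)) * √(1 + A / (4 * Real.pi)) -
    Real.arsinh √(A / (4 * Real.pi)))

theorem isoVol_zero : isoVol 0 = 0 := by simp [isoVol]

theorem isoVol_sinh {r : ℝ} (hr : 0 ≤ r) :
    isoVol (4 * Real.pi * Real.sinh r ^ 2) = 2 * Real.pi * (Real.sinh r * Real.cosh r - r) := by
  have hpi := Real.pi_pos
  have h1 : 4 * Real.pi * Real.sinh r ^ 2 / (4 * Real.pi) = Real.sinh r ^ 2 := by field_simp
  have h2 : 1 + Real.sinh r ^ 2 = Real.cosh r ^ 2 := by rw [Real.cosh_sq]; ring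
  rw [isoVol, h1, h2, Real.sqrt_sq (Real.sinh_nonneg_iff.2 hr), Real.sqrt_sq (Real.cosh_pos r).le,
    Real.arsinh_sinh]

theorem continuous_isoVol : Continuous isoVol := by
  unfold isoVol
  have : Continuous Real.arsinh := Real.continuous_arsinh
  fun_prop

/-- For spheres dV/dA = 1/(2 coth r), and √(A/(4π+A)) is tanh r. -/
theorem hasDerivAt_isoVol {A : ℝ} (hA : 0 < A) :
    HasDerivAt isoVol (√(A / (4 * Real.pi + A)) / 2) A := by
  have hpi := Real.pi_pos
  set s := A / (4 * Real.pi) with hs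
  have hs0 : 0 < s := by positivity
  have d0 : HasDerivAt (fun A : ℝ => A / (4 * Real.pi)) (1 / (4 * Real.pi)) A :=
    (hasDerivAt_id A).div_const _
  have d1 := d0.sqrt hs0.ne'
  have d2 := (d0.const_add 1).sqrt (by positivity)
  have d3 := (Real.hasDerivAt_arsinh √s).comp A d1
  refine (((d1.mul d2).sub d3).const_mul (2 * Real.pi)).congr_deriv ?_
  have e1 : A / (4 * Real.pi + A) = s / (1 + s) := by rw [hs]; field_simp
  have hx := Real.sqrt_pos.2 hs0
  have hy : 0 < √(1 + s) := Real.sqrt_pos.2 (by positivity)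
  rw [e1, Real.sqrt_div hs0.le, Real.sq_sqrt hs0.le]
  simp only [← hs]
  have hx2 := Real.sq_sqrt hs0.le
  have hy2 := Real.sq_sqrt (show 0 ≤ 1 + s by positivity)
  field_simp
  rw [hx2, hy2]; ring

theorem strictMonoOn_isoVol : StrictMonoOn isoVol (Ici 0) := by
  refine strictMonoOn_of_deriv_pos (convex_Ici 0) continuous_isoVol.continuousOn fun A hA => ?_
  rw [interior_Ici, mem_Ioi] at hA
  rw [(hasDerivAt_isoVol hA).deriv]
  have := Real.pi_pos
  positivity

theorem isoVol_nonneg {A : ℝ} (hA : 0 ≤ A) : 0 ≤ isoVol A := by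
  rw [← isoVol_zero]
  exact strictMonoOn_isoVol.monotoneOn self_mem_Ici hA hA

/-! ### The differential inequality for area and swept volume -/

section Comparison

variable {A W C : ℝ → ℝ} {T : ℝ}

/-- From c ≤ √(wa), it remains to see wa ≤ w²a/(4π+a), which is the Willmore bound multiplied by wa.
-/
theorem isoVol_comparison_deriv {a w c : ℝ} (ha : 0 < a) (hw : 4 * Real.pi + a ≤ w)
    (hc : c ^ 2 ≤ w * a) : c ≤ √(a / (4 * Real.pi + a)) * w := by
  have hpi := Real.pi_pos
  refine Real.le_sqrt_of_sq_le hc |>.trans ?_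
  have hw0 : 0 < w := by linarith
  rw [← Real.sqrt_sq hw0.le, ← Real.sqrt_mul (by positivity), Real.sqrt_sq hw0.le]
  refine Real.sqrt_le_sqrt ?_
  rw [div_mul_eq_mul_div, le_div_iff₀ (by positivity)]
  have := mul_le_mul_of_nonneg_left hw (by positivity : 0 ≤ w * a)
  nlinarith

theorem isoVol_comparison_deriv_lt {a w c : ℝ} (ha : 0 < a) (hw : 4 * Real.pi + a < w)
    (hc : c ^ 2 ≤ w * a) : c < √(a / (4 * Real.pi + a)) * w := by
  have hpi := Real.pi_pos
  refine (Real.le_sqrt_of_sq_le hc).trans_lt ?_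
  have hw0 : 0 < w := by linarith
  rw [← Real.sqrt_sq hw0.le, ← Real.sqrt_mul (by positivity), Real.sqrt_sq hw0.le]
  refine Real.sqrt_lt_sqrt (by positivity) ?_
  rw [div_mul_eq_mul_div, lt_div_iff₀ (by positivity)]
  have := mul_lt_mul_of_pos_left hw (by positivity : 0 < w * a)
  nlinarith

theorem continuousOn_isoVol_add (hAc : ContinuousOn A (Ico 0 T)) (hCc : ContinuousOn C (Ico 0 T)) :
    ContinuousOn (fun t => isoVol (A t) + ∫ s in (0 : ℝ)..t, C s) (Ico 0 T) := by
  refine (continuous_isoVol.comp_continuousOn hAc).add ?_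
  intro t ht
  obtain ⟨b, hb, hbT⟩ := exists_between ht.2
  have hsub : Icc 0 b ⊆ Ico 0 T := fun s hs => ⟨hs.1, hs.2.trans_lt hbT⟩
  have h0b : (0 : ℝ) ≤ b := ht.1.trans hb.le
  have h1 := intervalIntegral.continuousOn_primitive_interval (μ := volume) (a := 0) (b := b)
    (f := C) (by rw [uIcc_of_le h0b]; exact (hCc.mono hsub).integrableOn_Icc)
  rw [uIcc_of_le h0b] at h1
  refine (h1 t ⟨ht.1, hb.le⟩).mono_of_mem_nhdsWithin ?_
  filter_upwards [self_mem_nhdsWithin, nhdsWithin_le_nhds (Iio_mem_nhds hb)] with s hs hsb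
  exact ⟨hs.1, le_of_lt hsb⟩

theorem hasDerivAt_isoVol_add (hCc : ContinuousOn C (Ico 0 T)) {t : ℝ} (ht : t ∈ Ioo 0 T)
    (hA : 0 < A t) (hd : HasDerivAt A (-2 * W t) t) :
    HasDerivAt (fun t => isoVol (A t) + ∫ s in (0 : ℝ)..t, C s)
      (C t - √(A t / (4 * Real.pi + A t)) * W t) t := by
  have hi : IntervalIntegrable C volume 0 t := by
    refine ContinuousOn.intervalIntegrable ?_
    rw [uIcc_of_le ht.1.le]
    exact hCc.mono fun s hs => ⟨hs.1, hs.2.trans_lt ht.2⟩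
  have hco : ContinuousOn C (Ioo 0 T) := hCc.mono Ioo_subset_Ico_self
  have d2 := intervalIntegral.integral_hasDerivAt_right hi
    (hco.stronglyMeasurableAtFilter isOpen_Ioo t ht) (hco.continuousAt (isOpen_Ioo.mem_nhds ht))
  have d1 := (hasDerivAt_isoVol hA).comp t hd
  exact (d1.add d2).congr_deriv (by ring)

theorem antitoneOn_isoVol_add (hAc : ContinuousOn A (Ico 0 T)) (hCc : ContinuousOn C (Ico 0 T))
    (hA : ∀ t ∈ Ico 0 T, 0 < A t) (hd : ∀ t ∈ Ioo 0 T, HasDerivAt A (-2 * W t) t)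
    (hW : ∀ t ∈ Ico 0 T, 4 * Real.pi + A t ≤ W t) (hC : ∀ t ∈ Ico 0 T, C t ^ 2 ≤ W t * A t) :
    AntitoneOn (fun t => isoVol (A t) + ∫ s in (0 : ℝ)..t, C s) (Ico 0 T) := by
  have hD := fun t (ht : t ∈ Ioo 0 T) =>
    hasDerivAt_isoVol_add hCc ht (hA t (Ioo_subset_Ico_self ht)) (hd t ht)
  refine antitoneOn_of_deriv_nonpos (convex_Ico 0 T) (continuousOn_isoVol_add hAc hCc) ?_ ?_
  · rw [interior_Ico]
    exact fun t ht => (hD t ht).differentiableAt.differentiableWithinAt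
  · rw [interior_Ico]
    intro t ht
    have ht' := Ioo_subset_Ico_self ht
    rw [(hD t ht).deriv]
    linarith [isoVol_comparison_deriv (hA t ht') (hW t ht') (hC t ht')]

/-- A strict Willmore inequality at time 0 persists on a short interval by continuity, and there the
monotone quantity is strictly decreasing. -/
theorem exists_isoVol_add_lt (hAc : ContinuousOn A (Ico 0 T)) (hCc : ContinuousOn C (Ico 0 T))
    (hWc : ContinuousOn W (Ico 0 T)) (hT : 0 < T)
    (hA : ∀ t ∈ Ico 0 T, 0 < A t) (hd : ∀ t ∈ Ioo 0 T, HasDerivAt A (-2 * W t) t)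
    (hC : ∀ t ∈ Ico 0 T, C t ^ 2 ≤ W t * A t) (h0 : 4 * Real.pi + A 0 < W 0) :
    ∃ t ∈ Ico 0 T, isoVol (A t) + ∫ s in (0 : ℝ)..t, C s < isoVol (A 0) := by
  have h0T : (0 : ℝ) ∈ Ico 0 T := ⟨le_rfl, hT⟩
  have hev : ∀ᶠ t in 𝓝[Ico 0 T] (0 : ℝ), 4 * Real.pi + A t < W t :=
    ((hAc 0 h0T).const_add _).eventually_lt (hWc 0 h0T) h0
  obtain ⟨ε, hε, hb⟩ := Metric.mem_nhdsWithin_iff.1 hev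
  set b := min (ε / 2) (T / 2) with hbdef
  have hb0 : 0 < b := by positivity
  have hbε : b < ε := (min_le_left _ _).trans_lt (by linarith)
  have hbT : b < T := (min_le_right _ _).trans_lt (by linarith)
  have hsub : Icc 0 b ⊆ Ico 0 T := fun s hs => ⟨hs.1, hs.2.trans_lt hbT⟩
  have hanti : StrictAntiOn (fun t => isoVol (A t) + ∫ s in (0 : ℝ)..t, C s) (Icc 0 b) := by
    refine strictAntiOn_of_deriv_neg (convex_Icc 0 b)
      ((continuousOn_isoVol_add hAc hCc).mono hsub) ?_
    rw [interior_Icc]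
    intro t ht
    have ht' := hsub (Ioo_subset_Icc_self ht)
    have ht'' : t ∈ Ioo 0 T := ⟨ht.1, ht'.2⟩
    have hw : 4 * Real.pi + A t < W t := hb ⟨by
      rw [mem_ball_zero_iff, Real.norm_of_nonneg ht'.1]; exact ht.2.trans hbε, ht'⟩
    rw [(hasDerivAt_isoVol_add hCc ht'' (hA t ht') (hd t ht'')).deriv]
    linarith [isoVol_comparison_deriv_lt (hA t ht') hw (hC t ht')]
  refine ⟨b, ⟨hb0.le, hbT⟩, ?_⟩
  have := hanti (left_mem_Icc.2 hb0.le) (right_mem_Icc.2 hb0.le) hb0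
  simpa using this

end Comparison

/-! ### The isoperimetric bound along the flow -/

section Flow

variable {N : Type*} [TopologicalSpace N] [ChartedSpace E2 N] [IsManifold (𝓡 2) ∞ N]
variable [CompactSpace N] [MeasurableSpace N] [BorelSpace N]

theorem hArea_pos {f₀ f : N → E3} (h₀ : IsSurface f₀) (hf : IsSurface f) [Nonempty N]
    {cs : ℕ → N} (hcs : ⋃ k, (ch (cs k)).source = univ) : 0 < hArea f₀ f cs := by
  have := isFiniteMeasure_areaMeas h₀ hcs
  have := isOpenPosMeasure_areaMeas h₀ hcs
  obtain ⟨x⟩ := ‹Nonempty N›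
  exact (continuous_hjac h₀ hf).integral_pos_of_hasCompactSupport_nonneg_nonzero
    (HasCompactSupport.of_compactSpace _) (fun x => (hjac_pos h₀ hf x).le) (hjac_pos h₀ hf x).ne'

/-- Cauchy-Schwarz, obtained by expanding the nonnegative integral of (|H| - s)² with s the mean of
|H|. -/
theorem absCurv_sq_le {f₀ f v : N → E3} (h₀ : IsSurface f₀) (hf : IsSurface f)
    (hv : HasCurvatureVector f v) [Nonempty N] {cs : ℕ → N}
    (hcs : ⋃ k, (ch (cs k)).source = univ) :
    absCurv f₀ f v cs ^ 2 ≤ sqCurv f₀ f v cs * hArea f₀ f cs := by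
  have := isFiniteMeasure_areaMeas h₀ hcs
  have hA := hArea_pos h₀ hf hcs
  have hj := continuous_hjac h₀ hf
  have hq : Continuous fun x => ‖v x‖ / f x 2 :=
    hv.cont.norm.div (continuous_coord hf.smooth.continuous 2) fun x => (hf.pos x).ne'
  have hint : ∀ g : N → ℝ, Continuous g → Integrable g (areaMeas f₀ cs) := fun g hg =>
    hg.integrable_of_hasCompactSupport (HasCompactSupport.of_compactSpace _)
  set s := absCurv f₀ f v cs / hArea f₀ f cs with hs
  have h1 : 0 ≤ ∫ x, (‖v x‖ / f x 2 - s) ^ 2 * hjac f₀ f x ∂(areaMeas f₀ cs) :=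
    integral_nonneg fun x => mul_nonneg (sq_nonneg _) (hjac_pos h₀ hf x).le
  have h2 : ∫ x, (‖v x‖ / f x 2 - s) ^ 2 * hjac f₀ f x ∂(areaMeas f₀ cs) =
      sqCurv f₀ f v cs - 2 * s * absCurv f₀ f v cs + s ^ 2 * hArea f₀ f cs := by
    rw [sqCurv, absCurv, hArea, ← integral_const_mul, ← integral_const_mul, ← integral_sub,
      ← integral_add]
    · refine integral_congr_ae (Eventually.of_forall fun x => ?_)
      simp only [← div_pow]; ring
    · refine hint _ ?_
      simp only [← div_pow]; fun_prop
    · exact hint _ (by fun_prop)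
    · refine hint _ ?_
      simp only [← div_pow]; fun_prop
    · exact hint _ (by fun_prop)
  rw [h2] at h1
  have h3 : s * hArea f₀ f cs = absCurv f₀ f v cs := div_mul_cancel₀ _ hA.ne'
  have h4 := mul_nonneg h1 hA.le
  nlinarith

variable [T2Space N] {T : ℝ} {F : ℝ → N → E3}

/-- By monotonicity from t₀ on and `isoVol` ≥ 0, the total curvature integral up to any later t is
at most the value at t₀; then t → T removes the remaining enclosed volume. Time 0 gives the
inequality, a later t₀ the equality case. -/
theorem IsMeanCurvatureFlow.enclosedVolume_le_isoVol (hF : IsMeanCurvatureFlow T F) (hT : 0 < T)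
    (h0 : Function.Injective (F 0)) [Nonempty N] {cs : ℕ → N}
    (hcs : ⋃ k, (ch (cs k)).source = univ)
    (hV : Tendsto (fun t => enclosedVolume (range (F t))) (𝓝[<] T) (𝓝 0)) {t₀ : ℝ}
    (ht₀ : t₀ ∈ Ico 0 T) :
    enclosedVolume (range (F 0)) ≤ ENNReal.ofReal (isoVol (hArea (F 0) (F t₀) cs) +
      ∫ s in (0 : ℝ)..t₀, absCurv (F 0) (F s) (vel T F s) cs) := by
  have hS0 := hF.isSurface (t := 0) ⟨le_rfl, hT⟩
  have hanti := antitoneOn_isoVol_add (W := fun t => sqCurv (F 0) (F t) (vel T F t) cs)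
    (hF.continuousOn_hArea hT hcs) (hF.continuousOn_absCurv hT hcs)
    (fun t ht => hArea_pos hS0 (hF.isSurface ht) hcs) (fun t ht => hF.hasDerivAt_hArea hcs ht)
    (fun t ht => by
      have := willmore_ge hS0 (hF.isSurface ht) (hF.injective h0 ht) hcs (hF.hasCurvatureVector ht)
      change _ ≤ sqCurv (F 0) (F t) (vel T F t) cs - hArea (F 0) (F t) cs at this
      linarith)
    (fun t ht => absCurv_sq_le hS0 (hF.isSurface ht) (hF.hasCurvatureVector ht) hcs)
  set L := ENNReal.ofReal (isoVol (hArea (F 0) (F t₀) cs) +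
      ∫ s in (0 : ℝ)..t₀, absCurv (F 0) (F s) (vel T F s) cs) with hL
  have hlim : Tendsto (fun t => enclosedVolume (range (F t)) + L) (𝓝[<] T) (𝓝 (0 + L)) :=
    hV.add tendsto_const_nhds
  rw [zero_add] at hlim
  refine ge_of_tendsto hlim ?_
  filter_upwards [Ioo_mem_nhdsLT ht₀.2] with t ht
  have htT : t ∈ Ico 0 T := ⟨ht₀.1.trans ht.1.le, ht.2⟩
  refine (hF.enclosedVolume_le h0 htT).trans ?_
  gcongr
  refine (hF.hvolume_swept_le hcs htT).trans (ENNReal.ofReal_le_ofReal ?_)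
  have h1 := hanti ht₀ htT ht.1.le
  have h2 := isoVol_nonneg (hArea_pos hS0 (hF.isSurface htT) hcs).le
  simp only at h1
  linarith

end Flow

/-- The only component of the complement is all of space, which is unbounded. This excludes an empty
surface in the main theorem. -/
theorem enclosed_empty : enclosed ∅ = ∅ := by
  refine eq_empty_iff_forall_notMem.2 fun x hx => ?_
  have hx3 : x ∈ H3 := hx.1.1
  rw [mem_enclosed_iff isCompact_empty (empty_subset _) hx3 (notMem_empty x), compl_empty,
    connectedComponentIn_univ, PreconnectedSpace.connectedComponent_eq_univ] at hx
  exact NormedSpace.unbounded_univ ℝ E3 hx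

theorem exists_chart_cover (N : Type*) [TopologicalSpace N] [ChartedSpace E2 N] [CompactSpace N]
    [Nonempty N] : ∃ cs : ℕ → N, ⋃ k, (ch (cs k)).source = univ := by
  obtain ⟨s, hs⟩ := isCompact_univ.elim_finite_subcover (fun x : N => (ch x).source)
    (fun x => isOpen_extChartAt_source x)
    fun x _ => mem_iUnion.2 ⟨x, mem_extChartAt_source x⟩
  have hne : s.Nonempty := by
    rw [Finset.nonempty_iff_ne_empty]
    rintro rfl
    obtain ⟨x⟩ := ‹Nonempty N›
    simpa using hs (mem_univ x)
  obtain ⟨cs, hcs⟩ := s.countable_toSet.exists_eq_range hne.to_set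
  refine ⟨cs, eq_univ_of_univ_subset fun x hx => ?_⟩
  obtain ⟨y, hy, hxy⟩ := mem_iUnion₂.1 (hs hx)
  obtain ⟨k, rfl⟩ : y ∈ range cs := hcs ▸ hy
  exact mem_iUnion.2 ⟨k, hxy⟩

end Hyp3
end

/-! ### The isoperimetric inequality and its equality case -/

open Hyp3 in
theorem theorem4p1 {N : Type*} [TopologicalSpace N] [ChartedSpace Hyp3.E2 N]
    [IsManifold (𝓡 2) ∞ N] [CompactSpace N] [T2Space N]
    (F₀ : N → Hyp3.E3)
    (hF₀ : Manifold.IsSmoothEmbedding (𝓡 2) 𝓘(ℝ, Hyp3.E3) ∞ F₀)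
    (hmem : ∀ x, F₀ x ∈ Hyp3.H3)
    (hflow : Hyp3.NoSingularityBeforeVolumeVanishes F₀)
    (p : Hyp3.E3) (hp : p ∈ Hyp3.H3) (r : ℝ) (hr : 0 < r)
    (hvol : Hyp3.enclosedVolume (Hyp3.geodesicSphere p r) = Hyp3.enclosedVolume (range F₀)) :
    Hyp3.area (Hyp3.geodesicSphere p r) ≤ Hyp3.area (range F₀) ∧
      (Hyp3.area (range F₀) = Hyp3.area (Hyp3.geodesicSphere p r) →
        ∃ q ∈ Hyp3.H3, ∃ ρ : ℝ, 0 < ρ ∧ range F₀ = Hyp3.geodesicSphere q ρ) := by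
  have hpi := Real.pi_pos
  have hsinh := Real.sinh_pos_iff.2 hr
  set a : ℝ := 4 * Real.pi * Real.sinh r ^ 2 with ha
  have ha0 : 0 < a := by positivity
  have hVlow : ENNReal.ofReal (isoVol a) ≤ enclosedVolume (range F₀) := by
    rw [← hvol, ha, isoVol_sinh hr.le]
    exact ofReal_le_enclosedVolume_geodesicSphere hp hr
  have hiso : 0 < isoVol a := by
    rw [← isoVol_zero]
    exact strictMonoOn_isoVol self_mem_Ici ha0.le ha0
  -- An empty surface encloses no volume, whereas the comparison sphere encloses a positive one.
  rcases isEmpty_or_nonempty N with hN | hN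
  · rw [range_eq_empty, enclosedVolume, enclosed_empty, hvolume, Measure.restrict_empty,
      lintegral_zero_measure] at hVlow
    exact absurd hVlow (not_le.2 (ENNReal.ofReal_pos.2 hiso))
  let _ : MeasurableSpace N := borel N
  have : BorelSpace N := ⟨rfl⟩
  obtain ⟨cs, hcs⟩ := exists_chart_cover N
  obtain ⟨T, hT, F, rfl, hF, hV⟩ := hflow
  have hinj : Function.Injective (F 0) := hF₀.isEmbedding.injective
  have h0T : (0 : ℝ) ∈ Ico 0 T := ⟨le_rfl, hT⟩
  have hS0 := hF.isSurface h0T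
  set A : ℝ := hArea (F 0) (F 0) cs with hA
  have hA0 : 0 < A := hArea_pos hS0 hS0 hcs
  -- Positivity of `isoVol a` is needed to pass from extended nonnegative to real numbers, since
  -- `ENNReal.ofReal` forgets negative values.
  have hbound : ∀ t ∈ Ico 0 T, isoVol a ≤ isoVol (hArea (F 0) (F t) cs) +
      ∫ s in (0 : ℝ)..t, absCurv (F 0) (F s) (vel T F s) cs := fun t ht =>
    (ENNReal.ofReal_le_ofReal_iff'.1 (hVlow.trans
      (hF.enclosedVolume_le_isoVol hT hinj hcs hV ht))).resolve_right (not_le.2 hiso)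
  have haA : a ≤ A := by
    have := hbound 0 h0T
    rw [intervalIntegral.integral_same, add_zero] at this
    exact (strictMonoOn_isoVol.le_iff_le ha0.le hA0.le).1 this
  have harea := area_geodesicSphere_le hp hr
  have hrange := ofReal_hArea_le_area hS0 hinj hcs
  refine ⟨harea.trans ((ENNReal.ofReal_le_ofReal haA).trans hrange), fun heq => ?_⟩
  have hAa : A = a := le_antisymm ((ENNReal.ofReal_le_ofReal_iff ha0.le).1
    (hrange.trans (heq.le.trans harea))) haA
  have hv := hF.hasCurvatureVector h0T
  -- Equality of areas leaves no slack at time 0; a strict Willmore inequality there would push the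
  -- bound below `isoVol a` at some later time.
  have hW : sqCurv (F 0) (F 0) (vel T F 0) cs - hArea (F 0) (F 0) cs ≤ 4 * Real.pi := by
    by_contra! hlt
    obtain ⟨t, ht, hlt'⟩ := exists_isoVol_add_lt
      (A := fun t => hArea (F 0) (F t) cs) (C := fun t => absCurv (F 0) (F t) (vel T F t) cs)
      (W := fun t => sqCurv (F 0) (F t) (vel T F t) cs)
      (hF.continuousOn_hArea hT hcs) (hF.continuousOn_absCurv hT hcs)
      (hF.continuousOn_sqCurv hT hcs) hT
      (fun t ht => hArea_pos hS0 (hF.isSurface ht) hcs) (fun t ht => hF.hasDerivAt_hArea hcs ht)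
      (fun t ht => absCurv_sq_le hS0 (hF.isSurface ht) (hF.hasCurvatureVector ht) hcs)
      (by linarith)
    refine absurd (hbound t ht) (not_le.2 (hlt'.trans_eq ?_))
    exact congrArg isoVol hAa
  exact exists_geodesicSphere_of_deviation hS0
    (fun x y hxy => deviation_eq_zero hS0 hS0 hinj hcs hv hW hxy) hinj
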